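/- Let $\Omega$ be the metric graph with vertices $v_1,v_2,v_3,v_4$ and edges $e_1,e_2,e_3,e_4$ of lengths $l_1,\dots,l_4>0$, where $e_1$ joins $v_1$ and $v_2$, both $e_2$ and $e_3$ join $v_2$ and $v_3$, and $e_4$ joins $v_3$ and $v_4$ (a ring with two attached edges). Each edge $e_j$ is identified with $(0,l_j)$ by arclength, and carries a bounded continuous real potential $q_j$ on $(0,l_j)$. For $\tau>0$ and $f\in L^2(0,\tau)$ consider the problem $$u_{tt}-u_{xx}+q(x)u=0 \ \text{ on the edges, } 0<t<\tau,\qquad u(v_1,t)=f(t),\quad u(v_4,t)=0,$$ with $u$ continuous at $v_2$ and $v_3$, with the Kirchhoff--Neumann condition $\sum_{j}\partial u_j(v_i,t)=0$ (sum over the edges at $v_i$ of the derivatives pointing away from $v_i$) for $i=2,3$, and with $u|_{t=0}=u_t|_{t=0}=0$. A generalized solution is a function $u\in C([0,\tau];L^2(\Omega))$ such that $$\sum_{j=1}^4\int_0^\tau\!\!\int_0^{l_j}u_j\,(\varphi_{j,tt}-\varphi_{j,xx}+q_j\varphi_j)\,dx\,dt=\int_0^\tau f(t)\,\partial\varphi_1(v_1,t)\,dt$$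 for every $\varphi$ that is $C^2$ up to the boundary on each $[0,l_j]\times[0,\tau]$, vanishes at $v_1$ and $v_4$, is continuous and satisfies the Kirchhoff--Neumann condition at $v_2$ and $v_3$, and satisfies $\varphi=\varphi_t=0$ at $t=\tau$. Its trace $u(v_2,\cdot)$ is the common limit in $L^2(0,\tau)$ of $u_j(x,\cdot)$ as $x\to v_2$ along $e_j$ (over almost every $x$), $j=1,2,3$. Let $T>0$ and $\tau=T+l_1$. For every $f\in L^2(0,T)$, extended in any way to an element of $L^2(0,T+l_1)$, there is a unique generalized solution $u^f$ on $[0,T+l_1]$; it has a trace $u^f(v_2,\cdot)\in L^2(0,T+l_1)$, whose restriction to $(l_1,T+l_1)$ depends only on $f$ (on $(0,T)$), not on the extension. The map $$f\mapsto u^f(v_2,\cdot)\big|_{(l_1,T+l_1)}$$ so defined is a surjection from $L^2(0,T)$ onto $L^2(l_1,T+l_1)$. -/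

import Mathlib

open MeasureTheory Set Filter Topology

namespace RingGraph

/-! The metric graph: a ring with two attached edges. The four vertices are `v₁, v₂, v₃, v₄`, and
the edges are parametrized by arclength as follows (`x = 0` at the first named vertex, `x = l j` at
the second one):

* `e₁` joins `v₂` to the boundary vertex `v₁`;
* `e₂` and `e₃` both join `v₂` to `v₃` and form the ring;
* `e₄` joins `v₃` to the boundary vertex `v₄`.

A function on the graph is a family of functions of `x`, one for each edge. -/

/-- The edge from `v₂` (at `x = 0`) to the boundary vertex `v₁` (at `x = l e₁`). -/
abbrev e₁ : Fin 4 := 0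

/-- One of the two edges from `v₂` (at `x = 0`) to `v₃` (at `x = l e₂`). -/
abbrev e₂ : Fin 4 := 1

/-- The other edge from `v₂` (at `x = 0`) to `v₃` (at `x = l e₃`). -/
abbrev e₃ : Fin 4 := 2

/-- The edge from `v₃` (at `x = 0`) to the boundary vertex `v₄` (at `x = l e₄`). -/
abbrev e₄ : Fin 4 := 3

/-- Test functions `φ j x t` (edge, position, time) of the time interval `[0, τ]`: twice
continuously differentiable up to the boundary on every edge, satisfying the homogeneous Dirichlet
conditions at `v₁` and `v₄`, continuity and the Kirchhoff–Neumann condition at `v₂` and `v₃`, and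
zero terminal conditions at `t = τ`. -/
structure IsTestFunction (l : Fin 4 → ℝ) (τ : ℝ) (φ : Fin 4 → ℝ → ℝ → ℝ) : Prop where
  smooth : ∀ j, ContDiff ℝ 2 (fun p : ℝ × ℝ => φ j p.1 p.2)
  dirichlet_v₁ : ∀ t ∈ Icc 0 τ, φ e₁ (l e₁) t = 0
  dirichlet_v₄ : ∀ t ∈ Icc 0 τ, φ e₄ (l e₄) t = 0
  continuous_v₂ : ∀ t ∈ Icc 0 τ, φ e₁ 0 t = φ e₂ 0 t ∧ φ e₂ 0 t = φ e₃ 0 t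
  continuous_v₃ : ∀ t ∈ Icc 0 τ, φ e₂ (l e₂) t = φ e₃ (l e₃) t ∧ φ e₃ (l e₃) t = φ e₄ 0 t
  kirchhoff_v₂ : ∀ t ∈ Icc 0 τ,
    deriv (fun x => φ e₁ x t) 0 + deriv (fun x => φ e₂ x t) 0 + deriv (fun x => φ e₃ x t) 0 = 0
  kirchhoff_v₃ : ∀ t ∈ Icc 0 τ,
    -deriv (fun x => φ e₂ x t) (l e₂) - deriv (fun x => φ e₃ x t) (l e₃)
      + deriv (fun x => φ e₄ x t) 0 = 0
  terminal : ∀ j, ∀ x ∈ Icc 0 (l j), φ j x τ = 0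
  terminal_deriv : ∀ j, ∀ x ∈ Icc 0 (l j), deriv (fun t => φ j x t) τ = 0

/-- `u` (as a function `u j x t` of edge, position and time) is a generalized solution on the time
interval `[0, τ]` of
`u_tt - u_xx + q u = 0` on the edges, `u(v₁, t) = f t`, `u(v₄, t) = 0`,
`u` continuous and satisfying the Kirchhoff–Neumann condition at `v₂` and `v₃`, `u = u_t = 0` at
`t = 0`: it lies in `C([0, τ]; L²(Ω))`, where `L²(Ω)` is the direct sum of the spaces
`L²(0, l j)`, and satisfies the integral identity obtained by multiplying with a test function and
integrating by parts. In the latter, `-deriv (fun x => φ e₁ x t) (l e₁)` is the derivative of the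
test function at `v₁` pointing away from `v₁` along `e₁`. -/
structure IsGeneralizedSolution (l : Fin 4 → ℝ) (q : Fin 4 → ℝ → ℝ) (τ : ℝ) (f : ℝ → ℝ)
    (u : Fin 4 → ℝ → ℝ → ℝ) : Prop where
  measurable : ∀ j, AEStronglyMeasurable (fun p : ℝ × ℝ => u j p.1 p.2)
    (volume.restrict (Ioo 0 (l j) ×ˢ Ioo 0 τ))
  memLp : ∀ j, ∀ t ∈ Icc 0 τ, MemLp (fun x => u j x t) 2 (volume.restrict (Ioo 0 (l j)))
  continuous : ∀ j, ∀ t₀ ∈ Icc 0 τ,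
    Tendsto (fun t => eLpNorm (fun x => u j x t - u j x t₀) 2 (volume.restrict (Ioo 0 (l j))))
      (𝓝[Icc 0 τ] t₀) (𝓝 0)
  weak : ∀ φ, IsTestFunction l τ φ →
    ∑ j, ∫ t in (0 : ℝ)..τ, ∫ x in (0 : ℝ)..l j,
        u j x t * (iteratedDeriv 2 (fun s => φ j x s) t - iteratedDeriv 2 (fun y => φ j y t) x
          + q j x * φ j x t)
      = ∫ t in (0 : ℝ)..τ, f t * -deriv (fun x => φ e₁ x t) (l e₁)

/-- `o` is the trace `t ↦ u(v₂, t)` on `(0, τ)`: along each of the three edges at `v₂`, the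
functions `u j x ·` converge to `o` in `L²(0, τ)` as `x → 0⁺` (the limit being an essential limit,
over almost every `x`). -/
def IsTraceAtV₂ (τ : ℝ) (u : Fin 4 → ℝ → ℝ → ℝ) (o : ℝ → ℝ) : Prop :=
  MemLp o 2 (volume.restrict (Ioo 0 τ)) ∧
    ∀ j ∈ ({e₁, e₂, e₃} : Set (Fin 4)),
      Tendsto (fun x => eLpNorm (fun t => u j x t - o t) 2 (volume.restrict (Ioo 0 τ)))
        (𝓝[>] (0 : ℝ) ⊓ ae volume) (𝓝 0)

end RingGraph

namespace RingGraph

/-! On edge `j` a solution is written as two free waves plus a retarded potential: u = P(j,false)(t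
- x) + P(j,true)(t - (l j - x)) + the Duhamel integral of h j, where h = -q u (`wave`). The vertex
conditions then become algebraic relations at each instant, expressing the profiles leaving a vertex
through the waves arriving there (`scatter`). An arriving wave left its vertex at least min l
earlier, so on a bounded time interval this delay system is solved exactly by a finite Neumann
series (`profile_eq`). Integration along characteristics shows that such waves satisfy the weak
identity (`sum_integral_wave_mul_box`).

What remains is the equation h = -q u for the source. The value of u at a point is bounded by the
data and by a multiple of the L¹ mass of h in the past of that point (`enorm_profile_le`,
`enorm_wave_le`). In an exponentially weighted L¹ space this gives a contraction
(`exists_fixedPoint_source`), and also a Gronwall inequality (`ae_eq_zero_of_le_pastMass`).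

Uniqueness is by duality. The same construction with smooth sources, run backwards in time, yields
test functions φ with arbitrary smooth compactly supported φ_tt - φ_xx. So the difference of two
solutions is itself a wave with source -q times that difference, and Gronwall applies
(`IsGeneralizedSolution.ae_eq_prod`).

"Past" is measured in a time t - δ j x with δ of Lipschitz constant 1 (`IsFrame`). The choice δ = 0
gives existence and uniqueness. The choice `delay` gives data at v₁ at time t and values at v₂ at
time t + l 0 the same frame time; the estimates then say that the trace before T + l 0 depends only
on f before T (`mildTrace_eq`).

For surjectivity the trace o at v₂ is prescribed, zero up to time l 0. The ring with e₄ becomes a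
separate problem with Dirichlet data o at v₂. The Kirchhoff condition at v₂ then supplies full
Cauchy data for e₁ at v₂, and on e₁ the wave equation is solved sideways, in x instead of t. The
value reached at v₁ is the required control. All of this is causal in the frame `delay`, so the same
fixed point argument produces the source (`exists_isTraceAtV₂`), and uniqueness identifies the trace
obtained with the image of the control. -/

/-! ### The Duhamel integral of the wave equation on the line -/

/-- The fundamental solution of the wave equation on the line: `1 / 2` on the forward light cone. -/
noncomputable def lightCone (p : ℝ × ℝ) : ℝ := if |p.1| ≤ p.2 then 1 / 2 else 0

/-- The solution of `w_tt - w_xx = h` on the line which vanishes in the past. -/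
noncomputable def duhamel (h : ℝ × ℝ → ℝ) (x t : ℝ) : ℝ := ∫ p, h p * lightCone ((x, t) - p)

lemma measurable_lightCone : Measurable lightCone := by
  unfold lightCone
  exact Measurable.ite (measurableSet_le (by fun_prop) (by fun_prop)) measurable_const
    measurable_const

lemma abs_lightCone_le (p : ℝ × ℝ) : |lightCone p| ≤ 1 / 2 := by
  unfold lightCone; split_ifs <;> norm_num

lemma lightCone_of_lt {p : ℝ × ℝ} (h : p.2 < |p.1|) : lightCone p = 0 := by
  unfold lightCone; rw [if_neg (not_le.2 h)]

lemma integrable_mul_lightCone {h : ℝ × ℝ → ℝ} (hh : Integrable h) (z : ℝ × ℝ) :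
    Integrable (fun p => h p * lightCone (z - p)) := by
  refine hh.mul_bdd (c := 1 / 2) ?_ (ae_of_all _ fun p => by simpa using abs_lightCone_le _)
  exact (measurable_lightCone.comp (measurable_const.sub measurable_id)).aestronglyMeasurable

/-- For almost every `p`, the light cone with vertex `p` does not have `z` on its boundary. -/
lemma ae_continuousAt_lightCone (z : ℝ × ℝ) :
    ∀ᵐ p : ℝ × ℝ, ContinuousAt (fun w : ℝ × ℝ => lightCone (w - p)) z := by
  have hms : MeasurableSet {p : ℝ × ℝ | |z.1 - p.1| ≠ z.2 - p.2} :=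
    (measurableSet_eq_fun (by fun_prop) (by fun_prop)).compl
  have hnull : ∀ᵐ p : ℝ × ℝ, |z.1 - p.1| ≠ z.2 - p.2 := by
    rw [Measure.volume_eq_prod, Measure.ae_prod_iff_ae_ae hms]
    refine ae_of_all _ fun y => ?_
    have : ∀ᵐ s : ℝ, s ≠ z.2 - |z.1 - y| := by
      simp [ae_iff]
    filter_upwards [this] with s hs h
    apply hs; linarith
  filter_upwards [hnull] with p hp
  rcases lt_or_gt_of_ne hp with h | h
  · have : ∀ᶠ w : ℝ × ℝ in 𝓝 z, |w.1 - p.1| < w.2 - p.2 :=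
      (by fun_prop : Continuous fun w : ℝ × ℝ => |w.1 - p.1|).continuousAt.eventually_lt
        (by fun_prop : Continuous fun w : ℝ × ℝ => w.2 - p.2).continuousAt h
    refine (continuousAt_const (y := (1 / 2 : ℝ))).congr ?_
    filter_upwards [this] with w hw
    simp [lightCone, hw.le]
  · have : ∀ᶠ w : ℝ × ℝ in 𝓝 z, w.2 - p.2 < |w.1 - p.1| :=
      (by fun_prop : Continuous fun w : ℝ × ℝ => w.2 - p.2).continuousAt.eventually_lt
        (by fun_prop : Continuous fun w : ℝ × ℝ => |w.1 - p.1|).continuousAt h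
    refine (continuousAt_const (y := (0 : ℝ))).congr ?_
    filter_upwards [this] with w hw
    simp [lightCone, hw]

/-- The jump of `lightCone` is invisible to the integral: for almost every p the boundary of the
cone with vertex p misses the given point. Dominated convergence thus gives continuity for merely
integrable sources. -/
lemma continuous_duhamel {h : ℝ × ℝ → ℝ} (hh : Integrable h) :
    Continuous fun p : ℝ × ℝ => duhamel h p.1 p.2 := by
  rw [continuous_iff_continuousAt]
  intro z
  refine continuousAt_of_dominated (bound := fun p => ‖h p‖ * (1 / 2)) ?_ ?_ ?_ ?_
  · exact Eventually.of_forall fun w => (integrable_mul_lightCone hh _).aestronglyMeasurable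
  · refine Eventually.of_forall fun w => ae_of_all _ fun p => ?_
    rw [norm_mul]
    gcongr
    exact abs_lightCone_le _
  · exact hh.norm.mul_const _
  · filter_upwards [ae_continuousAt_lightCone z] with p hp
    exact continuousAt_const.mul hp

/-- Only sources in the backward light cone contribute, and the kernel is at most 1. All estimates
on the speed of propagation start here. -/
lemma enorm_duhamel_le (h : ℝ × ℝ → ℝ) (x t : ℝ) :
    ‖duhamel h x t‖ₑ ≤ ∫⁻ p in {p : ℝ × ℝ | |x - p.1| ≤ t - p.2}, ‖h p‖ₑ := by
  have hms : MeasurableSet {p : ℝ × ℝ | |x - p.1| ≤ t - p.2} :=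
    measurableSet_le (by fun_prop) (by fun_prop)
  refine (enorm_integral_le_lintegral_enorm _).trans ?_
  rw [← lintegral_indicator hms]
  refine lintegral_mono fun p => ?_
  by_cases hp : |x - p.1| ≤ t - p.2
  · rw [indicator_of_mem (by exact hp), enorm_mul]
    refine mul_le_of_le_one_right' ?_
    rw [← ofReal_norm, ENNReal.ofReal_le_one]
    exact (abs_lightCone_le _).trans (by norm_num)
  · simp only [lightCone]
    simp [hp]

lemma duhamel_sub {h h' : ℝ × ℝ → ℝ} (hh : Integrable h) (hh' : Integrable h') (x t : ℝ) :
    duhamel (fun p => h p - h' p) x t = duhamel h x t - duhamel h' x t := by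
  unfold duhamel
  rw [← integral_sub (integrable_mul_lightCone hh _) (integrable_mul_lightCone hh' _)]
  simp only [sub_mul]

/-- To the left of all sources the Duhamel integral is a free wave travelling to the left. This is
what allows the space derivative at a vertex to be expressed through the arriving wave. -/
lemma duhamel_of_le {h : ℝ × ℝ → ℝ} {x x' : ℝ} (hs : ∀ p, h p ≠ 0 → x ≤ p.1) (hx : x' ≤ x)
    (t : ℝ) : duhamel h x' t = duhamel h x (t - (x - x')) := by
  unfold duhamel
  congr 1; ext p
  by_cases hp : h p = 0
  · simp [hp]
  · have := hs p hp
    congr 1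
    simp only [lightCone, Prod.fst_sub, Prod.snd_sub]
    refine if_congr ?_ rfl rfl
    rw [abs_of_nonpos (by linarith), abs_of_nonpos (by linarith)]
    constructor <;> intro h <;> linarith

lemma duhamel_of_ge {h : ℝ × ℝ → ℝ} {x x' : ℝ} (hs : ∀ p, h p ≠ 0 → p.1 ≤ x) (hx : x ≤ x')
    (t : ℝ) : duhamel h x' t = duhamel h x (t - (x' - x)) := by
  unfold duhamel
  congr 1; ext p
  by_cases hp : h p = 0
  · simp [hp]
  · have := hs p hp
    congr 1
    simp only [lightCone, Prod.fst_sub, Prod.snd_sub]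
    refine if_congr ?_ rfl rfl
    rw [abs_of_nonneg (by linarith), abs_of_nonneg (by linarith)]
    constructor <;> intro h <;> linarith

/-- Exchanging the order of integration between the Duhamel integral and a pairing along a family
of points `z`. -/
lemma integral_duhamel_mul {α : Type*} [MeasurableSpace α] {μ : Measure α} [SFinite μ]
    {h : ℝ × ℝ → ℝ} (hh : Integrable h) {z : α → ℝ × ℝ} (hz : Measurable z) {g : α → ℝ}
    (hg : Integrable g μ) :
    ∫ a, duhamel h (z a).1 (z a).2 * g a ∂μ
      = ∫ p, h p * ∫ a, lightCone (z a - p) * g a ∂μ := by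
  have hint : Integrable (fun q : α × (ℝ × ℝ) => h q.2 * lightCone (z q.1 - q.2) * g q.1)
      (μ.prod volume) := by
    have h1 : Integrable (fun q : α × (ℝ × ℝ) => g q.1 * h q.2) (μ.prod volume) := hg.mul_prod hh
    have h2 := h1.mul_bdd (c := 1 / 2) (g := fun q : α × (ℝ × ℝ) => lightCone (z q.1 - q.2))
      (measurable_lightCone.comp
        ((hz.comp measurable_fst).sub measurable_snd)).aestronglyMeasurable
      (ae_of_all _ fun p => by simpa using abs_lightCone_le _)
    refine h2.congr (ae_of_all _ fun q => ?_)
    simp only; ring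
  calc ∫ a, duhamel h (z a).1 (z a).2 * g a ∂μ
      = ∫ a, ∫ p, h p * lightCone (z a - p) * g a ∂volume ∂μ := by
        refine integral_congr_ae (ae_of_all _ fun a => ?_)
        simp only
        rw [integral_mul_const]; rfl
    _ = ∫ p, ∫ a, h p * lightCone (z a - p) * g a ∂μ := integral_integral_swap hint
    _ = _ := by
        refine integral_congr_ae (ae_of_all _ fun p => ?_)
        simp only [mul_assoc, integral_const_mul]

/-! ### Derivatives along characteristics -/

/-- The time derivative of a function of `(x, t)`. -/
noncomputable def dt (φ : ℝ × ℝ → ℝ) (p : ℝ × ℝ) : ℝ := fderiv ℝ φ p (0, 1)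

/-- The space derivative of a function of `(x, t)`. -/
noncomputable def dx (φ : ℝ × ℝ → ℝ) (p : ℝ × ℝ) : ℝ := fderiv ℝ φ p (1, 0)

/-- The wave operator `φ_tt - φ_xx`. -/
noncomputable def box (φ : ℝ × ℝ → ℝ) (p : ℝ × ℝ) : ℝ :=
  iteratedDeriv 2 (fun s => φ (p.1, s)) p.2 - iteratedDeriv 2 (fun y => φ (y, p.2)) p.1

section
variable {φ : ℝ × ℝ → ℝ}

lemma hasDerivAt_time (hφ : Differentiable ℝ φ) (x t : ℝ) :
    HasDerivAt (fun s => φ (x, s)) (dt φ (x, t)) t := by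
  have h1 : HasDerivAt (fun s : ℝ => (x, s)) ((0 : ℝ), (1 : ℝ)) t :=
    (hasDerivAt_const t x).prodMk (hasDerivAt_id t)
  exact (hφ (x, t)).hasFDerivAt.comp_hasDerivAt t h1

lemma hasDerivAt_space (hφ : Differentiable ℝ φ) (x t : ℝ) :
    HasDerivAt (fun y => φ (y, t)) (dx φ (x, t)) x := by
  have h1 : HasDerivAt (fun s : ℝ => (s, t)) ((1 : ℝ), (0 : ℝ)) x :=
    (hasDerivAt_id x).prodMk (hasDerivAt_const x t)
  exact (hφ (x, t)).hasFDerivAt.comp_hasDerivAt x h1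

lemma contDiff_dt {n : WithTop ℕ∞} (hφ : ContDiff ℝ (n + 1) φ) : ContDiff ℝ n (dt φ) :=
  (hφ.fderiv_right le_rfl).clm_apply contDiff_const

lemma contDiff_dx {n : WithTop ℕ∞} (hφ : ContDiff ℝ (n + 1) φ) : ContDiff ℝ n (dx φ) :=
  (hφ.fderiv_right le_rfl).clm_apply contDiff_const

lemma dt_dx_eq (hφ : ContDiff ℝ 2 φ) (p : ℝ × ℝ) : dt (dx φ) p = dx (dt φ) p := by
  have hF : DifferentiableAt ℝ (fderiv ℝ φ) p :=
    ((hφ.fderiv_right (m := 1) (by norm_num)).differentiable (by norm_num)) p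
  have hs : IsSymmSndFDerivAt ℝ φ p := hφ.contDiffAt.isSymmSndFDerivAt (by simp)
  have e1 : fderiv ℝ (dx φ) p (0, 1) = fderiv ℝ (fderiv ℝ φ) p (0, 1) (1, 0) := by
    have : HasFDerivAt (dx φ) _ p := hF.hasFDerivAt.clm_apply (hasFDerivAt_const ((1 : ℝ), (0 : ℝ)) p)
    rw [this.fderiv]; simp
  have e2 : fderiv ℝ (dt φ) p (1, 0) = fderiv ℝ (fderiv ℝ φ) p (1, 0) (0, 1) := by
    have : HasFDerivAt (dt φ) _ p := hF.hasFDerivAt.clm_apply (hasFDerivAt_const ((0 : ℝ), (1 : ℝ)) p)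
    rw [this.fderiv]; simp
  change fderiv ℝ (dx φ) p (0, 1) = fderiv ℝ (dt φ) p (1, 0)
  rw [e1, e2]
  exact hs _ _

lemma box_eq (hφ : ContDiff ℝ 2 φ) (p : ℝ × ℝ) : box φ p = dt (dt φ) p - dx (dx φ) p := by
  have hd : Differentiable ℝ φ := hφ.differentiable (by norm_num)
  have h1 : Differentiable ℝ (dt φ) := (contDiff_dt (n := 1) hφ).differentiable (by norm_num)
  have h2 : Differentiable ℝ (dx φ) := (contDiff_dx (n := 1) hφ).differentiable (by norm_num)
  have e1 : deriv (fun s => φ (p.1, s)) = fun s => dt φ (p.1, s) :=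
    funext fun s => (hasDerivAt_time hd _ _).deriv
  have e2 : deriv (fun y => φ (y, p.2)) = fun y => dx φ (y, p.2) :=
    funext fun s => (hasDerivAt_space hd _ _).deriv
  unfold box
  rw [iteratedDeriv_succ, iteratedDeriv_one, e1, (hasDerivAt_time h1 _ _).deriv,
    iteratedDeriv_succ, iteratedDeriv_one, e2, (hasDerivAt_space h2 _ _).deriv]

lemma continuous_dt (hφ : ContDiff ℝ 2 φ) : Continuous (dt φ) :=
  (contDiff_dt (n := 1) hφ).continuous

lemma continuous_dx (hφ : ContDiff ℝ 2 φ) : Continuous (dx φ) :=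
  (contDiff_dx (n := 1) hφ).continuous

lemma continuous_box (hφ : ContDiff ℝ 2 φ) : Continuous (box φ) := by
  have h1 : Continuous (dt (dt φ)) :=
    (contDiff_dt (n := 0) (contDiff_dt (n := 1) hφ)).continuous
  have h2 : Continuous (dx (dx φ)) :=
    (contDiff_dx (n := 0) (contDiff_dx (n := 1) hφ)).continuous
  rw [funext (box_eq hφ)]
  exact h1.sub h2

lemma fderiv_apply_eq (p v : ℝ × ℝ) (ψ : ℝ × ℝ → ℝ) :
    fderiv ℝ ψ p v = v.1 * dx ψ p + v.2 * dt ψ p := by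
  have : v = v.1 • ((1 : ℝ), (0 : ℝ)) + v.2 • ((0 : ℝ), (1 : ℝ)) := by ext <;> simp
  conv_lhs => rw [this]
  simp only [map_add, map_smul, smul_eq_mul, dx, dt]

/-- The factorization (∂t + ∂x)(∂t - ∂x) of the wave operator; the mixed derivatives cancel by
symmetry. -/
lemma hasDerivAt_rightward (hφ : ContDiff ℝ 2 φ) (x ξ : ℝ) :
    HasDerivAt (fun r => dt φ (r, ξ + r) - dx φ (r, ξ + r)) (box φ (x, ξ + x)) x := by
  have h1 : Differentiable ℝ (dt φ) := (contDiff_dt (n := 1) hφ).differentiable (by norm_num)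
  have h2 : Differentiable ℝ (dx φ) := (contDiff_dx (n := 1) hφ).differentiable (by norm_num)
  have hc : HasDerivAt (fun r : ℝ => (r, ξ + r)) ((1 : ℝ), (1 : ℝ)) x :=
    (hasDerivAt_id x).prodMk ((hasDerivAt_id x).const_add ξ)
  have e1 := (h1 (x, ξ + x)).hasFDerivAt.comp_hasDerivAt x hc
  have e2 := (h2 (x, ξ + x)).hasFDerivAt.comp_hasDerivAt x hc
  refine (e1.sub e2).congr_deriv ?_
  rw [fderiv_apply_eq, fderiv_apply_eq, box_eq hφ, dt_dx_eq hφ]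
  ring

lemma hasDerivAt_leftward (hφ : ContDiff ℝ 2 φ) (x ξ : ℝ) :
    HasDerivAt (fun r => dt φ (r, ξ - r) + dx φ (r, ξ - r)) (-box φ (x, ξ - x)) x := by
  have h1 : Differentiable ℝ (dt φ) := (contDiff_dt (n := 1) hφ).differentiable (by norm_num)
  have h2 : Differentiable ℝ (dx φ) := (contDiff_dx (n := 1) hφ).differentiable (by norm_num)
  have hc : HasDerivAt (fun r : ℝ => (r, ξ - r)) ((1 : ℝ), (-1 : ℝ)) x :=
    (hasDerivAt_id x).prodMk ((hasDerivAt_id x).const_sub ξ)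
  have e1 := (h1 (x, ξ - x)).hasFDerivAt.comp_hasDerivAt x hc
  have e2 := (h2 (x, ξ - x)).hasFDerivAt.comp_hasDerivAt x hc
  refine (e1.add e2).congr_deriv ?_
  rw [fderiv_apply_eq, fderiv_apply_eq, box_eq hφ, dt_dx_eq hφ]
  ring

end

/-! ### Pairing travelling waves with test functions -/

/-- The fundamental theorem of calculus along the characteristic t = ξ + x, followed until it leaves
the rectangle. If it leaves through t = τ, the end value is zero by `hτ`; hence the case distinction
on the right. -/
lemma intervalIntegral_characteristic {ψ G : ℝ × ℝ → ℝ} (hG : Continuous G)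
    (hd : ∀ x ξ, HasDerivAt (fun r => ψ (r, ξ + r)) (G (x, ξ + x)) x) {α β τ ξ : ℝ}
    (hαβ : α ≤ β) (hτ : ∀ x ∈ Icc α β, ψ (x, τ) = 0) (hξ : ξ + α < τ) :
    ∫ x in Ioo α β, (if ξ + x < τ then G (x, ξ + x) else 0)
      = (if ξ + β < τ then ψ (β, ξ + β) else 0) - ψ (α, ξ + α) := by
  have hc : Continuous fun x => G (x, ξ + x) := by fun_prop
  have ftc : ∀ b, ∫ x in α..b, G (x, ξ + x) = ψ (b, ξ + b) - ψ (α, ξ + α) := fun b =>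
    intervalIntegral.integral_eq_sub_of_hasDerivAt (f := fun r => ψ (r, ξ + r))
      (fun x _ => hd x ξ) (hc.intervalIntegrable _ _)
  by_cases h : ξ + β < τ
  · rw [if_pos h, ← ftc β, intervalIntegral.integral_of_le hαβ, integral_Ioc_eq_integral_Ioo]
    refine setIntegral_congr_fun measurableSet_Ioo fun x hx => ?_
    rw [if_pos (by linarith [hx.2])]
  · rw [if_neg h]
    have hb : τ - ξ ≤ β := by linarith
    have h0 : ψ (τ - ξ, ξ + (τ - ξ)) = 0 := by
      rw [show ξ + (τ - ξ) = τ by ring]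
      exact hτ _ ⟨by linarith, hb⟩
    have e : ∫ x in Ioo α β, (if ξ + x < τ then G (x, ξ + x) else 0)
        = ∫ x in Ioo α (τ - ξ), G (x, ξ + x) := by
      have : ∀ x, (if ξ + x < τ then G (x, ξ + x) else 0)
          = (Iio (τ - ξ)).indicator (fun x => G (x, ξ + x)) x := fun x => by
        simp [indicator, lt_sub_iff_add_lt']
      simp_rw [this]
      rw [setIntegral_indicator measurableSet_Iio]
      congr 2
      ext x; simp only [mem_inter_iff, mem_Ioo, mem_Iio]
      constructor
      · rintro ⟨h1, h2⟩; exact ⟨h1.1, h2⟩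
      · rintro ⟨h1, h2⟩; exact ⟨⟨h1, by linarith⟩, h2⟩
    rw [e, ← integral_Ioc_eq_integral_Ioo, ← intervalIntegral.integral_of_le (by linarith), ftc, h0]

lemma integrableOn_mul_continuous {g ψ : ℝ → ℝ} (hg : Integrable g) (hψ : Continuous ψ) (a b : ℝ) :
    IntegrableOn (fun t => g t * ψ t) (Ioo a b) := by
  obtain ⟨M, hM⟩ := isCompact_Icc.exists_bound_of_continuousOn (s := Icc a b) hψ.continuousOn
  refine hg.integrableOn.mul_bdd (c := M) hψ.aestronglyMeasurable ?_
  filter_upwards [ae_restrict_mem measurableSet_Ioo] with t ht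
  exact hM _ (Ioo_subset_Icc_self ht)

lemma exists_bound_rectangle {G : ℝ × ℝ → ℝ} (hG : Continuous G) (α β τ : ℝ) :
    ∃ M, ∀ p ∈ Ioo α β ×ˢ Ioo 0 τ, |G p| ≤ M := by
  obtain ⟨M, hM⟩ := (isCompact_Icc.prod isCompact_Icc).exists_bound_of_continuousOn
    (s := Icc α β ×ˢ Icc 0 τ) hG.continuousOn
  exact ⟨M, fun p hp => hM p ⟨Ioo_subset_Icc_self hp.1, Ioo_subset_Icc_self hp.2⟩⟩

/-- The shear (x, t) ↦ (x, x + t) preserves measure and turns the travelling wave into a product of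
a function of x and an integrable function of t. -/
lemma integrableOn_wave_mul {P : ℝ → ℝ} (hP : Integrable P) {G : ℝ × ℝ → ℝ} (hG : Continuous G)
    (α β τ a : ℝ) :
    IntegrableOn (fun p : ℝ × ℝ => P (p.2 - (p.1 - a)) * G p) (Ioo α β ×ˢ Ioo 0 τ) := by
  obtain ⟨M, hM⟩ := exists_bound_rectangle hG α β τ
  have hR : MeasurableSet (Ioo α β ×ˢ Ioo (0 : ℝ) τ) := measurableSet_Ioo.prod measurableSet_Ioo
  have h1 : IntegrableOn (fun p : ℝ × ℝ => P (p.2 - (p.1 - a))) (Ioo α β ×ˢ univ) := by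
    have e := measurePreserving_prod_add (volume : Measure ℝ) (volume : Measure ℝ)
    have hemb := (MeasurableEquiv.shearAddRight ℝ).measurableEmbedding
    rw [← integrable_indicator_iff (measurableSet_Ioo.prod MeasurableSet.univ)]
    rw [Measure.volume_eq_prod, ← e.integrable_comp_emb hemb]
    have h2 : Integrable (fun q : ℝ × ℝ => (Ioo α β).indicator (fun _ => (1 : ℝ)) q.1 * P (q.2 + a))
        ((volume : Measure ℝ).prod (volume : Measure ℝ)) := by
      refine Integrable.mul_prod (f := (Ioo α β).indicator (fun _ => (1 : ℝ)))
        (g := fun t => P (t + a)) ?_ (hP.comp_add_right a)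
      exact (integrable_indicator_iff measurableSet_Ioo).2 (by simp)
    refine h2.congr (ae_of_all _ fun q => ?_)
    simp only [Function.comp, indicator, mem_prod, mem_univ, and_true]
    split_ifs
    · rw [one_mul]; congr 1; ring
    · simp
  refine (h1.mono_set (prod_mono le_rfl (subset_univ _))).mul_bdd (c := M)
    hG.aestronglyMeasurable ?_
  filter_upwards [ae_restrict_mem hR] with p hp using hM p hp

/-- Pairing a wave travelling to the right with `G`, when `ψ` is a primitive of `G` along the
characteristics and vanishes at the final time. -/
lemma integral_rightward_wave {P : ℝ → ℝ} (hP : Integrable P) (hP0 : ∀ t ≤ 0, P t = 0)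
    {ψ G : ℝ × ℝ → ℝ} (hψ : Continuous ψ) (hG : Continuous G)
    (hd : ∀ x ξ, HasDerivAt (fun r => ψ (r, ξ + r)) (G (x, ξ + x)) x) {α β τ : ℝ}
    (hαβ : α ≤ β) (hτ : ∀ x ∈ Icc α β, ψ (x, τ) = 0) :
    ∫ p in Ioo α β ×ˢ Ioo 0 τ, P (p.2 - (p.1 - α)) * G p
      = (∫ t in Ioo 0 τ, P (t - (β - α)) * ψ (β, t)) - ∫ t in Ioo 0 τ, P t * ψ (α, t) := by
  have hR : MeasurableSet (Ioo α β ×ˢ Ioo (0 : ℝ) τ) := measurableSet_Ioo.prod measurableSet_Ioo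
  have e := measurePreserving_prod_add (volume : Measure ℝ) (volume : Measure ℝ)
  have hemb := (MeasurableEquiv.shearAddRight ℝ).measurableEmbedding
  have hint := (integrable_indicator_iff hR).2 (integrableOn_wave_mul hP hG α β τ α)
  have hint' : Integrable (fun z : ℝ × ℝ => (Ioo α β ×ˢ Ioo (0 : ℝ) τ).indicator
      (fun p : ℝ × ℝ => P (p.2 - (p.1 - α)) * G p) (z.1, z.1 + z.2)) (volume.prod volume) :=
    (e.integrable_comp_emb hemb).2 hint
  rw [← integral_indicator hR, Measure.volume_eq_prod, ← e.integral_comp hemb,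
    integral_prod_symm _ hint']
  -- After the shear, P is constant on each characteristic and comes out of the integral.
  -- Characteristics with ξ + α ≤ 0 carry P = 0, and those with ξ + α ≥ τ miss the rectangle.
  have key : ∀ ξ, ∫ x, (Ioo α β ×ˢ Ioo (0 : ℝ) τ).indicator
        (fun p : ℝ × ℝ => P (p.2 - (p.1 - α)) * G p) (x, x + ξ)
      = (Ioo 0 τ).indicator (fun t => P (t - (β - α)) * ψ (β, t)) (ξ + β)
        - (Ioo 0 τ).indicator (fun t => P t * ψ (α, t)) (ξ + α) := by
    intro ξ
    have e1 : ∀ x, (Ioo α β ×ˢ Ioo (0 : ℝ) τ).indicator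
        (fun p : ℝ × ℝ => P (p.2 - (p.1 - α)) * G p) (x, x + ξ)
        = P (ξ + α) * (Ioo α β).indicator
            (fun x => if ξ + x < τ then G (x, ξ + x) else 0) x := by
      intro x
      by_cases h0 : ξ + α ≤ 0
      · have : x + ξ - (x - α) = ξ + α := by ring
        simp [indicator, this, hP0 _ h0]
      · have h2 : x + ξ - (x - α) = ξ + α := by ring
        simp only [indicator, mem_prod, h2, mem_Ioo]
        by_cases hx : α < x ∧ x < β
        · have h3 : 0 < x + ξ := by linarith [hx.1]
          by_cases h4 : ξ + x < τ
          · rw [if_pos ⟨hx, h3, by linarith⟩, if_pos hx, if_pos h4, add_comm x ξ]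
          · rw [if_neg (fun h => h4 (by linarith [h.2.2])), if_pos hx, if_neg h4, mul_zero]
        · rw [if_neg (fun h => hx h.1), if_neg hx, mul_zero]
    simp_rw [e1]
    rw [integral_const_mul, integral_indicator measurableSet_Ioo]
    have h5 : ξ + β - (β - α) = ξ + α := by ring
    simp only [indicator, h5, mem_Ioo]
    by_cases h0 : ξ + α ≤ 0
    · simp [hP0 _ h0]
    by_cases h1 : ξ + α < τ
    · rw [intervalIntegral_characteristic hG hd hαβ hτ h1,
        if_pos (⟨by linarith, h1⟩ : 0 < ξ + α ∧ ξ + α < τ)]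
      by_cases h2 : ξ + β < τ
      · rw [if_pos h2, if_pos ⟨by linarith, h2⟩]; ring
      · rw [if_neg h2, if_neg fun h => h2 h.2]; ring
    · have : ∀ x ∈ Ioo α β, (if ξ + x < τ then G (x, ξ + x) else 0) = 0 := fun x hx => by
        rw [if_neg]; linarith [hx.1]
      rw [setIntegral_congr_fun measurableSet_Ioo this, 
        if_neg fun h => h1 (by linarith [h.2]), if_neg fun h => h1 h.2]
      simp
  simp_rw [key]
  have i1 : Integrable ((Ioo 0 τ).indicator (fun t => P (t - (β - α)) * ψ (β, t))) :=
    (integrable_indicator_iff measurableSet_Ioo).2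
      (integrableOn_mul_continuous (hP.comp_sub_right _) (by fun_prop) _ _)
  have i2 : Integrable ((Ioo 0 τ).indicator (fun t => P t * ψ (α, t))) :=
    (integrable_indicator_iff measurableSet_Ioo).2
      (integrableOn_mul_continuous hP (by fun_prop) _ _)
  rw [integral_sub (i1.comp_add_right β) (i2.comp_add_right α),
    integral_add_right_eq_self (fun t => (Ioo 0 τ).indicator (fun t => P (t - (β - α)) * ψ (β, t)) t),
    integral_add_right_eq_self (fun t => (Ioo 0 τ).indicator (fun t => P t * ψ (α, t)) t),
    integral_indicator measurableSet_Ioo, integral_indicator measurableSet_Ioo]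

/-- Pairing a wave travelling to the left with `G`. -/
lemma integral_leftward_wave {P : ℝ → ℝ} (hP : Integrable P) (hP0 : ∀ t ≤ 0, P t = 0)
    {χ G : ℝ × ℝ → ℝ} (hχ : Continuous χ) (hG : Continuous G)
    (hd : ∀ x ξ, HasDerivAt (fun r => χ (r, ξ - r)) (-G (x, ξ - x)) x) {α β τ : ℝ}
    (hαβ : α ≤ β) (hτ : ∀ x ∈ Icc α β, χ (x, τ) = 0) :
    ∫ p in Ioo α β ×ˢ Ioo 0 τ, P (p.2 - (β - p.1)) * G p
      = (∫ t in Ioo 0 τ, P (t - (β - α)) * χ (α, t)) - ∫ t in Ioo 0 τ, P t * χ (β, t) := by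
  -- The reflection x ↦ -x reduces this to waves travelling to the right.
  have h := integral_rightward_wave hP hP0 (ψ := fun p => χ (-p.1, p.2)) (G := fun p => G (-p.1, p.2))
    (by fun_prop) (by fun_prop) (α := -β) (β := -α) (τ := τ) (fun x ξ => by
      have h1 := (hd (-x) ξ).comp x (hasDerivAt_neg x)
      simpa [Function.comp_def, sub_neg_eq_add] using h1) (by linarith)
    (fun x hx => hτ _ ⟨by linarith [hx.2], by linarith [hx.1]⟩)
  simp only [neg_neg] at h
  rw [show -α - -β = β - α by ring] at h
  rw [← h]
  have e : MeasurePreserving (fun p : ℝ × ℝ => (-p.1, p.2)) volume volume :=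
    (Measure.measurePreserving_neg (volume : Measure ℝ)).prod (MeasurePreserving.id volume)
  have hemb : MeasurableEmbedding (fun p : ℝ × ℝ => (-p.1, p.2)) :=
    ((MeasurableEquiv.neg ℝ).prodCongr (MeasurableEquiv.refl ℝ)).measurableEmbedding
  rw [← e.setIntegral_preimage_emb hemb]
  have hset : (fun p : ℝ × ℝ => (-p.1, p.2)) ⁻¹' (Ioo α β ×ˢ Ioo 0 τ) = Ioo (-β) (-α) ×ˢ Ioo 0 τ := by
    ext p
    simp only [mem_preimage, mem_prod, mem_Ioo]
    constructor <;> rintro ⟨⟨h1, h2⟩, h3⟩ <;> refine ⟨⟨?_, ?_⟩, h3⟩ <;> linarith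
  rw [hset]
  congr 1; ext p
  congr 2; ring

/-- The light cone is the fundamental solution of the wave equation: pairing with `φ_tt - φ_xx` on
a rectangle. -/
lemma integral_lightCone_mul_box {φ : ℝ × ℝ → ℝ} (hφ : ContDiff ℝ 2 φ) {l τ : ℝ}
    (h0 : ∀ x ∈ Icc 0 l, φ (x, τ) = 0) (ht0 : ∀ x ∈ Icc 0 l, dt φ (x, τ) = 0)
    (hx0 : ∀ x ∈ Icc 0 l, dx φ (x, τ) = 0) {p : ℝ × ℝ} (hp1 : p.1 ∈ Ioo 0 l) (hp2 : p.2 ∈ Ioo 0 τ) :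
    ∫ z in Ioo 0 l ×ˢ Ioo 0 τ, lightCone (z - p) * box φ z
      = (∫ t in Ioo 0 τ, lightCone ((l, t) - p) * (dt φ (l, t) - dx φ (l, t)))
        + (∫ t in Ioo 0 τ, lightCone ((0, t) - p) * (dt φ (0, t) + dx φ (0, t))) + φ p := by
  obtain ⟨y, s⟩ := p
  simp only at hp1 hp2
  -- To the right of y the cone is a rightward wave, to the left a leftward wave, both with the
  -- profile 1/2 from time s on. The cutoff at τ only serves to make the profile integrable.
  set P : ℝ → ℝ := (Ico s τ).indicator (fun _ => 1 / 2) with hPdef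
  have hP : Integrable P := (integrable_indicator_iff measurableSet_Ico).2 (by simp)
  have hP0 : ∀ t ≤ 0, P t = 0 := fun t ht =>
    indicator_of_notMem (fun h => by linarith [h.1, hp2.1]) _
  have hPR : ∀ x t, y ≤ x → t < τ → lightCone ((x, t) - (y, s)) = P (t - (x - y)) := by
    intro x t hx ht
    simp only [lightCone, Prod.fst_sub, Prod.snd_sub, hPdef, indicator, mem_Ico]
    refine if_congr ?_ rfl rfl
    rw [abs_of_nonneg (by linarith)]
    constructor
    · intro h; constructor <;> linarith
    · intro h; linarith [h.1]
  have hPL : ∀ x t, x ≤ y → t < τ → lightCone ((x, t) - (y, s)) = P (t - (y - x)) := by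
    intro x t hx ht
    simp only [lightCone, Prod.fst_sub, Prod.snd_sub, hPdef, indicator, mem_Ico]
    refine if_congr ?_ rfl rfl
    rw [abs_of_nonpos (by linarith)]
    constructor
    · intro h; constructor <;> linarith
    · intro h; linarith [h.1]
  have hG := continuous_box hφ
  have hct := continuous_dt hφ
  have hcx := continuous_dx hφ
  have hR := integral_rightward_wave hP hP0 (hct.sub hcx) hG (hasDerivAt_rightward hφ) (τ := τ)
    hp1.2.le (fun x hx => by
      have hx' : x ∈ Icc 0 l := ⟨by linarith [hp1.1, hx.1], hx.2⟩
      simp [ht0 x hx', hx0 x hx'])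
  have hL := integral_leftward_wave hP hP0 (hct.add hcx) hG (hasDerivAt_leftward hφ) (τ := τ)
    hp1.1.le (fun x hx => by
      have hx' : x ∈ Icc 0 l := ⟨hx.1, by linarith [hp1.2, hx.2]⟩
      simp [ht0 x hx', hx0 x hx'])
  have mR : MeasurableSet (Ioo y l ×ˢ Ioo (0 : ℝ) τ) := measurableSet_Ioo.prod measurableSet_Ioo
  have mL : MeasurableSet (Ioo 0 y ×ˢ Ioo (0 : ℝ) τ) := measurableSet_Ioo.prod measurableSet_Ioo
  have eR : EqOn (fun z => lightCone (z - (y, s)) * box φ z)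
      (fun z => P (z.2 - (z.1 - y)) * box φ z) (Ioo y l ×ˢ Ioo 0 τ) := fun z hz => by
    simp only; rw [← hPR z.1 z.2 hz.1.1.le hz.2.2]
  have eL : EqOn (fun z => lightCone (z - (y, s)) * box φ z)
      (fun z => P (z.2 - (y - z.1)) * box φ z) (Ioo 0 y ×ˢ Ioo 0 τ) := fun z hz => by
    simp only; rw [← hPL z.1 z.2 hz.1.2.le hz.2.2]
  have iR : IntegrableOn (fun z => lightCone (z - (y, s)) * box φ z) (Ioo y l ×ˢ Ioo 0 τ) :=
    (integrableOn_wave_mul hP hG y l τ y).congr_fun eR.symm mR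
  obtain ⟨M, hM⟩ := exists_bound_rectangle hG 0 l τ
  have iA : IntegrableOn (fun z => lightCone (z - (y, s)) * box φ z) (Ioo 0 l ×ˢ Ioo 0 τ) := by
    have hfin : volume (Ioo 0 l ×ˢ Ioo (0 : ℝ) τ) ≠ ⊤ := by
      rw [Measure.volume_eq_prod, Measure.prod_prod, Real.volume_Ioo, Real.volume_Ioo]
      exact ENNReal.mul_ne_top ENNReal.ofReal_ne_top ENNReal.ofReal_ne_top
    refine Measure.integrableOn_of_bounded (M := 1 / 2 * M) hfin ?_ ?_
    · exact ((measurable_lightCone.comp (measurable_id.sub_const _)).mul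
        hG.measurable).aestronglyMeasurable
    · filter_upwards [ae_restrict_mem (measurableSet_Ioo.prod measurableSet_Ioo)] with z hz
      rw [norm_mul]
      exact mul_le_mul (abs_lightCone_le _) (hM z hz) (norm_nonneg _) (by norm_num)
  have hsplit : ∫ z in Ioo 0 l ×ˢ Ioo 0 τ, lightCone (z - (y, s)) * box φ z
      = (∫ z in Ioo 0 y ×ˢ Ioo 0 τ, lightCone (z - (y, s)) * box φ z)
        + ∫ z in Ioo y l ×ˢ Ioo 0 τ, lightCone (z - (y, s)) * box φ z := by
    have hae : (Ioo 0 l ×ˢ Ioo 0 τ : Set (ℝ × ℝ)) =ᵐ[volume]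
        ((Ioo 0 y ×ˢ Ioo 0 τ) ∪ (Ioo y l ×ˢ Ioo 0 τ) : Set (ℝ × ℝ)) := by
      rw [← union_prod]
      refine Measure.set_prod_ae_eq ?_ (ae_eq_refl _)
      have : (Ioo 0 y ∪ Ioo y l : Set ℝ) = Ioo 0 l \ {y} := by
        ext x; simp only [mem_union, mem_Ioo, Set.mem_sdiff, mem_singleton_iff]
        constructor
        · rintro (h | h)
          · exact ⟨⟨h.1, h.2.trans hp1.2⟩, h.2.ne⟩
          · exact ⟨⟨hp1.1.trans h.1, h.2⟩, h.1.ne'⟩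
        · rintro ⟨h, hne⟩
          rcases lt_or_gt_of_ne hne with h' | h'
          · left; exact ⟨h.1, h'⟩
          · right; exact ⟨h', h.2⟩
      rw [this]
      exact (sdiff_null_ae_eq_self (by simp)).symm
    rw [setIntegral_congr_set hae, setIntegral_union _ mR]
    · exact iA.mono_set (prod_mono (Ioo_subset_Ioo_right hp1.2.le) le_rfl)
    · exact iA.mono_set (prod_mono (Ioo_subset_Ioo_left hp1.1.le) le_rfl)
    · rw [disjoint_left]
      intro z hz hz'
      linarith [hz.1.2, hz'.1.1]
  rw [hsplit, setIntegral_congr_fun mR eR, setIntegral_congr_fun mL eL, hR, hL]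
  have e1 : ∫ t in Ioo 0 τ, P (t - (l - y)) * (dt φ (l, t) - dx φ (l, t))
      = ∫ t in Ioo 0 τ, lightCone ((l, t) - (y, s)) * (dt φ (l, t) - dx φ (l, t)) :=
    setIntegral_congr_fun measurableSet_Ioo fun t ht => by
      rw [hPR l t hp1.2.le ht.2]
  have e2 : ∫ t in Ioo 0 τ, P (t - (y - 0)) * (dt φ (0, t) + dx φ (0, t))
      = ∫ t in Ioo 0 τ, lightCone ((0, t) - (y, s)) * (dt φ (0, t) + dx φ (0, t)) :=
    setIntegral_congr_fun measurableSet_Ioo fun t ht => by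
      rw [hPL 0 t hp1.1.le ht.2]
  -- The point mass appears here. In the boundary terms of the two halves at x = y the space
  -- derivatives cancel, and the two factors 1/2 leave the integral of the time derivative from s to
  -- τ, where φ vanishes.
  have e3 : (∫ t in Ioo 0 τ, P t * (dt φ (y, t) - dx φ (y, t)))
      + (∫ t in Ioo 0 τ, P t * (dt φ (y, t) + dx φ (y, t))) = - φ (y, s) := by
    rw [← integral_add (integrableOn_mul_continuous hP (by fun_prop) _ _)
      (integrableOn_mul_continuous hP (by fun_prop) _ _)]
    have : ∀ t, P t * (dt φ (y, t) - dx φ (y, t)) + P t * (dt φ (y, t) + dx φ (y, t))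
        = (Ico s τ).indicator (fun t => dt φ (y, t)) t := fun t => by
      simp only [hPdef, indicator]; split_ifs <;> ring
    simp_rw [this]
    rw [setIntegral_indicator measurableSet_Ico]
    have hset : Ioo 0 τ ∩ Ico s τ = Ico s τ := by
      refine inter_eq_right.2 fun t ht => ⟨by linarith [ht.1, hp2.1], ht.2⟩
    rw [hset, integral_Ico_eq_integral_Ioc, ← intervalIntegral.integral_of_le hp2.2.le,
      intervalIntegral.integral_eq_sub_of_hasDerivAt (f := fun t => φ (y, t))
        (fun t _ => hasDerivAt_time (hφ.differentiable (by norm_num)) y t)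
        ((by fun_prop : Continuous fun t => dt φ (y, t)).intervalIntegrable _ _),
      h0 y ⟨hp1.1.le, hp1.2.le⟩]
    ring
  simp only [Pi.add_apply, Pi.sub_apply] at *
  rw [e1, e2]
  linarith

/-- The weak form of `w_tt - w_xx = h` for the Duhamel integral, on a rectangle. -/
lemma integral_duhamel_mul_box {h : ℝ × ℝ → ℝ} (hh : Integrable h) {φ : ℝ × ℝ → ℝ}
    (hφ : ContDiff ℝ 2 φ) {l τ : ℝ} (hs : ∀ p, h p ≠ 0 → p.1 ∈ Ioo 0 l ∧ 0 < p.2)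
    (h0 : ∀ x ∈ Icc 0 l, φ (x, τ) = 0) (ht0 : ∀ x ∈ Icc 0 l, dt φ (x, τ) = 0)
    (hx0 : ∀ x ∈ Icc 0 l, dx φ (x, τ) = 0) :
    ∫ z in Ioo 0 l ×ˢ Ioo 0 τ, duhamel h z.1 z.2 * box φ z
      = (∫ t in Ioo 0 τ, duhamel h l t * (dt φ (l, t) - dx φ (l, t)))
        + (∫ t in Ioo 0 τ, duhamel h 0 t * (dt φ (0, t) + dx φ (0, t)))
        + ∫ z in Ioo 0 l ×ˢ Ioo 0 τ, h z * φ z := by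
  have hct := continuous_dt hφ
  have hcx := continuous_dx hφ
  have mR : MeasurableSet (Ioo 0 l ×ˢ Ioo (0 : ℝ) τ) := measurableSet_Ioo.prod measurableSet_Ioo
  have hfin : volume (Ioo 0 l ×ˢ Ioo (0 : ℝ) τ) ≠ ⊤ := by
    rw [Measure.volume_eq_prod, Measure.prod_prod, Real.volume_Ioo, Real.volume_Ioo]
    exact ENNReal.mul_ne_top ENNReal.ofReal_ne_top ENNReal.ofReal_ne_top
  have i0 : ∀ {G : ℝ × ℝ → ℝ}, Continuous G → IntegrableOn G (Ioo 0 l ×ˢ Ioo (0 : ℝ) τ) := by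
    intro G hG
    obtain ⟨M, hM⟩ := exists_bound_rectangle hG 0 l τ
    refine Measure.integrableOn_of_bounded (M := M) hfin hG.aestronglyMeasurable ?_
    filter_upwards [ae_restrict_mem mR] with z hz using hM z hz
  have i1 : ∀ {g : ℝ → ℝ}, Continuous g → IntegrableOn g (Ioo 0 τ) := fun hg =>
    hg.integrableOn_Icc.mono_set Ioo_subset_Icc_self
  have gl : Continuous fun t => dt φ (l, t) - dx φ (l, t) := by fun_prop
  have g0 : Continuous fun t => dt φ (0, t) + dx φ (0, t) := by fun_prop
  have A := integral_duhamel_mul hh measurable_id (i0 (continuous_box hφ))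
  have B := integral_duhamel_mul hh (z := fun t : ℝ => (l, t)) (by fun_prop) (i1 gl)
  have Cc := integral_duhamel_mul hh (z := fun t : ℝ => ((0 : ℝ), t)) (by fun_prop) (i1 g0)
  simp only [id] at A B Cc
  rw [A, B, Cc]
  have hb : ∀ {α : Type} [MeasurableSpace α] {μ : Measure α} [SFinite μ] {z : α → ℝ × ℝ}
      {g : α → ℝ}, Measurable z → Integrable g μ →
      Integrable (fun p => h p * ∫ a, lightCone (z a - p) * g a ∂μ) := by
    intro α _ μ _ z g hz hg
    have h1 : Integrable (fun q : α × (ℝ × ℝ) => g q.1 * h q.2) (μ.prod volume) := hg.mul_prod hh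
    have h2 := h1.mul_bdd (c := 1 / 2) (g := fun q : α × (ℝ × ℝ) => lightCone (z q.1 - q.2))
      (measurable_lightCone.comp
        ((hz.comp measurable_fst).sub measurable_snd)).aestronglyMeasurable
      (ae_of_all _ fun p => by simpa using abs_lightCone_le _)
    refine h2.integral_prod_right.congr (ae_of_all _ fun p => ?_)
    simp only
    rw [← integral_const_mul]
    congr 1; ext a; ring
  have i3 : Integrable ((Ioo 0 l ×ˢ Ioo (0 : ℝ) τ).indicator fun z => h z * φ z) := by
    rw [integrable_indicator_iff mR]
    obtain ⟨M, hM⟩ := exists_bound_rectangle hφ.continuous 0 l τ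
    refine hh.integrableOn.mul_bdd (c := M) hφ.continuous.aestronglyMeasurable ?_
    filter_upwards [ae_restrict_mem mR] with z hz using hM z hz
  have iB := hb (z := fun t : ℝ => (l, t)) (by fun_prop) (i1 gl)
  have iC := hb (z := fun t : ℝ => ((0 : ℝ), t)) (by fun_prop) (i1 g0)
  have eBC := integral_add (iB.add iC) i3
  simp only [Pi.add_apply] at eBC
  rw [← integral_indicator mR, ← integral_add iB iC, ← eBC]
  congr 1; ext p
  by_cases hp : h p = 0
  · simp [hp, indicator]
  obtain ⟨hp1, hp2⟩ := hs p hp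
  by_cases hp3 : p.2 < τ
  · rw [integral_lightCone_mul_box hφ h0 ht0 hx0 hp1 ⟨hp2, hp3⟩,
      indicator_of_mem (show p ∈ Ioo 0 l ×ˢ Ioo 0 τ from ⟨hp1, hp2, hp3⟩)]
    ring
  · have z1 : ∀ x t, t < τ → lightCone ((x, t) - p) = 0 := fun x t ht =>
      lightCone_of_lt (by
        simp only [Prod.fst_sub, Prod.snd_sub]
        linarith [abs_nonneg (x - p.1)])
    rw [indicator_of_notMem (fun h => hp3 h.2.2),
      setIntegral_eq_zero_of_forall_eq_zero fun z hz => by rw [z1 z.1 z.2 hz.2.2, zero_mul],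
      setIntegral_eq_zero_of_forall_eq_zero fun t ht => by rw [z1 l t ht.2, zero_mul],
      setIntegral_eq_zero_of_forall_eq_zero fun t ht => by rw [z1 0 t ht.2, zero_mul]]
    simp

/-! ### Travelling waves on the graph -/

/-- The initial vertex of a directed edge: `(j, false)` is the edge `j` with its given orientation,
`(j, true)` the edge with the opposite orientation. The vertices `v₁, …, v₄` are numbered from `0`. -/
def tail (d : Fin 4 × Bool) : Fin 4 := if d.2 then ![0, 2, 2, 3] d.1 else ![1, 1, 1, 2] d.1

/-- The directed edge with reversed orientation. -/
def rev (d : Fin 4 × Bool) : Fin 4 × Bool := (d.1, !d.2)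

/-- The coordinate of the terminal vertex of a directed edge. -/
def endpoint (l : Fin 4 → ℝ) (d : Fin 4 × Bool) : ℝ := if d.2 then 0 else l d.1

/-- The wave arriving at the end of a directed edge when the profile `P d` leaves at its start and
the edges carry the sources `h`. -/
noncomputable def incoming (l : Fin 4 → ℝ) (P : Fin 4 × Bool → ℝ → ℝ) (h : Fin 4 → ℝ × ℝ → ℝ)
    (d : Fin 4 × Bool) (t : ℝ) : ℝ :=
  P d (t - l d.1) + duhamel (h d.1) (endpoint l d) t

/-- The superposition of the travelling waves with profiles `P` and the Duhamel integrals of the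
sources `h`. -/
noncomputable def wave (l : Fin 4 → ℝ) (P : Fin 4 × Bool → ℝ → ℝ) (h : Fin 4 → ℝ × ℝ → ℝ)
    (j : Fin 4) (x t : ℝ) : ℝ :=
  P (j, false) (t - x) + P (j, true) (t - (l j - x)) + duhamel (h j) x t

/-- The vertex conditions for travelling waves: continuity and the Kirchhoff condition at the inner
vertices, Dirichlet data `f` at `v₁` and `0` at `v₄`. -/
structure VertexConditions (l : Fin 4 → ℝ) (f : ℝ → ℝ) (P : Fin 4 × Bool → ℝ → ℝ)
    (h : Fin 4 → ℝ × ℝ → ℝ) (t : ℝ) : Prop where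
  v₁ : P (0, true) t + incoming l P h (0, false) t = f t
  v₄ : P (3, true) t + incoming l P h (3, false) t = 0
  v₂_left : P (0, false) t + incoming l P h (0, true) t
    = P (1, false) t + incoming l P h (1, true) t
  v₂_right : P (1, false) t + incoming l P h (1, true) t
    = P (2, false) t + incoming l P h (2, true) t
  v₂_sum : P (0, false) t + P (1, false) t + P (2, false) t
    = incoming l P h (0, true) t + incoming l P h (1, true) t + incoming l P h (2, true) t
  v₃_left : P (1, true) t + incoming l P h (1, false) t
    = P (2, true) t + incoming l P h (2, false) t
  v₃_right : P (2, true) t + incoming l P h (2, false) t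
    = P (3, false) t + incoming l P h (3, true) t
  v₃_sum : P (1, true) t + P (2, true) t + P (3, false) t
    = incoming l P h (1, false) t + incoming l P h (2, false) t + incoming l P h (3, true) t

/-- Sources: integrable, supported in the edges and in positive time. -/
structure IsSource (l : Fin 4 → ℝ) (h : Fin 4 → ℝ × ℝ → ℝ) : Prop where
  integrable : ∀ j, Integrable (h j)
  support : ∀ j p, h j p ≠ 0 → p.1 ∈ Ioo 0 (l j) ∧ 0 < p.2

/-- Vertex and terminal conditions are known only on intervals, often closed ones; this allows
differentiating them up to the endpoints. -/
lemma eq_of_hasDerivAt_of_eqOn {a b : ℝ → ℝ} {a' b' t : ℝ} {s : Set ℝ} (ha : HasDerivAt a a' t)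
    (hb : HasDerivAt b b' t) (hs : EqOn a b s) (ht : t ∈ s) (hu : UniqueDiffWithinAt ℝ s t) :
    a' = b' :=
  hu.eq_deriv _ (ha.hasDerivWithinAt.congr hs.symm (hs ht).symm) hb.hasDerivWithinAt

lemma integrableOn_leftward_wave_mul {P : ℝ → ℝ} (hP : Integrable P) {G : ℝ × ℝ → ℝ}
    (hG : Continuous G) (L τ : ℝ) :
    IntegrableOn (fun z : ℝ × ℝ => P (z.2 - (L - z.1)) * G z) (Ioo 0 L ×ˢ Ioo 0 τ) := by
  have e : MeasurePreserving (fun p : ℝ × ℝ => (L - p.1, p.2)) volume volume :=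
    (Measure.measurePreserving_sub_left (volume : Measure ℝ) (L)).prod
      (MeasurePreserving.id volume)
  have hemb : MeasurableEmbedding (fun p : ℝ × ℝ => (L - p.1, p.2)) :=
    ((MeasurableEquiv.subLeft (L)).prodCongr (MeasurableEquiv.refl ℝ)).measurableEmbedding
  have h1 := integrableOn_wave_mul hP
    (hG.comp (by fun_prop : Continuous fun p : ℝ × ℝ => (L - p.1, p.2))) 0 (L) τ 0
  rw [← e.integrableOn_comp_preimage hemb]
  have hset : (fun p : ℝ × ℝ => (L - p.1, p.2)) ⁻¹' (Ioo 0 (L) ×ˢ Ioo 0 τ)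
      = Ioo 0 (L) ×ˢ Ioo 0 τ := by
    ext p
    simp only [mem_preimage, mem_prod, mem_Ioo]
    constructor <;> rintro ⟨⟨h1, h2⟩, h3⟩ <;> refine ⟨⟨?_, ?_⟩, h3⟩ <;> linarith
  rw [hset]
  refine h1.congr (ae_of_all _ fun p => ?_)
  simp

/-- Integration by parts on one edge. At both endpoints the Duhamel integral acts as a wave leaving
the edge, so its boundary terms merge with those of the arriving free wave into `incoming`. -/
lemma integral_wave_mul_box {l : Fin 4 → ℝ} (hl : ∀ j, 0 < l j) {P : Fin 4 × Bool → ℝ → ℝ}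
    (hP : ∀ d, Integrable (P d)) (hP0 : ∀ d, ∀ t ≤ 0, P d t = 0) {h : Fin 4 → ℝ × ℝ → ℝ}
    (hh : IsSource l h) {τ : ℝ} (j : Fin 4) {φ : ℝ × ℝ → ℝ} (hφ : ContDiff ℝ 2 φ)
    (h0 : ∀ x ∈ Icc 0 (l j), φ (x, τ) = 0) (ht0 : ∀ x ∈ Icc 0 (l j), dt φ (x, τ) = 0)
    (hx0 : ∀ x ∈ Icc 0 (l j), dx φ (x, τ) = 0) :
    IntegrableOn (fun t => (incoming l P h (j, false) t * (dt φ (l j, t) - dx φ (l j, t))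
        - P (j, false) t * (dt φ (0, t) - dx φ (0, t))
        + (incoming l P h (j, true) t * (dt φ (0, t) + dx φ (0, t))
        - P (j, true) t * (dt φ (l j, t) + dx φ (l j, t))))) (Ioo 0 τ) ∧
    ∫ z in Ioo 0 (l j) ×ˢ Ioo 0 τ, wave l P h j z.1 z.2 * box φ z
      = (∫ t in Ioo 0 τ, (incoming l P h (j, false) t * (dt φ (l j, t) - dx φ (l j, t))
        - P (j, false) t * (dt φ (0, t) - dx φ (0, t))
        + (incoming l P h (j, true) t * (dt φ (0, t) + dx φ (0, t))
        - P (j, true) t * (dt φ (l j, t) + dx φ (l j, t)))))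
        + ∫ z in Ioo 0 (l j) ×ˢ Ioo 0 τ, h j z * φ z := by
  have hct := continuous_dt hφ
  have hcx := continuous_dx hφ
  have hG := continuous_box hφ
  have hcd := continuous_duhamel (hh.integrable j)
  have hR := integral_rightward_wave (hP (j, false)) (hP0 _) (hct.sub hcx) hG
    (hasDerivAt_rightward hφ) (τ := τ) (hl j).le (fun x hx => by simp [ht0 x hx, hx0 x hx])
  have hL := integral_leftward_wave (hP (j, true)) (hP0 _) (hct.add hcx) hG
    (hasDerivAt_leftward hφ) (τ := τ) (hl j).le (fun x hx => by simp [ht0 x hx, hx0 x hx])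
  have hD := integral_duhamel_mul_box (hh.integrable j) hφ (hh.support j) h0 ht0 hx0
  have iR := integrableOn_wave_mul (hP (j, false)) hG 0 (l j) τ 0
  have iL := integrableOn_leftward_wave_mul (hP (j, true)) hG (l j) τ
  have iD : IntegrableOn (fun z : ℝ × ℝ => duhamel (h j) z.1 z.2 * box φ z)
      (Ioo 0 (l j) ×ˢ Ioo 0 τ) :=
    ((hcd.mul hG).continuousOn.integrableOn_compact (isCompact_Icc.prod isCompact_Icc)).mono_set
      (prod_mono Ioo_subset_Icc_self Ioo_subset_Icc_self)
  have e1 : ∫ z in Ioo 0 (l j) ×ˢ Ioo 0 τ, wave l P h j z.1 z.2 * box φ z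
      = (∫ z in Ioo 0 (l j) ×ˢ Ioo 0 τ, P (j, false) (z.2 - (z.1 - 0)) * box φ z)
        + (∫ z in Ioo 0 (l j) ×ˢ Ioo 0 τ, P (j, true) (z.2 - (l j - z.1)) * box φ z)
        + ∫ z in Ioo 0 (l j) ×ˢ Ioo 0 τ, duhamel (h j) z.1 z.2 * box φ z := by
    have := integral_add (iR.add iL) iD
    simp only [Pi.add_apply] at this
    rw [← integral_add iR iL, ← this]
    congr 1; ext z
    simp only [wave, sub_zero]; ring
  have c1 : Continuous fun t => dt φ (l j, t) - dx φ (l j, t) := by fun_prop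
  have c2 : Continuous fun t => dt φ (0, t) - dx φ (0, t) := by fun_prop
  have c3 : Continuous fun t => dt φ (l j, t) + dx φ (l j, t) := by fun_prop
  have c4 : Continuous fun t => dt φ (0, t) + dx φ (0, t) := by fun_prop
  have iO : ∀ {g : ℝ → ℝ}, Continuous g → IntegrableOn g (Ioo 0 τ) := fun hg =>
    hg.integrableOn_Icc.mono_set Ioo_subset_Icc_self
  have dl : Continuous fun t => duhamel (h j) (l j) t :=
    hcd.comp (by fun_prop : Continuous fun t : ℝ => (l j, t))
  have d0 : Continuous fun t => duhamel (h j) 0 t :=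
    hcd.comp (by fun_prop : Continuous fun t : ℝ => ((0 : ℝ), t))
  have i1 := integrableOn_mul_continuous ((hP (j, false)).comp_sub_right (l j - 0)) c1 0 τ
  have i2 := integrableOn_mul_continuous (hP (j, false)) c2 0 τ
  have i3 := integrableOn_mul_continuous ((hP (j, true)).comp_sub_right (l j - 0)) c4 0 τ
  have i4 := integrableOn_mul_continuous (hP (j, true)) c3 0 τ
  have i5 := iO (dl.mul c1)
  have i6 := iO (d0.mul c4)
  have s1 := integral_add i1 i5
  have s2 := integral_add i3 i6
  have s3 := integral_sub (i1.add i5) i2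
  have s4 := integral_sub (i3.add i6) i4
  have s5 := integral_add ((i1.add i5).sub i2) ((i3.add i6).sub i4)
  have e2 : (fun t => (incoming l P h (j, false) t * (dt φ (l j, t) - dx φ (l j, t))
        - P (j, false) t * (dt φ (0, t) - dx φ (0, t))
        + (incoming l P h (j, true) t * (dt φ (0, t) + dx φ (0, t))
        - P (j, true) t * (dt φ (l j, t) + dx φ (l j, t)))))
      = fun t => (P (j, false) (t - (l j - 0)) * (dt φ (l j, t) - dx φ (l j, t))
          + duhamel (h j) (l j) t * (dt φ (l j, t) - dx φ (l j, t))
          - P (j, false) t * (dt φ (0, t) - dx φ (0, t))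
          + (P (j, true) (t - (l j - 0)) * (dt φ (0, t) + dx φ (0, t))
          + duhamel (h j) 0 t * (dt φ (0, t) + dx φ (0, t))
          - P (j, true) t * (dt φ (l j, t) + dx φ (l j, t)))) := by
    ext t
    simp only [incoming, endpoint, sub_zero]
    simp only [Bool.false_eq_true, if_false, if_true]
    ring
  constructor
  · rw [e2]
    exact ((i1.add i5).sub i2).add ((i3.add i6).sub i4)
  rw [e1, hR, hL, hD, e2]
  simp only [Pi.add_apply, Pi.sub_apply, Pi.mul_apply] at s1 s2 s3 s4 s5 ⊢
  rw [s5, s3, s4, s1, s2]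
  ring

/-- Travelling waves which satisfy the vertex conditions satisfy the integral identity. -/
theorem sum_integral_wave_mul_box {l : Fin 4 → ℝ} (hl : ∀ j, 0 < l j)
    {P : Fin 4 × Bool → ℝ → ℝ} (hP : ∀ d, Integrable (P d)) (hP0 : ∀ d, ∀ t ≤ 0, P d t = 0)
    {h : Fin 4 → ℝ × ℝ → ℝ} (hh : IsSource l h) {τ : ℝ} (hτ : 0 < τ) {f : ℝ → ℝ}
    (hv : ∀ t ∈ Ioo 0 τ, VertexConditions l f P h t) {φ : Fin 4 → ℝ → ℝ → ℝ}
    (hφ : IsTestFunction l τ φ) :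
    ∑ j, ∫ z in Ioo 0 (l j) ×ˢ Ioo 0 τ, wave l P h j z.1 z.2 * box (fun p => φ j p.1 p.2) z
      = (∑ j, ∫ z in Ioo 0 (l j) ×ˢ Ioo 0 τ, h j z * φ j z.1 z.2)
        + ∫ t in Ioo 0 τ, f t * -deriv (fun x => φ e₁ x t) (l e₁) := by
  set Φ : Fin 4 → ℝ × ℝ → ℝ := fun j p => φ j p.1 p.2 with hΦ
  have hdiff : ∀ j, Differentiable ℝ (Φ j) := fun j => (hφ.smooth j).differentiable (by norm_num)
  have hdt : ∀ j x t, HasDerivAt (fun s => φ j x s) (dt (Φ j) (x, t)) t := fun j x t =>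
    hasDerivAt_time (hdiff j) x t
  have hdx : ∀ j x t, HasDerivAt (fun y => φ j y t) (dx (Φ j) (x, t)) x := fun j x t =>
    hasDerivAt_space (hdiff j) x t
  have hut : ∀ t ∈ Icc 0 τ, UniqueDiffWithinAt ℝ (Icc 0 τ) t := uniqueDiffOn_Icc hτ
  have hux : ∀ j, ∀ x ∈ Icc 0 (l j), UniqueDiffWithinAt ℝ (Icc 0 (l j)) x := fun j =>
    uniqueDiffOn_Icc (hl j)
  have edge := fun j => integral_wave_mul_box hl hP hP0 hh (τ := τ) j (hφ.smooth j)
    (hφ.terminal j) (fun x hx => by rw [← hφ.terminal_deriv j x hx]; exact (hdt j x τ).deriv.symm)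
    (fun x hx => eq_of_hasDerivAt_of_eqOn (hdx j x τ) (hasDerivAt_const x (0 : ℝ))
      (fun y hy => hφ.terminal j y hy) hx (hux j x hx))
  rw [Finset.sum_congr rfl fun j _ => (edge j).2, Finset.sum_add_distrib, add_comm]
  congr 1
  rw [← integral_finsetSum]
  · refine setIntegral_congr_fun measurableSet_Ioo fun t ht => ?_
    have ht' : t ∈ Icc 0 τ := Ioo_subset_Icc_self ht
    have d1 : dt (Φ 0) (l 0, t) = 0 := eq_of_hasDerivAt_of_eqOn (hdt 0 _ t)
      (hasDerivAt_const t (0 : ℝ)) (fun s hs => hφ.dirichlet_v₁ s hs) ht' (hut t ht')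
    have d4 : dt (Φ 3) (l 3, t) = 0 := eq_of_hasDerivAt_of_eqOn (hdt 3 _ t)
      (hasDerivAt_const t (0 : ℝ)) (fun s hs => hφ.dirichlet_v₄ s hs) ht' (hut t ht')
    have c1 : dt (Φ 0) (0, t) = dt (Φ 1) (0, t) := eq_of_hasDerivAt_of_eqOn (hdt 0 _ t)
      (hdt 1 _ t) (fun s hs => (hφ.continuous_v₂ s hs).1) ht' (hut t ht')
    have c2 : dt (Φ 1) (0, t) = dt (Φ 2) (0, t) := eq_of_hasDerivAt_of_eqOn (hdt 1 _ t)
      (hdt 2 _ t) (fun s hs => (hφ.continuous_v₂ s hs).2) ht' (hut t ht')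
    have c3 : dt (Φ 1) (l 1, t) = dt (Φ 2) (l 2, t) := eq_of_hasDerivAt_of_eqOn (hdt 1 _ t)
      (hdt 2 _ t) (fun s hs => (hφ.continuous_v₃ s hs).1) ht' (hut t ht')
    have c4 : dt (Φ 2) (l 2, t) = dt (Φ 3) (0, t) := eq_of_hasDerivAt_of_eqOn (hdt 2 _ t)
      (hdt 3 _ t) (fun s hs => (hφ.continuous_v₃ s hs).2) ht' (hut t ht')
    have k2 := hφ.kirchhoff_v₂ t ht'
    have k3 := hφ.kirchhoff_v₃ t ht'
    simp only [(hdx _ _ t).deriv] at k2 k3 ⊢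
    have k2' : dx (Φ 0) (0, t) = - dx (Φ 1) (0, t) - dx (Φ 2) (0, t) := by
      change dx (Φ 0) (0, t) + dx (Φ 1) (0, t) + dx (Φ 2) (0, t) = 0 at k2
      linarith
    have k3' : dx (Φ 3) (0, t) = dx (Φ 1) (l 1, t) + dx (Φ 2) (l 2, t) := by
      change - dx (Φ 1) (l 1, t) - dx (Φ 2) (l 2, t) + dx (Φ 3) (0, t) = 0 at k3
      linarith
    obtain ⟨w1, w4, w2, w2', w2s, w3, w3', w3s⟩ := hv t ht
    change _ = f t * -dx (Φ 0) (l 0, t)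
    rw [Fin.sum_univ_four]
    change incoming l P h (0, false) t * (dt (Φ 0) (l 0, t) - dx (Φ 0) (l 0, t))
        - P (0, false) t * (dt (Φ 0) (0, t) - dx (Φ 0) (0, t))
        + (incoming l P h (0, true) t * (dt (Φ 0) (0, t) + dx (Φ 0) (0, t))
        - P (0, true) t * (dt (Φ 0) (l 0, t) + dx (Φ 0) (l 0, t)))
        + (incoming l P h (1, false) t * (dt (Φ 1) (l 1, t) - dx (Φ 1) (l 1, t))
        - P (1, false) t * (dt (Φ 1) (0, t) - dx (Φ 1) (0, t))
        + (incoming l P h (1, true) t * (dt (Φ 1) (0, t) + dx (Φ 1) (0, t))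
        - P (1, true) t * (dt (Φ 1) (l 1, t) + dx (Φ 1) (l 1, t))))
        + (incoming l P h (2, false) t * (dt (Φ 2) (l 2, t) - dx (Φ 2) (l 2, t))
        - P (2, false) t * (dt (Φ 2) (0, t) - dx (Φ 2) (0, t))
        + (incoming l P h (2, true) t * (dt (Φ 2) (0, t) + dx (Φ 2) (0, t))
        - P (2, true) t * (dt (Φ 2) (l 2, t) + dx (Φ 2) (l 2, t))))
        + (incoming l P h (3, false) t * (dt (Φ 3) (l 3, t) - dx (Φ 3) (l 3, t))
        - P (3, false) t * (dt (Φ 3) (0, t) - dx (Φ 3) (0, t))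
        + (incoming l P h (3, true) t * (dt (Φ 3) (0, t) + dx (Φ 3) (0, t))
        - P (3, true) t * (dt (Φ 3) (l 3, t) + dx (Φ 3) (l 3, t)))) = _
    rw [d1, d4, c1, c2, c3, c4, k2', k3', ← w1]
    -- Each condition is multiplied by its dual quantity: the sum conditions by the common time
    -- derivative of φ at the vertex, the continuity conditions and the condition at v₄ by space
    -- derivatives of φ, which the Kirchhoff conditions for φ link at the inner vertices.
    linear_combination
      -(dt (Φ 3) (0, t)) * w3s - (dt (Φ 2) (0, t)) * w2s - dx (Φ 1) (0, t) * w2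
        - dx (Φ 2) (0, t) * (w2 + w2') - dx (Φ 1) (l 1, t) * (w3 + w3')
        - dx (Φ 2) (l 2, t) * w3' - dx (Φ 3) (l 3, t) * w4
  · exact fun j _ => (edge j).1

/-! ### Continuity in `L²` -/

lemma tendsto_eLpNorm_translate {g : ℝ → ℝ} (hg : MemLp g 2) (a₀ : ℝ) :
    Tendsto (fun a => eLpNorm (fun x => g (x - a) - g (x - a₀)) 2) (𝓝 a₀) (𝓝 0) := by
  let F : ℝ → C(ℝ, ℝ) := fun a => ⟨fun x => x - a, by fun_prop⟩
  have hmp : ∀ a : ℝ, MeasurePreserving (F a) :=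
    fun a => measurePreserving_sub_right volume a
  have hF : Continuous F := by
    refine ContinuousMap.continuous_of_continuous_uncurry _ ?_
    exact (continuous_snd.sub continuous_fst : Continuous fun p : ℝ × ℝ => p.2 - p.1)
  have h1 : Tendsto (fun a => Lp.compMeasurePreserving (F a) (hmp a) (hg.toLp g)) (𝓝 a₀)
      (𝓝 (Lp.compMeasurePreserving (F a₀) (hmp a₀) (hg.toLp g))) :=
    (continuous_const (y := hg.toLp g)).compMeasurePreservingLp hF hmp (by norm_num) |>.tendsto a₀
  rw [tendsto_iff_edist_tendsto_0] at h1
  refine h1.congr fun a => ?_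
  rw [Lp.toLp_compMeasurePreserving hg (hmp a), Lp.toLp_compMeasurePreserving hg (hmp a₀),
    Lp.edist_toLp_toLp]
  rfl

lemma tendsto_eLpNorm_continuous {k : ℝ → ℝ → ℝ} (hk : Continuous fun p : ℝ × ℝ => k p.1 p.2)
    (L a₀ : ℝ) :
    Tendsto (fun a => eLpNorm (fun b => k a b - k a₀ b) 2 (volume.restrict (Ioo 0 L)))
      (𝓝 a₀) (𝓝 0) := by
  set V := (volume.restrict (Ioo 0 L)) univ ^ (2 : ENNReal).toReal⁻¹ with hV
  have hVt : V ≠ ⊤ := by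
    rw [hV]
    refine ENNReal.rpow_ne_top_of_nonneg (by norm_num) ?_
    simp
  rw [ENNReal.tendsto_nhds_zero]
  intro ε hε
  obtain ⟨δ, hδ, hδε⟩ : ∃ δ : ℝ, 0 < δ ∧ V * ENNReal.ofReal δ ≤ ε := by
    have : Tendsto (fun δ : ℝ => V * ENNReal.ofReal δ) (𝓝[>] 0) (𝓝 (V * ENNReal.ofReal 0)) :=
      (ENNReal.Tendsto.const_mul (ENNReal.tendsto_ofReal tendsto_id) (Or.inr hVt)).mono_left
        nhdsWithin_le_nhds
    rw [ENNReal.ofReal_zero, mul_zero, ENNReal.tendsto_nhds_zero] at this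
    obtain ⟨δ, h1, h2⟩ := ((this ε hε).and self_mem_nhdsWithin).exists
    exact ⟨δ, h2, h1⟩
  obtain ⟨v, hv, hvk⟩ := (isCompact_Icc (a := (0 : ℝ)) (b := L)).mem_uniformity_of_prod
    (f := k) (s := univ) (q := a₀) (by exact hk.continuousOn) (mem_univ _)
    (Metric.dist_mem_uniformity hδ)
  rw [nhdsWithin_univ] at hv
  filter_upwards [hv] with a ha
  refine (eLpNorm_le_of_ae_bound (C := δ) ?_).trans hδε
  filter_upwards [ae_restrict_mem measurableSet_Ioo] with b hb
  have := hvk a ha b (Ioo_subset_Icc_self hb)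
  exact (le_of_lt this)

lemma tendsto_eLpNorm_add_three {α : Type*} {F : Filter α} {β : Type*} [MeasurableSpace β]
    {μ : Measure β} {a b c : α → β → ℝ} (ha : ∀ i, AEStronglyMeasurable (a i) μ)
    (hb : ∀ i, AEStronglyMeasurable (b i) μ) (hc : ∀ i, AEStronglyMeasurable (c i) μ)
    (ta : Tendsto (fun i => eLpNorm (a i) 2 μ) F (𝓝 0))
    (tb : Tendsto (fun i => eLpNorm (b i) 2 μ) F (𝓝 0))
    (tc : Tendsto (fun i => eLpNorm (c i) 2 μ) F (𝓝 0)) :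
    Tendsto (fun i => eLpNorm (fun x => a i x + b i x + c i x) 2 μ) F (𝓝 0) := by
  have h0 : Tendsto (fun i => eLpNorm (a i) 2 μ + eLpNorm (b i) 2 μ + eLpNorm (c i) 2 μ) F
      (𝓝 0) := by simpa using (ta.add tb).add tc
  refine tendsto_of_tendsto_of_tendsto_of_le_of_le tendsto_const_nhds h0 (fun _ => zero_le)
    fun i => ?_
  refine (eLpNorm_add_le ((ha i).add (hb i)) (hc i) (by norm_num)).trans ?_
  gcongr
  exact eLpNorm_add_le (ha i) (hb i) (by norm_num)

section
variable {l : Fin 4 → ℝ} {P : Fin 4 × Bool → ℝ → ℝ} {h : Fin 4 → ℝ × ℝ → ℝ}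

lemma measurable_wave (hP : ∀ d, Measurable (P d)) (hh : ∀ j, Integrable (h j)) (j : Fin 4) :
    Measurable fun p : ℝ × ℝ => wave l P h j p.1 p.2 := by
  unfold wave
  refine (((hP _).comp ?_).add ((hP _).comp ?_)).add (continuous_duhamel (hh j)).measurable
  · fun_prop
  · fun_prop

/-- As a function of x, each free wave at time t is a translate of a fixed profile (reflected, for
the rightward one), so this is continuity of translations in L². -/
lemma tendsto_eLpNorm_wave_time (hPm : ∀ d, Measurable (P d)) (hP : ∀ d, MemLp (P d) 2)
    (hh : IsSource l h) (j : Fin 4) (t₀ : ℝ) :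
    Tendsto (fun t => eLpNorm (fun x => wave l P h j x t - wave l P h j x t₀) 2
      (volume.restrict (Ioo 0 (l j)))) (𝓝 t₀) (𝓝 0) := by
  have hd := continuous_duhamel (hh.integrable j)
  have hneg : MemLp (fun x => P (j, false) (-x)) 2 :=
    (hP (j, false)).comp_measurePreserving (Measure.measurePreserving_neg volume)
  have t1 := tendsto_eLpNorm_translate hneg t₀
  have t2 : Tendsto (fun t => eLpNorm (fun x => P (j, true) (x - (l j - t))
      - P (j, true) (x - (l j - t₀))) 2 volume) (𝓝 t₀) (𝓝 0) :=
    (tendsto_eLpNorm_translate (hP (j, true)) (l j - t₀)).comp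
      ((continuous_const.sub continuous_id).tendsto t₀)
  have t3 := tendsto_eLpNorm_continuous (k := fun t x => duhamel (h j) x t)
    (hd.comp (continuous_snd.prodMk continuous_fst)) (l j) t₀
  have rs : ∀ {F : ℝ → ℝ → ℝ}, Tendsto (fun t => eLpNorm (F t) 2 volume) (𝓝 t₀) (𝓝 0) →
      Tendsto (fun t => eLpNorm (F t) 2 (volume.restrict (Ioo 0 (l j)))) (𝓝 t₀) (𝓝 0) :=
    fun hF => tendsto_of_tendsto_of_tendsto_of_le_of_le tendsto_const_nhds hF
      (fun _ => zero_le) fun t => eLpNorm_mono_measure _ Measure.restrict_le_self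
  have dm : ∀ t, Measurable fun x => duhamel (h j) x t := fun t =>
    (hd.comp (by fun_prop : Continuous fun x : ℝ => (x, t))).measurable
  refine (tendsto_eLpNorm_add_three (fun t => ?_) (fun t => ?_) (fun t => ?_) (rs t1) (rs t2)
    t3).congr fun t => ?_
  · exact (((hPm _).comp (by fun_prop)).sub ((hPm _).comp (by fun_prop))).aestronglyMeasurable
  · exact (((hPm _).comp (by fun_prop)).sub ((hPm _).comp (by fun_prop))).aestronglyMeasurable
  · exact ((dm t).sub (dm t₀)).aestronglyMeasurable
  · congr 1; ext x
    simp only [wave, neg_sub]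
    rw [show x - (l j - t) = t - (l j - x) by ring, show x - (l j - t₀) = t₀ - (l j - x) by ring]
    ring

/-- With the roles of x and t exchanged, the same argument gives the trace: the departing profile
plus the arriving wave. It is a limit over all x, which is more than the essential limit required of
a trace. -/
lemma tendsto_eLpNorm_wave_space (hPm : ∀ d, Measurable (P d)) (hP : ∀ d, MemLp (P d) 2)
    (hh : IsSource l h) (j : Fin 4) (τ : ℝ) :
    Tendsto (fun x => eLpNorm (fun t => wave l P h j x t
      - (P (j, false) t + incoming l P h (j, true) t)) 2 (volume.restrict (Ioo 0 τ)))
      (𝓝 0) (𝓝 0) := by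
  have hd := continuous_duhamel (hh.integrable j)
  have t1 := tendsto_eLpNorm_translate (hP (j, false)) 0
  have t2 : Tendsto (fun x => eLpNorm (fun t => P (j, true) (t - (l j - x))
      - P (j, true) (t - (l j - 0))) 2 volume) (𝓝 0) (𝓝 0) :=
    (tendsto_eLpNorm_translate (hP (j, true)) (l j - 0)).comp
      ((continuous_const.sub continuous_id).tendsto 0)
  have t3 := tendsto_eLpNorm_continuous (k := fun x t => duhamel (h j) x t) hd τ 0
  have rs : ∀ {F : ℝ → ℝ → ℝ}, Tendsto (fun t => eLpNorm (F t) 2 volume) (𝓝 0) (𝓝 0) →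
      Tendsto (fun t => eLpNorm (F t) 2 (volume.restrict (Ioo 0 τ))) (𝓝 0) (𝓝 0) :=
    fun hF => tendsto_of_tendsto_of_tendsto_of_le_of_le tendsto_const_nhds hF
      (fun _ => zero_le) fun t => eLpNorm_mono_measure _ Measure.restrict_le_self
  have dm : ∀ x, Measurable fun t => duhamel (h j) x t := fun x =>
    (hd.comp (by fun_prop : Continuous fun t : ℝ => (x, t))).measurable
  refine (tendsto_eLpNorm_add_three (fun t => ?_) (fun t => ?_) (fun t => ?_) (rs t1) (rs t2)
    t3).congr fun x => ?_
  · exact (((hPm _).comp (by fun_prop)).sub ((hPm _).comp (by fun_prop))).aestronglyMeasurable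
  · exact (((hPm _).comp (by fun_prop)).sub ((hPm _).comp (by fun_prop))).aestronglyMeasurable
  · exact ((dm t).sub (dm 0)).aestronglyMeasurable
  · congr 1; ext t
    simp only [wave, incoming, endpoint, sub_zero]
    simp only [if_true]
    ring

lemma memLp_duhamel (hh : IsSource l h) (j : Fin 4) (t b : ℝ) :
    MemLp (fun x => duhamel (h j) x t) 2 (volume.restrict (Ioo 0 b)) := by
  have hc : Continuous fun x => duhamel (h j) x t :=
    (continuous_duhamel (hh.integrable j)).comp (by fun_prop : Continuous fun x : ℝ => (x, t))
  obtain ⟨M, hM⟩ := isCompact_Icc.exists_bound_of_continuousOn (s := Icc 0 b) hc.continuousOn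
  refine MemLp.of_bound hc.aestronglyMeasurable M ?_
  filter_upwards [ae_restrict_mem measurableSet_Ioo] with x hx using hM x (Ioo_subset_Icc_self hx)

lemma memLp_wave (hP : ∀ d, MemLp (P d) 2) (hh : IsSource l h) (j : Fin 4) (t : ℝ) :
    MemLp (fun x => wave l P h j x t) 2 (volume.restrict (Ioo 0 (l j))) := by
  refine MemLp.add (MemLp.add ?_ ?_) (memLp_duhamel hh j t (l j))
  · exact ((hP (j, false)).comp_measurePreserving
      (Measure.measurePreserving_sub_left volume t)).restrict _
  · have := ((hP (j, true)).comp_measurePreserving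
      (measurePreserving_sub_right volume (l j - t))).restrict (Ioo 0 (l j))
    refine this.ae_eq (ae_of_all _ fun x => ?_)
    simp only [Function.comp]
    congr 1; ring

end

/-! ### Scattering at the vertices -/

/-- The coefficient of the wave arriving along `d'` in the wave leaving along `d`. At a vertex `v`,
`c v = 2 / deg v` corresponds to the Kirchhoff condition and `c v = 0` to a Dirichlet condition. -/
noncomputable def scatter (c : Fin 4 → ℝ) (d d' : Fin 4 × Bool) : ℝ :=
  (if tail d = tail (rev d') then c (tail d) else 0) - if d' = rev d then 1 else 0

/-- One transport along the edges followed by scattering at the vertices. -/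
noncomputable def step (c l : Fin 4 → ℝ) (G : Fin 4 × Bool → ℝ → ℝ) (d : Fin 4 × Bool) (t : ℝ) : ℝ :=
  ∑ d', scatter c d d' * G d' (t - l d'.1)

/-- The first `N` terms of the Neumann series of the delay system `P = G + step P`. -/
noncomputable def solve (c l : Fin 4 → ℝ) (N : ℕ) (G : Fin 4 × Bool → ℝ → ℝ) (d : Fin 4 × Bool)
    (t : ℝ) : ℝ :=
  ∑ n ∈ Finset.range N, (step c l)^[n] G d t

lemma rev_rev (d : Fin 4 × Bool) : rev (rev d) = d := by simp [rev]

lemma tail_of_scatter_ne_zero {c : Fin 4 → ℝ} {d d' : Fin 4 × Bool} (h : scatter c d d' ≠ 0) :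
    tail (rev d') = tail d := by
  by_contra hne
  apply h
  unfold scatter
  rw [if_neg (Ne.symm hne), if_neg, sub_zero]
  rintro rfl
  exact hne (by rw [rev_rev])

lemma abs_scatter_le {c : Fin 4 → ℝ} (hc : ∀ v, c v ∈ Icc (0 : ℝ) 1) (d d' : Fin 4 × Bool) :
    |scatter c d d'| ≤ 1 := by
  obtain ⟨h0, h1⟩ := hc (tail d)
  unfold scatter
  rw [abs_le]
  split_ifs <;> constructor <;> linarith

section
variable {c l : Fin 4 → ℝ}

/-- The geometric series telescopes. The last term is the only defect, and `iterate_step_eq_zero`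
removes it up to the time N m. -/
lemma solve_eq (N : ℕ) (G : Fin 4 × Bool → ℝ → ℝ) (d : Fin 4 × Bool) (t : ℝ) :
    solve c l N G d t = G d t + step c l (solve c l N G) d t - (step c l)^[N] G d t := by
  have h1 : step c l (solve c l N G) d t = ∑ n ∈ Finset.range N, (step c l)^[n + 1] G d t := by
    simp only [step, solve, Finset.mul_sum, Function.iterate_succ_apply']
    rw [Finset.sum_comm]
  have h2 := Finset.sum_range_succ' (fun n => (step c l)^[n] G d t) N
  have h3 := Finset.sum_range_succ (fun n => (step c l)^[n] G d t) N
  rw [h1]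
  simp only [Function.iterate_zero, id] at h2
  unfold solve
  linarith

/-- Every passage along an edge costs at least the time m. -/
lemma iterate_step_eq_zero {m : ℝ} (hm : ∀ j, m ≤ l j) {G : Fin 4 × Bool → ℝ → ℝ}
    (hG : ∀ d, ∀ t ≤ 0, G d t = 0) (n : ℕ) :
    ∀ d, ∀ t ≤ n * m, (step c l)^[n] G d t = 0 := by
  induction n with
  | zero => simpa using hG
  | succ n ih =>
    intro d t ht
    rw [Function.iterate_succ_apply']
    refine Finset.sum_eq_zero fun d' _ => ?_
    rw [ih d' _ _, mul_zero]
    push_cast at ht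
    linarith [hm d'.1]

/-- The finite Neumann series consists of linear combinations of translates. Measurability, local
square integrability and smoothness all pass to the profiles by this principle. -/
lemma solve_induction {Q : (ℝ → ℝ) → Prop} (h0 : Q fun _ => 0)
    (hadd : ∀ f g, Q f → Q g → Q fun t => f t + g t) (hmul : ∀ (a : ℝ) f, Q f → Q fun t => a * f t)
    (htr : ∀ (a : ℝ) f, Q f → Q fun t => f (t - a)) {G : Fin 4 × Bool → ℝ → ℝ} (hG : ∀ d, Q (G d))
    (N : ℕ) (d : Fin 4 × Bool) : Q (solve c l N G d) := by
  have hsum : ∀ {ι : Type} (s : Finset ι) (F : ι → ℝ → ℝ), (∀ i, Q (F i)) →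
      Q fun t => ∑ i ∈ s, F i t := by
    classical
    intro ι s F hF
    induction s using Finset.induction_on with
    | empty => simpa using h0
    | insert a s ha ih => simp only [Finset.sum_insert ha]; exact hadd _ _ (hF a) ih
  refine hsum _ _ fun n => ?_
  induction n generalizing d with
  | zero => exact hG d
  | succ n ih =>
    rw [Function.iterate_succ_apply']
    exact hsum Finset.univ (fun d' t => scatter c d d' * (step c l)^[n] G d' (t - l d'.1)) fun d' =>
      hmul _ _ (htr _ _ (ih d'))

/-! ### Frames and the speed of propagation -/

/-- Time offsets `V` at the vertices and `δ` on the edges which increase at most with unit speed: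
a signal does not travel backwards with respect to the time `t - δ j x`. -/
structure IsFrame (l : Fin 4 → ℝ) (V : Fin 4 → ℝ) (δ : Fin 4 → ℝ → ℝ) : Prop where
  lipschitz : ∀ j x y, |δ j x - δ j y| ≤ |x - y|
  start : ∀ j, δ j 0 = V (tail (j, false))
  finish : ∀ j, δ j (l j) = V (tail (j, true))

/-- In frame time, a wave never reaches the end of an edge before it left the start. -/
lemma IsFrame.tail_rev_le {V : Fin 4 → ℝ} {δ : Fin 4 → ℝ → ℝ} (hF : IsFrame l V δ)
    (hl : ∀ j, 0 < l j) (d : Fin 4 × Bool) : V (tail (rev d)) ≤ V (tail d) + l d.1 := by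
  obtain ⟨j, b⟩ := d
  have h := hF.lipschitz j 0 (l j)
  rw [hF.start, hF.finish, zero_sub, abs_neg, abs_of_pos (hl j), abs_le] at h
  cases b
  · exact sub_le_iff_le_add'.1 (by simp only [rev, Bool.not_false]; linarith)
  · exact sub_le_iff_le_add'.1 (by simp only [rev, Bool.not_true]; linarith)

lemma IsFrame.continuous {V : Fin 4 → ℝ} {δ : Fin 4 → ℝ → ℝ} (hF : IsFrame l V δ) (j : Fin 4) :
    Continuous (δ j) := by
  refine (LipschitzWith.of_dist_le_mul (K := 1) fun x y => ?_).continuous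
  simpa [Real.dist_eq] using hF.lipschitz j x y

/-- A bound which is monotone in frame time survives transport because arrival is not earlier than
departure. The 8 counts the directed edges; each coefficient is at most 1 in absolute value. -/
lemma enorm_step_le {V : Fin 4 → ℝ} {δ : Fin 4 → ℝ → ℝ} (hF : IsFrame l V δ)
    (hl : ∀ j, 0 < l j) (hc : ∀ v, c v ∈ Icc (0 : ℝ) 1) {B : ℝ → ENNReal} (hB : Monotone B)
    {G : Fin 4 × Bool → ℝ → ℝ} (hG : ∀ d t, ‖G d t‖ₑ ≤ B (t - V (tail d))) (d : Fin 4 × Bool)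
    (t : ℝ) : ‖step c l G d t‖ₑ ≤ 8 * B (t - V (tail d)) := by
  have h8 : (8 : ENNReal) * B (t - V (tail d)) = ∑ _d' : Fin 4 × Bool, B (t - V (tail d)) := by
    simp
  rw [h8]
  refine (enorm_sum_le _ _).trans (Finset.sum_le_sum fun d' _ => ?_)
  by_cases h : scatter c d d' = 0
  · simp [h]
  · rw [enorm_mul]
    have h1 : ‖scatter c d d'‖ₑ ≤ 1 := by
      rw [← ofReal_norm, ENNReal.ofReal_le_one]
      exact abs_scatter_le hc d d'
    refine (mul_le_of_le_one_left' h1).trans ((hG d' _).trans (hB ?_))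
    have := hF.tail_rev_le hl d'
    rw [tail_of_scatter_ne_zero h] at this
    linarith

/-- The constant in the bound for `solve`. -/
noncomputable def solveConst (N : ℕ) : ENNReal := ∑ n ∈ Finset.range N, 8 ^ n

lemma solveConst_ne_top (N : ℕ) : solveConst N ≠ ⊤ := by
  unfold solveConst
  exact ENNReal.sum_ne_top.2 fun n _ => ENNReal.pow_ne_top (by norm_num)

lemma enorm_solve_le {V : Fin 4 → ℝ} {δ : Fin 4 → ℝ → ℝ} (hF : IsFrame l V δ)
    (hl : ∀ j, 0 < l j) (hc : ∀ v, c v ∈ Icc (0 : ℝ) 1) {B : ℝ → ENNReal} (hB : Monotone B)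
    {G : Fin 4 × Bool → ℝ → ℝ} (hG : ∀ d t, ‖G d t‖ₑ ≤ B (t - V (tail d))) (N : ℕ)
    (d : Fin 4 × Bool) (t : ℝ) : ‖solve c l N G d t‖ₑ ≤ solveConst N * B (t - V (tail d)) := by
  have h : ∀ n d t, ‖(step c l)^[n] G d t‖ₑ ≤ 8 ^ n * B (t - V (tail d)) := by
    intro n
    induction n with
    | zero => simpa using hG
    | succ n ih =>
      intro d t
      rw [Function.iterate_succ_apply', pow_succ', mul_assoc]
      exact enorm_step_le hF hl hc (B := fun r => 8 ^ n * B r)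
        (fun r s hrs => by dsimp only; gcongr; exact hB hrs) ih d t
  unfold solve solveConst
  rw [Finset.sum_mul]
  exact (enorm_sum_le _ _).trans (Finset.sum_le_sum fun n _ => h n d t)

/-! ### Profiles generated by data and sources -/

/-- The waves leaving the vertices directly because of the data `ι` and of the sources `h`. -/
noncomputable def emitted (c l : Fin 4 → ℝ) (ι : Fin 4 × Bool → ℝ → ℝ) (h : Fin 4 → ℝ × ℝ → ℝ)
    (d : Fin 4 × Bool) (t : ℝ) : ℝ :=
  ι d t + ∑ d', scatter c d d' * duhamel (h d'.1) (endpoint l d') t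

/-- The profiles of the waves leaving the vertices because of the data `ι` and the sources `h`. -/
noncomputable def profile (c l : Fin 4 → ℝ) (N : ℕ) (ι : Fin 4 × Bool → ℝ → ℝ)
    (h : Fin 4 → ℝ × ℝ → ℝ) : Fin 4 × Bool → ℝ → ℝ :=
  solve c l N (emitted c l ι h)

/-- The mass of the sources up to the time `r` of the frame. -/
noncomputable def pastMass (δ : Fin 4 → ℝ → ℝ) (h : Fin 4 → ℝ × ℝ → ℝ) (r : ℝ) : ENNReal :=
  ∑ k, ∫⁻ p in {p : ℝ × ℝ | p.2 - δ k p.1 ≤ r}, ‖h k p‖ₑ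

lemma monotone_pastMass (δ : Fin 4 → ℝ → ℝ) (h : Fin 4 → ℝ × ℝ → ℝ) : Monotone (pastMass δ h) :=
  fun _ _ hrs => Finset.sum_le_sum fun _ _ =>
    lintegral_mono_set fun _ hp => le_trans hp hrs

/-- Since the offsets have Lipschitz constant 1, the backward light cone of (x, t) lies in the frame
past of (x, t). -/
lemma enorm_duhamel_le_pastMass {V : Fin 4 → ℝ} {δ : Fin 4 → ℝ → ℝ} (hF : IsFrame l V δ)
    (h : Fin 4 → ℝ × ℝ → ℝ) (j : Fin 4) (x t : ℝ) :
    ‖duhamel (h j) x t‖ₑ ≤ pastMass δ h (t - δ j x) := by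
  refine (enorm_duhamel_le _ _ _).trans (le_trans ?_ (Finset.single_le_sum
    (f := fun k => ∫⁻ p in {p : ℝ × ℝ | p.2 - δ k p.1 ≤ t - δ j x}, ‖h k p‖ₑ)
    (fun _ _ => zero_le) (Finset.mem_univ j)))
  refine lintegral_mono_set fun p hp => ?_
  simp only [Set.mem_ofPred_eq] at hp ⊢
  have := (abs_le.1 (hF.lipschitz j x p.1)).2
  linarith

lemma duhamel_eq_zero_of_nonpos {h : Fin 4 → ℝ × ℝ → ℝ} (hh : IsSource l h) (j : Fin 4) (x : ℝ)
    {t : ℝ} (ht : t ≤ 0) : duhamel (h j) x t = 0 := by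
  refine integral_eq_zero_of_ae (ae_of_all _ fun p => ?_)
  by_cases hp : h j p = 0
  · simp [hp]
  · have : lightCone ((x, t) - p) = 0 := lightCone_of_lt (by
      simp only [Prod.fst_sub, Prod.snd_sub]
      linarith [(hh.support j p hp).2, abs_nonneg (x - p.1)])
    simp [this]

lemma enorm_emitted_le {V : Fin 4 → ℝ} {δ : Fin 4 → ℝ → ℝ} (hF : IsFrame l V δ)
    (hc : ∀ v, c v ∈ Icc (0 : ℝ) 1) {B : ℝ → ENNReal} {ι : Fin 4 × Bool → ℝ → ℝ}
    (hι : ∀ d t, ‖ι d t‖ₑ ≤ B (t - V (tail d))) (h : Fin 4 → ℝ × ℝ → ℝ) (d : Fin 4 × Bool) (t : ℝ) :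
    ‖emitted c l ι h d t‖ₑ ≤ B (t - V (tail d)) + 8 * pastMass δ h (t - V (tail d)) := by
  refine (enorm_add_le _ _).trans (add_le_add (hι d t) ?_)
  have h8 : (8 : ENNReal) * pastMass δ h (t - V (tail d))
    = ∑ _d' : Fin 4 × Bool, pastMass δ h (t - V (tail d)) := by simp
  rw [h8]
  refine (enorm_sum_le _ _).trans (Finset.sum_le_sum fun d' _ => ?_)
  by_cases hs : scatter c d d' = 0
  · simp [hs]
  · rw [enorm_mul]
    have h1 : ‖scatter c d d'‖ₑ ≤ 1 := by
      rw [← ofReal_norm, ENNReal.ofReal_le_one]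
      exact abs_scatter_le hc d d'
    refine (mul_le_of_le_one_left' h1).trans ((enorm_duhamel_le_pastMass hF h d'.1 _ _).trans_eq ?_)
    congr 2
    rw [← tail_of_scatter_ne_zero hs]
    obtain ⟨j, b⟩ := d'
    cases b
    · simpa [endpoint, rev] using hF.finish j
    · simpa [endpoint, rev] using hF.start j

lemma enorm_profile_le {V : Fin 4 → ℝ} {δ : Fin 4 → ℝ → ℝ} (hF : IsFrame l V δ)
    (hl : ∀ j, 0 < l j) (hc : ∀ v, c v ∈ Icc (0 : ℝ) 1) {B : ℝ → ENNReal} (hB : Monotone B)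
    {ι : Fin 4 × Bool → ℝ → ℝ} (hι : ∀ d t, ‖ι d t‖ₑ ≤ B (t - V (tail d)))
    (h : Fin 4 → ℝ × ℝ → ℝ) (N : ℕ) (d : Fin 4 × Bool) (t : ℝ) :
    ‖profile c l N ι h d t‖ₑ
      ≤ solveConst N * (B (t - V (tail d)) + 8 * pastMass δ h (t - V (tail d))) :=
  enorm_solve_le hF hl hc (B := fun r => B r + 8 * pastMass δ h r)
    (fun r s hrs => by dsimp only; gcongr; exacts [hB hrs, monotone_pastMass δ h hrs])
    (enorm_emitted_le hF hc hι h) N d t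

/-- The Duhamel part of an arriving wave sits in `emitted` and its free part in `step`; together
they form `incoming`. The truncation of the series is not felt before the time N m. -/
lemma profile_eq {m : ℝ} (hm : ∀ j, m ≤ l j) {ι : Fin 4 × Bool → ℝ → ℝ}
    (hι : ∀ d, ∀ t ≤ 0, ι d t = 0) {h : Fin 4 → ℝ × ℝ → ℝ} (hh : IsSource l h) (N : ℕ)
    (d : Fin 4 × Bool) {t : ℝ} (ht : t ≤ N * m) :
    profile c l N ι h d t
      = ι d t + ∑ d', scatter c d d' * incoming l (profile c l N ι h) h d' t := by
  have hG : ∀ d, ∀ t ≤ 0, emitted c l ι h d t = 0 := fun d t ht => by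
    simp [emitted, hι d t ht, duhamel_eq_zero_of_nonpos hh _ _ ht]
  rw [profile, solve_eq, iterate_step_eq_zero hm hG N d t ht, sub_zero]
  simp only [emitted, step, incoming, mul_add, Finset.sum_add_distrib]
  ring

lemma profile_eq_zero {ι : Fin 4 × Bool → ℝ → ℝ} (hl : ∀ j, 0 < l j)
    (hι : ∀ d, ∀ t ≤ 0, ι d t = 0) {h : Fin 4 → ℝ × ℝ → ℝ} (hh : IsSource l h) (N : ℕ)
    (d : Fin 4 × Bool) {t : ℝ} (ht : t ≤ 0) : profile c l N ι h d t = 0 := by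
  have hG : ∀ d, ∀ t ≤ 0, emitted c l ι h d t = 0 := fun d t ht => by
    simp [emitted, hι d t ht, duhamel_eq_zero_of_nonpos hh _ _ ht]
  unfold profile solve
  refine Finset.sum_eq_zero fun n _ => iterate_step_eq_zero (m := 0) (fun j => (hl j).le) hG n d t ?_
  simpa using ht

/-- Linearity in data and source jointly, so that Lipschitz estimates reduce to bounds for a single
profile. -/
lemma profile_sub (N : ℕ) (ι ι' : Fin 4 × Bool → ℝ → ℝ) {h h' : Fin 4 → ℝ × ℝ → ℝ}
    (hh : ∀ j, Integrable (h j)) (hh' : ∀ j, Integrable (h' j)) (d : Fin 4 × Bool) (t : ℝ) :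
    profile c l N (fun d t => ι d t - ι' d t) (fun j p => h j p - h' j p) d t
      = profile c l N ι h d t - profile c l N ι' h' d t := by
  have he : emitted c l (fun d t => ι d t - ι' d t) (fun j p => h j p - h' j p)
      = fun d t => emitted c l ι h d t - emitted c l ι' h' d t := by
    ext d t
    simp only [emitted, duhamel_sub (hh _) (hh' _), mul_sub, Finset.sum_sub_distrib]
    ring
  have hs : ∀ n, (step c l)^[n] (fun d t => emitted c l ι h d t - emitted c l ι' h' d t)
      = fun d t => (step c l)^[n] (emitted c l ι h) d t - (step c l)^[n] (emitted c l ι' h') d t := by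
    intro n
    induction n with
    | zero => rfl
    | succ n ih =>
      rw [Function.iterate_succ_apply', ih]
      ext d t
      simp only [Function.iterate_succ_apply', step, mul_sub, Finset.sum_sub_distrib]
  simp only [profile, solve, he, hs, Finset.sum_sub_distrib]

lemma wave_sub (P P' : Fin 4 × Bool → ℝ → ℝ) {h h' : Fin 4 → ℝ × ℝ → ℝ}
    (hh : ∀ j, Integrable (h j)) (hh' : ∀ j, Integrable (h' j)) (j : Fin 4) (x t : ℝ) :
    wave l (fun d t => P d t - P' d t) (fun j p => h j p - h' j p) j x t
      = wave l P h j x t - wave l P' h' j x t := by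
  simp only [wave, duhamel_sub (hh _) (hh' _)]
  ring

lemma incoming_sub (P P' : Fin 4 × Bool → ℝ → ℝ) {h h' : Fin 4 → ℝ × ℝ → ℝ}
    (hh : ∀ j, Integrable (h j)) (hh' : ∀ j, Integrable (h' j)) (d : Fin 4 × Bool) (t : ℝ) :
    incoming l (fun d t => P d t - P' d t) (fun j p => h j p - h' j p) d t
      = incoming l P h d t - incoming l P' h' d t := by
  simp only [incoming, duhamel_sub (hh _) (hh' _)]
  ring

/-- The two free waves left the endpoints at frame times no later than that of (x, t), and the light
cone lies in its past. -/
lemma enorm_wave_le {V : Fin 4 → ℝ} {δ : Fin 4 → ℝ → ℝ} (hF : IsFrame l V δ) {B : ℝ → ENNReal}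
    (hB : Monotone B) {P : Fin 4 × Bool → ℝ → ℝ} {h : Fin 4 → ℝ × ℝ → ℝ}
    (hP : ∀ d t, ‖P d t‖ₑ ≤ B (t - V (tail d))) (j : Fin 4) {x : ℝ} (hx : x ∈ Icc 0 (l j)) (t : ℝ) :
    ‖wave l P h j x t‖ₑ ≤ 2 * B (t - δ j x) + pastMass δ h (t - δ j x) := by
  refine (enorm_add_le _ _).trans (add_le_add ((enorm_add_le _ _).trans ?_)
    (enorm_duhamel_le_pastMass hF h j x t))
  rw [two_mul]
  refine add_le_add ((hP _ _).trans (hB ?_)) ((hP _ _).trans (hB ?_))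
  · have := (abs_le.1 (hF.lipschitz j x 0)).2
    rw [hF.start, sub_zero, abs_of_nonneg hx.1] at this
    linarith
  · have := (abs_le.1 (hF.lipschitz j x (l j))).2
    rw [hF.finish, abs_of_nonpos (by linarith [hx.2])] at this
    linarith

lemma enorm_incoming_le {V : Fin 4 → ℝ} {δ : Fin 4 → ℝ → ℝ} (hF : IsFrame l V δ)
    (hl : ∀ j, 0 < l j) {B : ℝ → ENNReal}
    (hB : Monotone B) {P : Fin 4 × Bool → ℝ → ℝ} {h : Fin 4 → ℝ × ℝ → ℝ}
    (hP : ∀ d t, ‖P d t‖ₑ ≤ B (t - V (tail d))) (d : Fin 4 × Bool) (t : ℝ) :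
    ‖incoming l P h d t‖ₑ ≤ B (t - V (tail (rev d))) + pastMass δ h (t - V (tail (rev d))) := by
  refine (enorm_add_le _ _).trans (add_le_add ((hP _ _).trans (hB ?_)) ?_)
  · linarith [hF.tail_rev_le hl d]
  · refine (enorm_duhamel_le_pastMass hF h d.1 _ _).trans_eq ?_
    congr 2
    obtain ⟨j, b⟩ := d
    cases b
    · simpa [endpoint, rev] using hF.finish j
    · simpa [endpoint, rev] using hF.start j

end

/-! ### A Gronwall inequality and a fixed point theorem in weighted `L¹` spaces -/

section
variable {l : Fin 4 → ℝ} {V : Fin 4 → ℝ} {δ : Fin 4 → ℝ → ℝ}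

/-- The exponential weight in the time of the frame. -/
noncomputable def weight (a : ℝ) (δ : Fin 4 → ℝ → ℝ) (j : Fin 4) (p : ℝ × ℝ) : ENNReal :=
  ENNReal.ofReal (Real.exp (-a * (p.2 - δ j p.1)))

lemma IsFrame.measurable_time (hF : IsFrame l V δ) (j : Fin 4) :
    Measurable fun p : ℝ × ℝ => p.2 - δ j p.1 :=
  measurable_snd.sub ((hF.continuous j).measurable.comp measurable_fst)

lemma IsFrame.measurable_weight (hF : IsFrame l V δ) (a : ℝ) (j : Fin 4) :
    Measurable (weight a δ j) :=
  (Real.measurable_exp.comp ((hF.measurable_time j).const_mul _)).ennreal_ofReal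

lemma weight_ne_zero (a : ℝ) (j : Fin 4) (p : ℝ × ℝ) : weight a δ j p ≠ 0 := by
  simp [weight, Real.exp_pos]

lemma lintegral_exp_Ici {a : ℝ} (ha : 0 < a) (r : ℝ) :
    ∫⁻ s in Ici r, ENNReal.ofReal (Real.exp (-a * s)) = ENNReal.ofReal (Real.exp (-a * r) / a) := by
  rw [setLIntegral_congr Ioi_ae_eq_Ici.symm, ← ofReal_integral_eq_lintegral_ofReal
    (integrableOn_exp_mul_Ioi (by linarith) r) (ae_of_all _ fun s => (Real.exp_pos _).le),
    integral_exp_mul_Ioi (by linarith) r]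
  congr 1
  rw [neg_div_neg_eq]

/-- On each line x = const the weight after frame time r integrates to exp(-a r) / a; the edge
contributes its length. -/
lemma lintegral_weight_le (hF : IsFrame l V δ) {a : ℝ} (ha : 0 < a) (j : Fin 4)
    (r : ℝ) :
    ∫⁻ p in {p : ℝ × ℝ | p.1 ∈ Ioo 0 (l j) ∧ r ≤ p.2 - δ j p.1}, weight a δ j p
      ≤ ENNReal.ofReal (l j / a) * ENNReal.ofReal (Real.exp (-a * r)) := by
  have hm1 : MeasurableSet {p : ℝ × ℝ | p.1 ∈ Ioo 0 (l j) ∧ r ≤ p.2 - δ j p.1} :=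
    (measurable_fst measurableSet_Ioo).inter
      (measurableSet_le measurable_const (hF.measurable_time j))
  rw [← lintegral_indicator hm1, Measure.volume_eq_prod,
    lintegral_prod _ ((hF.measurable_weight a j).indicator hm1).aemeasurable]
  have h1 : ∀ x, ∫⁻ t, {p : ℝ × ℝ | p.1 ∈ Ioo 0 (l j) ∧ r ≤ p.2 - δ j p.1}.indicator
      (weight a δ j) (x, t) = (Ioo 0 (l j)).indicator
        (fun _ => ENNReal.ofReal (Real.exp (-a * r) / a)) x := by
    intro x
    by_cases hx : x ∈ Ioo 0 (l j)
    · rw [indicator_of_mem hx, ← lintegral_exp_Ici ha, ← lintegral_indicator measurableSet_Ici,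
        ← lintegral_sub_right_eq_self (fun t => (Ici r).indicator
          (fun s => ENNReal.ofReal (Real.exp (-a * s))) t) (δ j x)]
      congr 1; ext t
      simp only [indicator, Set.mem_ofPred_eq, mem_Ici, hx, true_and, weight]
    · rw [indicator_of_notMem hx]
      simp only [indicator, Set.mem_ofPred_eq, hx, false_and, if_false, lintegral_zero]
  simp_rw [h1]
  rw [lintegral_indicator measurableSet_Ioo, setLIntegral_const, Real.volume_Ioo, sub_zero,
    div_eq_mul_inv, div_eq_mul_inv, ENNReal.ofReal_mul (Real.exp_pos _).le,
    ENNReal.ofReal_mul' (inv_pos.2 ha).le]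
  rw [mul_comm, mul_right_comm]
  exact le_of_eq (by ring)

/-- Integrating the past mass of `F` against the weight gains a factor `l j / a`. -/
lemma lintegral_weight_mul_past_le (hF : IsFrame l V δ) {a : ℝ} (ha : 0 < a) (j k : Fin 4) (T : ℝ)
    {F : ℝ × ℝ → ENNReal} (hFm : AEMeasurable F) :
    ∫⁻ p in {p : ℝ × ℝ | p.1 ∈ Ioo 0 (l j) ∧ p.2 - δ j p.1 < T},
        weight a δ j p * ∫⁻ p' in {p' : ℝ × ℝ | p'.2 - δ k p'.1 ≤ p.2 - δ j p.1}, F p'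
      ≤ ENNReal.ofReal (l j / a) *
        ∫⁻ p' in {p' : ℝ × ℝ | p'.2 - δ k p'.1 < T}, weight a δ k p' * F p' := by
  set S : Set (ℝ × ℝ) := {p : ℝ × ℝ | p.1 ∈ Ioo 0 (l j) ∧ p.2 - δ j p.1 < T} with hS
  have hSm : MeasurableSet S := (measurable_fst measurableSet_Ioo).inter
      (measurableSet_lt (hF.measurable_time j) measurable_const)
  have hTm : MeasurableSet {p' : ℝ × ℝ | p'.2 - δ k p'.1 < T} :=
    measurableSet_lt (hF.measurable_time k) measurable_const
  have hRm : MeasurableSet {z : (ℝ × ℝ) × (ℝ × ℝ) | z.2.2 - δ k z.2.1 ≤ z.1.2 - δ j z.1.1} :=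
    measurableSet_le ((hF.measurable_time k).comp measurable_snd)
      ((hF.measurable_time j).comp measurable_fst)
  have e1 : ∀ p, weight a δ j p * ∫⁻ p' in {p' : ℝ × ℝ | p'.2 - δ k p'.1 ≤ p.2 - δ j p.1}, F p'
      = ∫⁻ p', {z : (ℝ × ℝ) × (ℝ × ℝ) | z.2.2 - δ k z.2.1 ≤ z.1.2 - δ j z.1.1}.indicator
          (fun z => weight a δ j z.1 * F z.2) (p, p') := by
    intro p
    have hm : MeasurableSet {p' : ℝ × ℝ | p'.2 - δ k p'.1 ≤ p.2 - δ j p.1} :=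
      measurableSet_le (hF.measurable_time k) measurable_const
    rw [← lintegral_const_mul'' _ hFm.restrict, ← lintegral_indicator hm]
    rfl
  simp_rw [e1]
  -- Tonelli: instead of the past of p, integrate for fixed p' over the points p after p', where the
  -- weight has total mass at most l j / a times the weight at p'.
  rw [lintegral_lintegral_swap]
  swap
  · refine AEMeasurable.indicator ?_ hRm
    exact ((hF.measurable_weight a j).comp measurable_fst).aemeasurable.mul
      (hFm.comp_quasiMeasurePreserving Measure.quasiMeasurePreserving_snd)
  rw [← lintegral_const_mul' _ _ ENNReal.ofReal_ne_top, ← lintegral_indicator hTm]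
  refine lintegral_mono fun p' => ?_
  have e2 : ∀ p, {z : (ℝ × ℝ) × (ℝ × ℝ) | z.2.2 - δ k z.2.1 ≤ z.1.2 - δ j z.1.1}.indicator
          (fun z => weight a δ j z.1 * F z.2) (p, p')
      = ({p : ℝ × ℝ | p'.2 - δ k p'.1 ≤ p.2 - δ j p.1}.indicator (weight a δ j) p) * F p' := by
    intro p; simp only [indicator, Set.mem_ofPred_eq]; split_ifs <;> simp
  have hm : MeasurableSet {p : ℝ × ℝ | p'.2 - δ k p'.1 ≤ p.2 - δ j p.1} :=
    measurableSet_le measurable_const (hF.measurable_time j)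
  simp_rw [e2]
  rw [lintegral_mul_const _ ((hF.measurable_weight a j).indicator hm), lintegral_indicator hm,
    Measure.restrict_restrict hm]
  by_cases hT : p'.2 - δ k p'.1 < T
  · rw [indicator_of_mem (by exact hT), ← mul_assoc]
    gcongr
    refine le_trans (lintegral_mono_set ?_) (lintegral_weight_le hF ha j _)
    rintro p ⟨h1, h2⟩
    exact ⟨h2.1, h1⟩
  · have : {p : ℝ × ℝ | p'.2 - δ k p'.1 ≤ p.2 - δ j p.1} ∩ S = ∅ := by
      ext p
      simp only [mem_inter_iff, Set.mem_ofPred_eq, mem_empty_iff_false, iff_false, hS]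
      rintro ⟨h1, -, h2⟩
      linarith
    rw [this]
    simp

/-- The total weighted mass of `h` before the time `T` of the frame. -/
noncomputable def weightedMass (a : ℝ) (δ : Fin 4 → ℝ → ℝ) (T : ℝ) (h : Fin 4 → ℝ × ℝ → ℝ) :
    ENNReal :=
  ∑ k, ∫⁻ p in {p : ℝ × ℝ | p.2 - δ k p.1 < T}, weight a δ k p * ‖h k p‖ₑ

lemma lintegral_weight_mul_pastMass_le (hF : IsFrame l V δ) {a : ℝ} (ha : 0 < a) (j : Fin 4) (T : ℝ)
    {h : Fin 4 → ℝ × ℝ → ℝ} (hh : ∀ j, AEStronglyMeasurable (h j)) :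
    ∫⁻ p in {p : ℝ × ℝ | p.1 ∈ Ioo 0 (l j) ∧ p.2 - δ j p.1 < T},
        weight a δ j p * pastMass δ h (p.2 - δ j p.1)
      ≤ ENNReal.ofReal (l j / a) * weightedMass a δ T h := by
  unfold pastMass weightedMass
  simp_rw [Finset.mul_sum]
  rw [lintegral_finsetSum']
  · exact Finset.sum_le_sum fun k _ =>
      lintegral_weight_mul_past_le hF ha j k T (hh k).enorm
  · intro k _
    refine (hF.measurable_weight a j).aemeasurable.mul ?_
    have hmono : Monotone fun r => ∫⁻ p' in {p' : ℝ × ℝ | p'.2 - δ k p'.1 ≤ r}, ‖h k p'‖ₑ :=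
      fun _ _ hrs => lintegral_mono_set fun _ hp => le_trans hp hrs
    exact (hmono.measurable.comp (hF.measurable_time j)).aemeasurable

end

section
variable {l : Fin 4 → ℝ} {V : Fin 4 → ℝ} {δ : Fin 4 → ℝ → ℝ}

/-- A large rate makes the gain l j / a beat any constant. The bound 1/8 is chosen so that the sum
over four edges is 1/2. -/
lemma exists_rate (hl : ∀ j, 0 < l j) {C : ENNReal} (hC : C ≠ ⊤) :
    ∃ a : ℝ, 0 < a ∧ ∀ j, C * ENNReal.ofReal (l j / a) ≤ 1 / 8 := by
  set c := C.toReal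
  have hc : 0 ≤ c := ENNReal.toReal_nonneg
  set L := ∑ j, l j
  have hL : ∀ j, l j ≤ L := fun j =>
    Finset.single_le_sum (f := l) (fun i _ => (hl i).le) (Finset.mem_univ j)
  have hL0 : 0 < L := (hl 0).trans_le (hL 0)
  refine ⟨8 * c * L + 1, by positivity, fun j => ?_⟩
  rw [← ENNReal.ofReal_toReal hC, ← ENNReal.ofReal_mul ENNReal.toReal_nonneg,
    show (1 / 8 : ENNReal) = ENNReal.ofReal (1 / 8) by
      rw [ENNReal.ofReal_div_of_pos (by norm_num)]; simp]
  refine ENNReal.ofReal_le_ofReal ?_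
  change c * (l j / (8 * c * L + 1)) ≤ 1 / 8
  rw [mul_div_assoc', div_le_div_iff₀ (by positivity) (by norm_num)]
  nlinarith [mul_le_mul_of_nonneg_left (hL j) hc]

/-- Gronwall's inequality for sources controlled by their past mass. -/
theorem ae_eq_zero_of_le_pastMass (hF : IsFrame l V δ) (hl : ∀ j, 0 < l j)
    {h : Fin 4 → ℝ × ℝ → ℝ} (hh : ∀ j, Integrable (h j)) {b : ℝ}
    (hs : ∀ j p, h j p ≠ 0 → p.1 ∈ Ioo 0 (l j) ∧ -b ≤ p.2 - δ j p.1) {C : ENNReal} (hC : C ≠ ⊤)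
    {T : ℝ} (hle : ∀ j, ∀ᵐ p : ℝ × ℝ, p.1 ∈ Ioo 0 (l j) → p.2 - δ j p.1 < T →
      ‖h j p‖ₑ ≤ C * pastMass δ h (p.2 - δ j p.1)) (j : Fin 4) :
    ∀ᵐ p : ℝ × ℝ, p.2 - δ j p.1 < T → h j p = 0 := by
  obtain ⟨a, ha, hCa⟩ := exists_rate hl hC
  have hTm : ∀ k, MeasurableSet {p : ℝ × ℝ | p.2 - δ k p.1 < T} := fun k =>
    measurableSet_lt (hF.measurable_time k) measurable_const
  have hSm : ∀ k, MeasurableSet {p : ℝ × ℝ | p.1 ∈ Ioo 0 (l k) ∧ p.2 - δ k p.1 < T} := fun k =>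
    (measurable_fst measurableSet_Ioo).inter (hTm k)
  -- Finiteness is needed to absorb half of the mass below. The weight is bounded on the sources
  -- because they live after the frame time -b.
  have hfin : weightedMass a δ T h ≠ ⊤ := by
    refine ENNReal.sum_ne_top.2 fun k _ => ne_of_lt ?_
    calc ∫⁻ p in {p : ℝ × ℝ | p.2 - δ k p.1 < T}, weight a δ k p * ‖h k p‖ₑ
        ≤ ∫⁻ p, ENNReal.ofReal (Real.exp (a * b)) * ‖h k p‖ₑ := by
          refine (lintegral_mono' Measure.restrict_le_self fun p => ?_)
          by_cases hp : h k p = 0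
          · simp [hp]
          · dsimp only
            gcongr
            refine ENNReal.ofReal_le_ofReal (Real.exp_le_exp.2 ?_)
            nlinarith [(hs k p hp).2]
      _ = ENNReal.ofReal (Real.exp (a * b)) * ∫⁻ p, ‖h k p‖ₑ :=
          lintegral_const_mul' _ _ ENNReal.ofReal_ne_top
      _ < ⊤ := ENNReal.mul_lt_top ENNReal.ofReal_lt_top (hh k).2
  have hk : ∀ k, ∫⁻ p in {p : ℝ × ℝ | p.2 - δ k p.1 < T}, weight a δ k p * ‖h k p‖ₑ
      ≤ 1 / 8 * weightedMass a δ T h := by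
    intro k
    calc ∫⁻ p in {p : ℝ × ℝ | p.2 - δ k p.1 < T}, weight a δ k p * ‖h k p‖ₑ
        ≤ ∫⁻ p in {p : ℝ × ℝ | p.1 ∈ Ioo 0 (l k) ∧ p.2 - δ k p.1 < T},
            C * (weight a δ k p * pastMass δ h (p.2 - δ k p.1)) := by
          rw [← lintegral_indicator (hTm k), ← lintegral_indicator (hSm k)]
          refine lintegral_mono_ae ?_
          filter_upwards [hle k] with p hp
          by_cases h0 : h k p = 0
          · simp [indicator, h0]
          have h1 := (hs k p h0).1
          by_cases hT : p.2 - δ k p.1 < T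
          · rw [indicator_of_mem (by exact hT), indicator_of_mem (by exact ⟨h1, hT⟩)]
            calc weight a δ k p * ‖h k p‖ₑ ≤ weight a δ k p * (C * pastMass δ h (p.2 - δ k p.1)) := by
                  gcongr; exact hp h1 hT
              _ = _ := by ring
          · rw [indicator_of_notMem (by exact hT)]; exact zero_le
      _ = C * ∫⁻ p in {p : ℝ × ℝ | p.1 ∈ Ioo 0 (l k) ∧ p.2 - δ k p.1 < T},
            weight a δ k p * pastMass δ h (p.2 - δ k p.1) := lintegral_const_mul' _ _ hC
      _ ≤ C * (ENNReal.ofReal (l k / a) * weightedMass a δ T h) := by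
          gcongr
          exact lintegral_weight_mul_pastMass_le hF ha k T fun i => (hh i).aestronglyMeasurable
      _ ≤ 1 / 8 * weightedMass a δ T h := by
          rw [← mul_assoc]; gcongr; exact hCa k
  have hsum : weightedMass a δ T h ≤ 1 / 2 * weightedMass a δ T h := by
    conv_lhs => unfold weightedMass
    refine (Finset.sum_le_sum fun k _ => hk k).trans_eq ?_
    rw [Finset.sum_const, Finset.card_univ, Fintype.card_fin, nsmul_eq_mul, ← mul_assoc]
    congr 1
    rw [← ENNReal.toReal_eq_toReal_iff' (by finiteness) (by finiteness)]
    norm_num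
  have hzero : weightedMass a δ T h = 0 := by
    by_contra hne
    have : 1 / 2 * weightedMass a δ T h < weightedMass a δ T h := by
      rw [one_div, mul_comm, ← div_eq_mul_inv]
      exact ENNReal.half_lt_self hne hfin
    exact absurd hsum (not_le.2 this)
  have hj : ∫⁻ p in {p : ℝ × ℝ | p.2 - δ j p.1 < T}, weight a δ j p * ‖h j p‖ₑ = 0 :=
    Finset.sum_eq_zero_iff.1 hzero j (Finset.mem_univ j)
  have hj' := (lintegral_eq_zero_iff' (f := fun p => weight a δ j p * ‖h j p‖ₑ)
    ((hF.measurable_weight a j).aemeasurable.mul (hh j).aestronglyMeasurable.enorm).restrict).1 hj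
  filter_upwards [(ae_restrict_iff' (hTm j)).1 hj'] with p hp hT
  have := hp hT
  simpa [weight_ne_zero] using this

/-- The part of the edge `j` between the times `0` and `T` of the frame. -/
def slab (l : Fin 4 → ℝ) (δ : Fin 4 → ℝ → ℝ) (T : ℝ) (j : Fin 4) : Set (ℝ × ℝ) :=
  {p | p.1 ∈ Ioo 0 (l j) ∧ 0 < p.2 - δ j p.1 ∧ p.2 - δ j p.1 < T}

lemma IsFrame.measurableSet_slab (hF : IsFrame l V δ) (T : ℝ) (j : Fin 4) :
    MeasurableSet (slab l δ T j) :=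
  (measurable_fst measurableSet_Ioo).inter
    ((measurableSet_lt measurable_const (hF.measurable_time j)).inter
      (measurableSet_lt (hF.measurable_time j) measurable_const))

lemma enorm_exp (y : ℝ) : ‖Real.exp y‖ₑ = ENNReal.ofReal (Real.exp y) := by
  rw [Real.enorm_eq_ofReal (Real.exp_pos y).le]

/-- Existence of fixed points for operators on sources which are Lipschitz with respect to the
past mass. -/
theorem exists_fixedPoint_source (hF : IsFrame l V δ) (hl : ∀ j, 0 < l j)
    {Ψ : (Fin 4 → ℝ × ℝ → ℝ) → Fin 4 → ℝ × ℝ → ℝ} {C : ENNReal} (hC : C ≠ ⊤) (T : ℝ)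
    (hmeas : ∀ h : Fin 4 → ℝ × ℝ → ℝ, (∀ j, Integrable (h j)) → ∀ j, AEStronglyMeasurable (Ψ h j))
    (hint : ∀ j, IntegrableOn (Ψ (fun _ _ => 0) j) (slab l δ T j))
    (hlip : ∀ h h' : Fin 4 → ℝ × ℝ → ℝ, (∀ j, Integrable (h j)) → (∀ j, Integrable (h' j)) →
      ∀ j, ∀ p ∈ slab l δ T j, ‖Ψ h j p - Ψ h' j p‖ₑ
        ≤ C * pastMass δ (fun j p => h j p - h' j p) (p.2 - δ j p.1)) :
    ∃ h : Fin 4 → ℝ × ℝ → ℝ, (∀ j, Integrable (h j)) ∧ (∀ j, ∀ p ∉ slab l δ T j, h j p = 0) ∧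
      ∀ j, ∀ᵐ p : ℝ × ℝ, p ∈ slab l δ T j → h j p = Ψ h j p := by
  obtain ⟨a, ha, hCa⟩ := exists_rate hl hC
  have hZm := hF.measurableSet_slab T
  have hSm : ∀ k, MeasurableSet {p : ℝ × ℝ | p.1 ∈ Ioo 0 (l k) ∧ p.2 - δ k p.1 < T} := fun k =>
    (measurable_fst measurableSet_Ioo).inter (measurableSet_lt (hF.measurable_time k) measurable_const)
  have hexp : ∀ (b : ℝ) k, Measurable fun p : ℝ × ℝ => Real.exp (b * (p.2 - δ k p.1)) := fun b k =>
    Real.measurable_exp.comp ((hF.measurable_time k).const_mul _)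
  -- unweighted sources
  let E : (Fin 4 → ℝ × ℝ → ℝ) → Fin 4 → ℝ × ℝ → ℝ := fun v k =>
    (slab l δ T k).indicator fun p => Real.exp (a * (p.2 - δ k p.1)) * v k p
  have hE : ∀ v : Fin 4 → ℝ × ℝ → ℝ, (∀ k, Integrable (v k)) → ∀ k, Integrable (E v k) := by
    intro v hv k
    refine (integrable_indicator_iff (hZm k)).2 ?_
    refine (hv k).integrableOn.bdd_mul (c := Real.exp (a * T)) (hexp a k).aestronglyMeasurable ?_
    filter_upwards [ae_restrict_mem (hZm k)] with p hp
    rw [Real.norm_eq_abs, Real.abs_exp]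
    exact Real.exp_le_exp.2 (mul_le_mul_of_nonneg_left hp.2.2.le ha.le)
  -- the operator on weighted sources
  let Θ : (Fin 4 → ℝ × ℝ → ℝ) → Fin 4 → ℝ × ℝ → ℝ := fun v k =>
    (slab l δ T k).indicator fun p => Real.exp (-a * (p.2 - δ k p.1)) * Ψ (E v) k p
  -- The exponential in `E` cancels the weight. Hence plain L¹ distances of v control weighted
  -- masses of `E v`, and the contraction can be set up in a product of plain L¹ spaces.
  have hmass : ∀ v v' : Fin 4 → ℝ × ℝ → ℝ,
      weightedMass a δ T (fun k p => E v k p - E v' k p) ≤ ∑ k, ∫⁻ p, ‖v k p - v' k p‖ₑ := by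
    intro v v'
    refine Finset.sum_le_sum fun k _ => ?_
    refine lintegral_mono' Measure.restrict_le_self fun p => ?_
    simp only [E, indicator]
    split_ifs with hp
    · rw [← mul_sub, enorm_mul, enorm_exp, ← mul_assoc, weight,
        ← ENNReal.ofReal_mul (Real.exp_pos _).le, ← Real.exp_add]
      simp
    · simp
  have hdiff : ∀ v v' : Fin 4 → ℝ × ℝ → ℝ, (∀ k, Integrable (v k)) → (∀ k, Integrable (v' k)) →
      ∀ k, ∫⁻ p, ‖Θ v k p - Θ v' k p‖ₑ ≤ 1 / 8 * ∑ i, ∫⁻ p, ‖v i p - v' i p‖ₑ := by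
    intro v v' hv hv' k
    calc ∫⁻ p, ‖Θ v k p - Θ v' k p‖ₑ
        ≤ ∫⁻ p in {p : ℝ × ℝ | p.1 ∈ Ioo 0 (l k) ∧ p.2 - δ k p.1 < T},
            C * (weight a δ k p * pastMass δ (fun k p => E v k p - E v' k p) (p.2 - δ k p.1)) := by
          rw [← lintegral_indicator (hSm k)]
          refine lintegral_mono fun p => ?_
          by_cases hp : p ∈ slab l δ T k
          · rw [indicator_of_mem (by exact ⟨hp.1, hp.2.2⟩)]
            simp only [Θ, indicator_of_mem hp]
            rw [← mul_sub, enorm_mul, enorm_exp]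
            refine (mul_le_mul_right (hlip _ _ (hE v hv) (hE v' hv') k p hp) _).trans_eq ?_
            unfold weight; ring
          · simp [Θ, indicator_of_notMem hp]
      _ = C * ∫⁻ p in {p : ℝ × ℝ | p.1 ∈ Ioo 0 (l k) ∧ p.2 - δ k p.1 < T},
            weight a δ k p * pastMass δ (fun k p => E v k p - E v' k p) (p.2 - δ k p.1) :=
          lintegral_const_mul' _ _ hC
      _ ≤ C * (ENNReal.ofReal (l k / a) * weightedMass a δ T (fun k p => E v k p - E v' k p)) := by
          gcongr
          exact lintegral_weight_mul_pastMass_le hF ha k T fun i =>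
            ((hE v hv i).sub (hE v' hv' i)).aestronglyMeasurable
      _ ≤ 1 / 8 * ∑ i, ∫⁻ p, ‖v i p - v' i p‖ₑ := by
          rw [← mul_assoc]; gcongr
          · exact hCa k
          · exact hmass v v'
  have hΘm : ∀ v : Fin 4 → ℝ × ℝ → ℝ, (∀ k, Integrable (v k)) → ∀ k,
      AEStronglyMeasurable (Θ v k) := fun v hv k =>
    ((hexp (-a) k).aestronglyMeasurable.mul (hmeas _ (hE v hv) k)).indicator (hZm k)
  have hE0 : E (fun _ _ => 0) = fun _ _ => 0 := by ext k p; simp [E]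
  have hΘ0 : ∀ k, Integrable (Θ (fun _ _ => 0) k) := by
    intro k
    refine (integrable_indicator_iff (hZm k)).2 ?_
    rw [hE0]
    refine (hint k).bdd_mul (c := 1) (hexp (-a) k).aestronglyMeasurable ?_
    filter_upwards [ae_restrict_mem (hZm k)] with p hp
    rw [Real.norm_eq_abs, Real.abs_exp, Real.exp_le_one_iff]
    nlinarith [hp.2.1]
  have hΘi : ∀ v : Fin 4 → ℝ × ℝ → ℝ, (∀ k, Integrable (v k)) → ∀ k, Integrable (Θ v k) := by
    intro v hv k
    have h1 : Integrable (fun p => Θ v k p - Θ (fun _ _ => 0) k p) := by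
      refine ⟨(hΘm v hv k).sub (hΘ0 k).aestronglyMeasurable, ?_⟩
      refine (hdiff v (fun _ _ => 0) hv (fun _ => integrable_zero _ _ _) k).trans_lt ?_
      refine ENNReal.mul_lt_top (by finiteness) (ENNReal.sum_lt_top.2 fun i _ => ?_)
      simp only [sub_zero]
      exact (hv i).2
    refine (h1.add (hΘ0 k)).congr (ae_of_all _ fun p => ?_)
    simp
  let Φ : (Fin 4 → Lp ℝ 1 (volume : Measure (ℝ × ℝ))) → Fin 4 → Lp ℝ 1 (volume : Measure (ℝ × ℝ)) :=
    fun v k => (hΘi (fun i => v i) (fun i => L1.integrable_coeFn (v i)) k).toL1 _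
  -- The product carries the maximum distance, so four contributions of 1/8 give the constant 1/2.
  have hΦ : ContractingWith (1 / 2) Φ := by
    refine ⟨by norm_num, fun v v' => ?_⟩
    refine edist_pi_le_iff.2 fun k => ?_
    rw [Integrable.edist_toL1_toL1]
    refine (le_of_eq (by simp only [edist_eq_enorm_sub])).trans
      ((hdiff (fun i => v i) (fun i => v' i) (fun i => L1.integrable_coeFn (v i))
        (fun i => L1.integrable_coeFn (v' i)) k).trans ?_)
    have h1 : ∀ i, ∫⁻ p, ‖v i p - v' i p‖ₑ ≤ edist v v' := by
      intro i
      refine le_trans (le_of_eq ?_) (edist_le_pi_edist v v' i)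
      conv_rhs => rw [← Integrable.toL1_coeFn (v i) (L1.integrable_coeFn (v i)),
        ← Integrable.toL1_coeFn (v' i) (L1.integrable_coeFn (v' i)), Integrable.edist_toL1_toL1]
      simp only [edist_eq_enorm_sub]
    calc 1 / 8 * ∑ i, ∫⁻ p, ‖v i p - v' i p‖ₑ ≤ 1 / 8 * ∑ _i : Fin 4, edist v v' := by
          gcongr with i; exact h1 i
      _ = _ := by
          rw [Finset.sum_const, Finset.card_univ, Fintype.card_fin, nsmul_eq_mul, ← mul_assoc]
          congr 1
          rw [← ENNReal.toReal_eq_toReal_iff' (by finiteness) (by finiteness)]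
          norm_num
  set v := ContractingWith.fixedPoint Φ hΦ with hv
  have hfix : Φ v = v := hΦ.fixedPoint_isFixedPt
  have hvi : ∀ k, Integrable (v k) := fun k => L1.integrable_coeFn (v k)
  refine ⟨E fun k => v k, hE _ hvi, fun j p hp => indicator_of_notMem hp _, fun j => ?_⟩
  have h1 : (v j : ℝ × ℝ → ℝ) =ᵐ[volume] Θ (fun i => v i) j := by
    conv_lhs => rw [← hfix]
    exact Integrable.coeFn_toL1 _
  filter_upwards [h1] with p hp hpZ
  change (slab l δ T j).indicator _ p = _
  rw [indicator_of_mem hpZ]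
  change Real.exp _ * v j p = _
  rw [hp]
  simp only [Θ, indicator_of_mem hpZ]
  rw [← mul_assoc, ← Real.exp_add]
  simp

end

/-! ### The Duhamel integral of a smooth source -/

lemma locallyIntegrable_lightCone : LocallyIntegrable lightCone :=
  (locallyIntegrable_const (1 / 2 : ℝ)).mono measurable_lightCone.aestronglyMeasurable
    (ae_of_all _ fun p => by simpa using abs_lightCone_le p)

section
variable {g : ℝ × ℝ → ℝ}

/-- As a convolution with a locally integrable kernel, the Duhamel integral inherits the smoothness
of a compactly supported source, and derivatives fall on the source. -/
lemma duhamel_eq_convolution (g : ℝ × ℝ → ℝ) :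
    (fun p : ℝ × ℝ => duhamel g p.1 p.2)
      = convolution lightCone g (ContinuousLinearMap.mul ℝ ℝ) volume := by
  ext p
  rw [convolution_mul_swap]
  unfold duhamel
  congr 1; ext q; ring

lemma contDiff_duhamel {n : ℕ∞} (hg : ContDiff ℝ n g) (hc : HasCompactSupport g) :
    ContDiff ℝ n fun p : ℝ × ℝ => duhamel g p.1 p.2 := by
  rw [duhamel_eq_convolution]
  exact hc.contDiff_convolution_right _ locallyIntegrable_lightCone hg

lemma fderiv_duhamel (hg : ContDiff ℝ 1 g) (hc : HasCompactSupport g) (p v : ℝ × ℝ) :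
    fderiv ℝ (fun p : ℝ × ℝ => duhamel g p.1 p.2) p v
      = duhamel (fun q => fderiv ℝ g q v) p.1 p.2 := by
  have h := hc.hasFDerivAt_convolution_right (ContinuousLinearMap.mul ℝ ℝ)
    (μ := volume) locallyIntegrable_lightCone hg p
  rw [duhamel_eq_convolution, h.fderiv, convolution_precompR_apply _ locallyIntegrable_lightCone
    (hc.fderiv ℝ) (hg.continuous_fderiv one_ne_zero)]
  exact (congrFun (duhamel_eq_convolution fun q => fderiv ℝ g q v) p).symm

lemma hasCompactSupport_dt (hc : HasCompactSupport g) : HasCompactSupport (dt g) :=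
  hc.fderiv_apply ℝ _

lemma hasCompactSupport_dx (hc : HasCompactSupport g) : HasCompactSupport (dx g) :=
  hc.fderiv_apply ℝ _

/-- The wave operator commutes with the convolution; with `duhamel_box` this makes the Duhamel
integral a classical solution. -/
lemma box_duhamel (hg : ContDiff ℝ 2 g) (hc : HasCompactSupport g) (p : ℝ × ℝ) :
    box (fun p : ℝ × ℝ => duhamel g p.1 p.2) p = duhamel (box g) p.1 p.2 := by
  have hg1 : ContDiff ℝ 1 g := hg.of_le (by norm_num)
  have e1 : dt (fun p : ℝ × ℝ => duhamel g p.1 p.2) = fun p => duhamel (dt g) p.1 p.2 :=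
    funext fun p => fderiv_duhamel hg1 hc p _
  have e2 : dx (fun p : ℝ × ℝ => duhamel g p.1 p.2) = fun p => duhamel (dx g) p.1 p.2 :=
    funext fun p => fderiv_duhamel hg1 hc p _
  have c1 := contDiff_dt (n := 1) hg
  have c2 := contDiff_dx (n := 1) hg
  have s1 := hasCompactSupport_dt hc
  have s2 := hasCompactSupport_dx hc
  have i1 : Integrable (dt (dt g)) :=
    (contDiff_dt (n := 0) c1).continuous.integrable_of_hasCompactSupport (hasCompactSupport_dt s1)
  have i2 : Integrable (dx (dx g)) :=
    (contDiff_dx (n := 0) c2).continuous.integrable_of_hasCompactSupport (hasCompactSupport_dx s2)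
  have e3 : box g = fun p => dt (dt g) p - dx (dx g) p := funext fun p => box_eq hg p
  rw [box_eq (contDiff_duhamel (n := 2) hg hc), e1, e2, e3, duhamel_sub i1 i2]
  congr 1
  · exact fderiv_duhamel c1 s1 p _
  · exact fderiv_duhamel c2 s2 p _

lemma box_comp_affine (a b : ℝ) (φ : ℝ × ℝ → ℝ) (p : ℝ × ℝ) :
    box (fun p => φ (p.1 - a, b - p.2)) p = box φ (p.1 - a, b - p.2) := by
  have e1 := iteratedDeriv_comp_const_sub 2 (fun s => φ (p.1 - a, s)) b
  have e2 := iteratedDeriv_comp_sub_const 2 (fun y => φ (y, b - p.2)) a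
  have e1' := congrFun e1 p.2
  have e2' := congrFun e2 p.1
  unfold box
  simp only at e1' e2' ⊢
  rw [e1', e2']
  simp

/-- The Duhamel integral inverts the wave operator. -/
lemma duhamel_box (hg : ContDiff ℝ 2 g) (hc : HasCompactSupport g) (x₀ t₀ : ℝ) :
    duhamel (box g) x₀ t₀ = g (x₀, t₀) := by
  obtain ⟨R, hR⟩ := (hc.isCompact.union (isCompact_singleton (x := (x₀, t₀)))).isBounded.subset_ball
    ((0 : ℝ), (0 : ℝ))
  have hball : ∀ p ∈ tsupport g ∪ {(x₀, t₀)}, |p.1| < R ∧ |p.2| < R := fun p hp => by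
    have := hR hp
    rw [Metric.mem_ball, Prod.dist_eq, max_lt_iff] at this
    simpa [Real.dist_eq] using this
  obtain ⟨hx0, ht0⟩ := hball (x₀, t₀) (by simp)
  simp only [abs_lt] at hx0 ht0
  have hout : ∀ x t, R ≤ |x| ∨ R ≤ |t| → (x, t) ∉ tsupport g := fun x t h hp => by
    have := hball (x, t) (Or.inl hp)
    rcases h with h | h <;> [linarith [this.1]; linarith [this.2]]
  have hbox0 : ∀ p ∉ tsupport g, box g p = 0 := fun p hp => by
    have h1 : tsupport (dt g) ⊆ tsupport g := tsupport_fderiv_apply_subset ℝ _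
    have h2 : tsupport (dx g) ⊆ tsupport g := tsupport_fderiv_apply_subset ℝ _
    have f1 := fderiv_of_notMem_tsupport (𝕜 := ℝ) fun h => hp (h1 h)
    have f2 := fderiv_of_notMem_tsupport (𝕜 := ℝ) fun h => hp (h2 h)
    rw [box_eq hg]
    change fderiv ℝ (dt g) p (0, 1) - fderiv ℝ (dx g) p (1, 0) = 0
    rw [f1, f2]
    simp
  -- Time reversal turns the backward cone of the Duhamel integral into a forward one, and the shift
  -- places the support inside the square (0, 2R)². All boundary terms in
  -- `integral_lightCone_mul_box` then vanish and only the point value survives.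
  set φ : ℝ × ℝ → ℝ := fun p => g (p.1 - R, R - p.2) with hφ
  have hφc : ContDiff ℝ 2 φ := hg.comp (by fun_prop)
  have hφ0 : ∀ x t, R ≤ |x - R| ∨ R ≤ |R - t| →
      φ (x, t) = 0 ∧ dt φ (x, t) = 0 ∧ dx φ (x, t) = 0 := by
    intro x t h
    have hn : (x, t) ∉ tsupport φ := fun hp =>
      hout _ _ h (tsupport_comp_subset_preimage g
        (by fun_prop : Continuous fun p : ℝ × ℝ => (p.1 - R, R - p.2)) hp)
    have hf := fderiv_of_notMem_tsupport (𝕜 := ℝ) hn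
    exact ⟨image_eq_zero_of_notMem_tsupport hn, by simp [dt, hf], by simp [dx, hf]⟩
  have key := integral_lightCone_mul_box hφc (l := 2 * R) (τ := 2 * R)
    (p := (x₀ + R, R - t₀))
    (fun x _ => (hφ0 x (2 * R) (Or.inr (by rw [show R - 2 * R = -R by ring, abs_neg]; exact le_abs_self R))).1)
    (fun x _ => (hφ0 x (2 * R) (Or.inr (by rw [show R - 2 * R = -R by ring, abs_neg]; exact le_abs_self R))).2.1)
    (fun x _ => (hφ0 x (2 * R) (Or.inr (by rw [show R - 2 * R = -R by ring, abs_neg]; exact le_abs_self R))).2.2)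
    ⟨by linarith, by linarith⟩ ⟨by linarith, by linarith⟩
  have b1 : ∀ t, dt φ (2 * R, t) - dx φ (2 * R, t) = 0 := fun t => by
    obtain ⟨-, h1, h2⟩ := hφ0 (2 * R) t (Or.inl (by rw [show 2 * R - R = R by ring]; exact le_abs_self R))
    rw [h1, h2, sub_zero]
  have b2 : ∀ t, dt φ (0, t) + dx φ (0, t) = 0 := fun t => by
    obtain ⟨-, h1, h2⟩ := hφ0 0 t (Or.inl (by rw [zero_sub, abs_neg]; exact le_abs_self R))
    rw [h1, h2, add_zero]
  simp only [b1, b2, mul_zero, integral_zero, zero_add] at key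
  have hval : φ (x₀ + R, R - t₀) = g (x₀, t₀) := by simp [hφ]
  rw [hval] at key
  rw [← key, ← integral_indicator (measurableSet_Ioo.prod measurableSet_Ioo)]
  unfold duhamel
  have e : MeasurePreserving (fun p : ℝ × ℝ => (p.1 - R, R - p.2)) volume volume :=
    (measurePreserving_sub_right (volume : Measure ℝ) R).prod
      (Measure.measurePreserving_sub_left (volume : Measure ℝ) R)
  have hemb : MeasurableEmbedding (fun p : ℝ × ℝ => (p.1 - R, R - p.2)) :=
    ((MeasurableEquiv.subRight R).prodCongr (MeasurableEquiv.subLeft R)).measurableEmbedding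
  rw [← e.integral_comp hemb]
  congr 1; ext z
  have hcone : lightCone ((x₀, t₀) - (z.1 - R, R - z.2)) = lightCone (z - (x₀ + R, R - t₀)) := by
    simp only [lightCone, Prod.fst_sub, Prod.snd_sub]
    refine if_congr ?_ rfl rfl
    rw [show x₀ - (z.1 - R) = -(z.1 - (x₀ + R)) by ring, abs_neg,
      show t₀ - (R - z.2) = z.2 - (R - t₀) by ring]
  by_cases hz : z ∈ Ioo 0 (2 * R) ×ˢ Ioo 0 (2 * R)
  · rw [indicator_of_mem hz, hcone, box_comp_affine, mul_comm]
  · rw [indicator_of_notMem hz, hbox0, zero_mul]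
    refine hout _ _ ?_
    by_contra hcon
    push Not at hcon
    simp only [abs_lt] at hcon
    apply hz
    refine ⟨⟨?_, ?_⟩, ⟨?_, ?_⟩⟩ <;> linarith [hcon.1.1, hcon.1.2, hcon.2.1, hcon.2.2]

end

/-! ### The scattering coefficients of the graph -/

/-- The coefficients for the Kirchhoff condition at `v₂` and `v₃`. -/
noncomputable def kirchhoffCoeff : Fin 4 → ℝ := ![0, 2 / 3, 2 / 3, 0]

lemma kirchhoffCoeff_mem (v : Fin 4) : kirchhoffCoeff v ∈ Icc (0 : ℝ) 1 := by
  fin_cases v <;> simp [kirchhoffCoeff] <;> norm_num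

/-- At v₂ and v₃ the relation says that departing plus arriving wave on each edge is 2/3 of the sum
of all arriving waves. This is independent of the edge, which is continuity; adding the three edges
gives the Kirchhoff sum. A zero coefficient leaves departing plus arriving wave equal to the data.
-/
lemma vertexConditions_of_scatter {l : Fin 4 → ℝ} {f : ℝ → ℝ} {P : Fin 4 × Bool → ℝ → ℝ}
    {h : Fin 4 → ℝ × ℝ → ℝ} {t : ℝ}
    (hP : ∀ d, P d t = (if d = (0, true) then f t else 0)
      + ∑ d', scatter kirchhoffCoeff d d' * incoming l P h d' t) :
    VertexConditions l f P h t := by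
  have e := hP
  simp only [Fintype.sum_prod_type, Fin.sum_univ_four, Fintype.sum_bool, scatter, tail, rev,
    kirchhoffCoeff] at e
  have e0f := e (0, false)
  have e0t := e (0, true)
  have e1f := e (1, false)
  have e1t := e (1, true)
  have e2f := e (2, false)
  have e2t := e (2, true)
  have e3f := e (3, false)
  have e3t := e (3, true)
  clear e hP
  simp at e0f e0t e1f e1t e2f e2t e3f e3t
  constructor <;> linarith

/-! ### Smooth waves -/

lemma box_add {f g : ℝ × ℝ → ℝ} (hf : ContDiff ℝ 2 f) (hg : ContDiff ℝ 2 g) (p : ℝ × ℝ) :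
    box (fun p => f p + g p) p = box f p + box g p := by
  have a1 : ContDiff ℝ 2 fun s => f (p.1, s) := hf.comp (by fun_prop)
  have a2 : ContDiff ℝ 2 fun s => g (p.1, s) := hg.comp (by fun_prop)
  have b1 : ContDiff ℝ 2 fun y => f (y, p.2) := hf.comp (by fun_prop)
  have b2 : ContDiff ℝ 2 fun y => g (y, p.2) := hg.comp (by fun_prop)
  unfold box
  rw [iteratedDeriv_fun_add a1.contDiffAt a2.contDiffAt,
    iteratedDeriv_fun_add b1.contDiffAt b2.contDiffAt]
  ring

lemma box_rightward (P : ℝ → ℝ) (p : ℝ × ℝ) : box (fun p => P (p.2 - p.1)) p = 0 := by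
  have e1 := congrFun (iteratedDeriv_comp_sub_const 2 P p.1) p.2
  have e2 := congrFun (iteratedDeriv_comp_const_sub 2 P p.2) p.1
  unfold box
  simp only [e1, e2]
  simp

lemma box_leftward (P : ℝ → ℝ) (a : ℝ) (p : ℝ × ℝ) : box (fun p => P (p.2 - (a - p.1))) p = 0 := by
  have e1 := congrFun (iteratedDeriv_comp_sub_const 2 P (a - p.1)) p.2
  have e2 := congrFun (iteratedDeriv_comp_add_const 2 P (p.2 - a)) p.1
  have e3 : (fun y => P (p.2 - (a - y))) = fun y => P (y + (p.2 - a)) := by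
    ext y; congr 1; ring
  unfold box
  simp only [e3, e1, e2]
  rw [sub_eq_zero]; congr 1; ring

section
variable {l : Fin 4 → ℝ} {P : Fin 4 × Bool → ℝ → ℝ} {h : Fin 4 → ℝ × ℝ → ℝ}

lemma contDiff_wave (hP : ∀ d, ContDiff ℝ 2 (P d)) (hs : ∀ j, ContDiff ℝ 2 (h j))
    (hc : ∀ j, HasCompactSupport (h j)) (j : Fin 4) :
    ContDiff ℝ 2 fun p : ℝ × ℝ => wave l P h j p.1 p.2 :=
  (((hP _).comp (by fun_prop)).add ((hP _).comp (by fun_prop))).add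
    (contDiff_duhamel (n := 2) (hs j) (hc j))

lemma contDiff_incoming (hP : ∀ d, ContDiff ℝ 2 (P d)) (hs : ∀ j, ContDiff ℝ 2 (h j))
    (hc : ∀ j, HasCompactSupport (h j)) (d : Fin 4 × Bool) : ContDiff ℝ 2 (incoming l P h d) :=
  ((hP _).comp (by fun_prop)).add
    ((contDiff_duhamel (n := 2) (hs d.1) (hc d.1)).comp
      (by fun_prop : ContDiff ℝ 2 fun t : ℝ => (endpoint l d, t)))

lemma contDiff_profile {c : Fin 4 → ℝ} (hs : ∀ j, ContDiff ℝ 2 (h j))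
    (hc : ∀ j, HasCompactSupport (h j)) (N : ℕ) (d : Fin 4 × Bool) :
    ContDiff ℝ 2 (profile c l N (fun _ _ => 0) h d) := by
  refine solve_induction (Q := fun f => ContDiff ℝ 2 f) contDiff_const (fun f g => ContDiff.add)
    (fun a f hf => contDiff_const.mul hf) (fun a f hf => hf.comp (by fun_prop)) (fun d => ?_) N d
  refine contDiff_const.add (ContDiff.sum fun d' _ => contDiff_const.mul ?_)
  exact (contDiff_duhamel (n := 2) (hs d'.1) (hc d'.1)).comp
      (by fun_prop : ContDiff ℝ 2 fun t : ℝ => (endpoint l d', t))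

lemma box_wave (hP : ∀ d, ContDiff ℝ 2 (P d)) (hs : ∀ j, ContDiff ℝ 2 (h j))
    (hc : ∀ j, HasCompactSupport (h j)) (j : Fin 4) (p : ℝ × ℝ) :
    box (fun p => wave l P h j p.1 p.2) p = h j p := by
  have a1 : ContDiff ℝ 2 fun p : ℝ × ℝ => P (j, false) (p.2 - p.1) := (hP _).comp (by fun_prop)
  have a2 : ContDiff ℝ 2 fun p : ℝ × ℝ => P (j, true) (p.2 - (l j - p.1)) :=
    (hP _).comp (by fun_prop)
  simp only [wave]
  rw [box_add (a1.add a2) (contDiff_duhamel (n := 2) (hs j) (hc j)), box_add a1 a2,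
    box_rightward, box_leftward, box_duhamel (hs j) (hc j), duhamel_box (hs j) (hc j)]
  simp

/-- For x ≤ 0 all sources lie to the right, so the whole wave equals P(t - x) plus the arriving wave
at time t + x. Since the wave is differentiable at 0, this one-sided formula determines the
derivative. -/
lemma deriv_wave_zero (hP : ∀ d, ContDiff ℝ 2 (P d)) (hs : ∀ j, ContDiff ℝ 2 (h j))
    (hc : ∀ j, HasCompactSupport (h j)) (hh : IsSource l h) (j : Fin 4) (t : ℝ) :
    deriv (fun x => wave l P h j x t) 0
      = -deriv (P (j, false)) t + deriv (incoming l P h (j, true)) t := by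
  have hd := hasDerivAt_space ((contDiff_wave (l := l) hP hs hc j).differentiable (by norm_num)) 0 t
  rw [hd.deriv]
  have hPd : HasDerivAt (P (j, false)) (deriv (P (j, false)) t) (t - 0) := by
    rw [sub_zero]; exact ((hP _).differentiable (by norm_num) t).hasDerivAt
  have hId : HasDerivAt (incoming l P h (j, true)) (deriv (incoming l P h (j, true)) t) (t + 0) := by
    rw [add_zero]; exact ((contDiff_incoming hP hs hc _).differentiable (by norm_num) t).hasDerivAt
  have h2 : HasDerivAt (fun x => P (j, false) (t - x) + incoming l P h (j, true) (t + x))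
      (-deriv (P (j, false)) t + deriv (incoming l P h (j, true)) t) 0 := by
    have := (hPd.comp (0 : ℝ) ((hasDerivAt_id (0 : ℝ)).const_sub t)).add
      (hId.comp (0 : ℝ) ((hasDerivAt_id (0 : ℝ)).const_add t))
    exact this.congr_deriv (by ring)
  refine eq_of_hasDerivAt_of_eqOn hd h2 (s := Iic 0) (fun x hx => ?_) (mem_Iic.2 le_rfl)
    (uniqueDiffOn_Iic 0 _ (mem_Iic.2 le_rfl))
  simp only [wave, incoming, endpoint, if_true]
  rw [duhamel_of_le (fun p hp => (hh.support j p hp).1.1.le) hx,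
    show t - (l j - x) = t + x - l j by ring, show t - (0 - x) = t + x by ring]
  ring

lemma deriv_wave_end (hP : ∀ d, ContDiff ℝ 2 (P d)) (hs : ∀ j, ContDiff ℝ 2 (h j))
    (hc : ∀ j, HasCompactSupport (h j)) (hh : IsSource l h) (j : Fin 4) (t : ℝ) :
    deriv (fun x => wave l P h j x t) (l j)
      = deriv (P (j, true)) t - deriv (incoming l P h (j, false)) t := by
  have hd := hasDerivAt_space
    ((contDiff_wave (l := l) hP hs hc j).differentiable (by norm_num)) (l j) t
  rw [hd.deriv]
  have hPd : HasDerivAt (P (j, true)) (deriv (P (j, true)) t) (t - l j + l j) := by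
    rw [sub_add_cancel]; exact ((hP _).differentiable (by norm_num) t).hasDerivAt
  have hId : HasDerivAt (incoming l P h (j, false)) (deriv (incoming l P h (j, false)) t)
      (t + l j - l j) := by
    rw [add_sub_cancel_right]
    exact ((contDiff_incoming hP hs hc _).differentiable (by norm_num) t).hasDerivAt
  have h2 : HasDerivAt
      (fun x => P (j, true) (t - l j + x) + incoming l P h (j, false) (t + l j - x))
      (deriv (P (j, true)) t - deriv (incoming l P h (j, false)) t) (l j) := by
    have := (hPd.comp (l j) ((hasDerivAt_id (l j)).const_add (t - l j))).add
      (hId.comp (l j) ((hasDerivAt_id (l j)).const_sub (t + l j)))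
    exact this.congr_deriv (by ring)
  refine eq_of_hasDerivAt_of_eqOn hd h2 (s := Ici (l j)) (fun x hx => ?_) (mem_Ici.2 le_rfl)
    (uniqueDiffOn_Ici (l j) _ (mem_Ici.2 le_rfl))
  simp only [wave, incoming, endpoint, Bool.false_eq_true, if_false]
  rw [duhamel_of_ge (fun p hp => (hh.support j p hp).1.2.le) hx,
    show t - (l j - x) = t - l j + x by ring, show t + l j - x - l j = t - x by ring,
    show t - (x - l j) = t + l j - x by ring]
  ring

lemma wave_eq_zero (hP0 : ∀ d, ∀ t ≤ 0, P d t = 0) (hh : IsSource l h) (j : Fin 4) {x t : ℝ}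
    (hx : x ∈ Icc 0 (l j)) (ht : t ≤ 0) : wave l P h j x t = 0 := by
  simp only [wave]
  rw [hP0 _ _ (by linarith [hx.1]), hP0 _ _ (by linarith [hx.2]),
    duhamel_eq_zero_of_nonpos hh j x ht]
  simp

/-- A smooth wave on the graph with homogeneous boundary conditions, run backwards in time, is a
test function. -/
lemma isTestFunction_wave (hP : ∀ d, ContDiff ℝ 2 (P d))
    (hP0 : ∀ d, ∀ t ≤ 0, P d t = 0) (hs : ∀ j, ContDiff ℝ 2 (h j))
    (hc : ∀ j, HasCompactSupport (h j)) (hh : IsSource l h) {τ τ' : ℝ} (hτ : τ < τ')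
    (hv : ∀ t < τ', VertexConditions l (fun _ => 0) P h t) :
    IsTestFunction l τ fun j x t => wave l P h j x (τ - t) := by
  have hw0 : ∀ j t, wave l P h j 0 t = P (j, false) t + incoming l P h (j, true) t := fun j t => by
    simp [wave, incoming, endpoint, add_assoc]
  have hwl : ∀ j t, wave l P h j (l j) t = P (j, true) t + incoming l P h (j, false) t :=
    fun j t => by
      simp only [wave, incoming, endpoint, Bool.false_eq_true, if_false, sub_self, sub_zero]; ring
  have hv' : ∀ t ∈ Icc 0 τ, VertexConditions l (fun _ => 0) P h (τ - t) := fun t ht =>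
    hv _ (by linarith [ht.1])
  have hPd : ∀ d t, HasDerivAt (P d) (deriv (P d) t) t := fun d t =>
    ((hP _).differentiable (by norm_num) t).hasDerivAt
  have hId : ∀ d t, HasDerivAt (incoming l P h d) (deriv (incoming l P h d) t) t := fun d t =>
    ((contDiff_incoming hP hs hc _).differentiable (by norm_num) t).hasDerivAt
  -- The conditions hold up to τ' > τ, so τ - t is an interior time even for t = 0 and they may be
  -- differentiated there.
  have hu : ∀ t ∈ Icc 0 τ, UniqueDiffWithinAt ℝ (Iio τ') (τ - t) := fun t ht =>
    isOpen_Iio.uniqueDiffWithinAt (by rw [mem_Iio]; linarith [ht.1])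
  refine ⟨fun j => ?_, fun t ht => ?_, fun t ht => ?_, fun t ht => ⟨?_, ?_⟩, fun t ht => ⟨?_, ?_⟩,
    fun t ht => ?_, fun t ht => ?_, fun j x hx => ?_, fun j x hx => ?_⟩
  · exact (contDiff_wave hP hs hc j).comp (by fun_prop : ContDiff ℝ 2 fun p : ℝ × ℝ => (p.1, τ - p.2))
  · rw [hwl]; exact (hv' t ht).v₁
  · rw [hwl]; exact (hv' t ht).v₄
  · rw [hw0, hw0]; exact (hv' t ht).v₂_left
  · rw [hw0, hw0]; exact (hv' t ht).v₂_right
  · rw [hwl, hwl]; exact (hv' t ht).v₃_left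
  · rw [hwl, hw0]; exact (hv' t ht).v₃_right
  -- The Kirchhoff condition for derivatives is the time derivative of the sum condition for the
  -- profiles.
  · rw [deriv_wave_zero hP hs hc hh, deriv_wave_zero hP hs hc hh, deriv_wave_zero hP hs hc hh]
    have := eq_of_hasDerivAt_of_eqOn
      (((hPd (0, false) (τ - t)).add (hPd (1, false) (τ - t))).add (hPd (2, false) (τ - t)))
      (((hId (0, true) (τ - t)).add (hId (1, true) (τ - t))).add (hId (2, true) (τ - t)))
      (fun s hs => (hv s hs).v₂_sum) (mem_Iio.2 (by linarith [ht.1])) (hu t ht)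
    linarith
  · rw [deriv_wave_zero hP hs hc hh, deriv_wave_end hP hs hc hh, deriv_wave_end hP hs hc hh]
    have := eq_of_hasDerivAt_of_eqOn
      (((hPd (1, true) (τ - t)).add (hPd (2, true) (τ - t))).add (hPd (3, false) (τ - t)))
      (((hId (1, false) (τ - t)).add (hId (2, false) (τ - t))).add (hId (3, true) (τ - t)))
      (fun s hs => (hv s hs).v₃_sum) (mem_Iio.2 (by linarith [ht.1])) (hu t ht)
    linarith
  · exact wave_eq_zero hP0 hh j hx (by simp)
  · have hd := hasDerivAt_time ((contDiff_wave (l := l) hP hs hc j).differentiable (by norm_num)) x 0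
    have hd' : HasDerivAt (fun s => wave l P h j x (τ - s)) _ τ :=
      HasDerivAt.comp (h := fun s => τ - s) (h₂ := fun s => wave l P h j x s) τ
        (by simpa using hd) ((hasDerivAt_id τ).const_sub τ)
    have h0 := eq_of_hasDerivAt_of_eqOn hd (hasDerivAt_const (0 : ℝ) (0 : ℝ)) (s := Iic 0)
      (fun s hs => wave_eq_zero hP0 hh j hx hs) (mem_Iic.2 le_rfl)
      (uniqueDiffOn_Iic 0 _ (mem_Iic.2 le_rfl))
    rw [hd'.deriv, h0]; simp

end

/-! ### Duality with the backward wave equation -/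

/-- A family of integrable functions on the edges which is orthogonal to `box φ` for all test
functions `φ` vanishes. -/
theorem ae_eq_zero_of_integral_mul_box {l : Fin 4 → ℝ} (hl : ∀ j, 0 < l j) {τ : ℝ}
    {e : Fin 4 → ℝ × ℝ → ℝ} (he : ∀ j, IntegrableOn (e j) (Ioo 0 (l j) ×ˢ Ioo 0 τ))
    (h0 : ∀ φ, IsTestFunction l τ φ →
      ∑ j, ∫ z in Ioo 0 (l j) ×ˢ Ioo 0 τ, e j z * box (fun p => φ j p.1 p.2) z = 0) (j : Fin 4) :
    ∀ᵐ z, z ∈ Ioo 0 (l j) ×ˢ Ioo 0 τ → e j z = 0 := by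
  have hU : IsOpen (Ioo 0 (l j) ×ˢ Ioo 0 τ) := isOpen_Ioo.prod isOpen_Ioo
  refine hU.ae_eq_zero_of_integral_contDiff_smul_eq_zero (he j).locallyIntegrableOn
    fun g hg hgc hgs => ?_
  have hsub : ∀ p, g p ≠ 0 → p ∈ Ioo 0 (l j) ×ˢ Ioo 0 τ := fun p hp => hgs (subset_tsupport g hp)
  -- The bump g, reversed in time, as the source of a free wave. Run backwards, this wave is a test
  -- function whose image under the wave operator is g on edge j and 0 on the other edges.
  let h : Fin 4 → ℝ × ℝ → ℝ := fun k p => if k = j then g (p.1, τ - p.2) else 0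
  have hs : ∀ k, ContDiff ℝ 2 (h k) := fun k => by
    by_cases hk : k = j
    · simp only [h, hk, if_true]
      exact (contDiff_infty.1 hg 2).comp (by fun_prop)
    · simp only [h, hk, if_false]; exact contDiff_const
  have hc : ∀ k, HasCompactSupport (h k) := fun k => by
    by_cases hk : k = j
    · simp only [h, hk, if_true]
      exact hgc.comp_homeomorph ((Homeomorph.refl ℝ).prodCongr (Homeomorph.subLeft τ))
    · simp only [h, hk, if_false]; exact HasCompactSupport.zero
  have hh : IsSource l h := by
    refine ⟨fun k => (hs k).continuous.integrable_of_hasCompactSupport (hc k), fun k p hp => ?_⟩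
    by_cases hk : k = j
    · subst hk
      simp only [h, if_true] at hp
      have := hsub _ hp
      exact ⟨this.1, by have := this.2.2; simp only at this; linarith⟩
    · simp [h, hk] at hp
  obtain ⟨m, hm, hml⟩ : ∃ m > 0, ∀ j, m ≤ l j := by
    obtain ⟨i, hi⟩ := Finite.exists_min l
    exact ⟨l i, hl i, hi⟩
  -- The extra unit of time provides the room τ < τ + 1 which `isTestFunction_wave` needs.
  obtain ⟨N, hN⟩ := exists_nat_ge ((τ + 1) / m)
  rw [div_le_iff₀ hm] at hN
  set P := profile kirchhoffCoeff l N (fun _ _ => 0) h with hPdef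
  have hP : ∀ d, ContDiff ℝ 2 (P d) := contDiff_profile hs hc N
  have hφ := isTestFunction_wave (τ := τ) (τ' := τ + 1) hP
    (fun d t => profile_eq_zero hl (fun _ _ _ => rfl) hh N d) hs hc hh (by linarith)
    (fun t ht => vertexConditions_of_scatter fun d => by
      simpa using profile_eq hml (fun _ _ _ => rfl) hh N d (ht.le.trans hN))
  have hbox : ∀ k p, box (fun p => wave l P h k p.1 (τ - p.2)) p = if k = j then g p else 0 :=
    fun k p => by
      have e1 := box_comp_affine 0 τ (fun p => wave l P h k p.1 p.2) p
      rw [box_wave hP hs hc] at e1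
      simpa [h] using e1
  have := h0 _ hφ
  rw [Finset.sum_eq_single j (fun k _ hk => by simp [hbox, hk]) (by simp)] at this
  simp only [hbox, if_true] at this
  rw [← setIntegral_eq_integral_of_forall_compl_eq_zero (s := Ioo 0 (l j) ×ˢ Ioo 0 τ)
    (fun p hp => by rw [not_not.1 (mt (hsub p) hp), zero_smul])]
  simpa only [smul_eq_mul, mul_comm] using this

/-! ### The potential and the weak form -/

/-- The potential on an edge, extended by zero. -/
noncomputable def potential (l : Fin 4 → ℝ) (q : Fin 4 → ℝ → ℝ) (j : Fin 4) : ℝ → ℝ :=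
  (Ioo 0 (l j)).indicator (q j)

section
variable {l : Fin 4 → ℝ} {q : Fin 4 → ℝ → ℝ}

lemma measurable_potential (hq : ∀ j, ContinuousOn (q j) (Ioo 0 (l j))) (j : Fin 4) :
    Measurable (potential l q j) := by
  classical
  have := (hq j).measurable_piecewise (g := fun _ => (0 : ℝ)) continuousOn_const measurableSet_Ioo
  rwa [show (fun _ => (0 : ℝ)) = 0 from rfl, piecewise_eq_indicator] at this

lemma exists_bound_potential (hq : ∀ j, ∃ M, ∀ x ∈ Ioo 0 (l j), |q j x| ≤ M) :
    ∃ M : ℝ, 0 ≤ M ∧ ∀ j x, |potential l q j x| ≤ M := by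
  choose M hM using hq
  refine ⟨∑ j, |M j|, Finset.sum_nonneg fun j _ => abs_nonneg _, fun j x => ?_⟩
  have hj : |M j| ≤ ∑ j, |M j| :=
    Finset.single_le_sum (f := fun j => |M j|) (fun i _ => abs_nonneg _) (Finset.mem_univ j)
  by_cases hx : x ∈ Ioo 0 (l j)
  · rw [potential, indicator_of_mem hx]
    exact (hM j x hx).trans ((le_abs_self _).trans hj)
  · rw [potential, indicator_of_notMem hx, abs_zero]
    exact (abs_nonneg _).trans hj

lemma integrableOn_mul_of_continuous {u φ : ℝ × ℝ → ℝ} {L τ : ℝ}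
    (hu : IntegrableOn u (Ioo 0 L ×ˢ Ioo 0 τ)) (hφ : Continuous φ) :
    IntegrableOn (fun z => u z * φ z) (Ioo 0 L ×ˢ Ioo 0 τ) := by
  obtain ⟨C, hC⟩ := (isCompact_Icc.prod isCompact_Icc : IsCompact (Icc 0 L ×ˢ Icc 0 τ)).exists_bound_of_continuousOn
    hφ.continuousOn
  refine Integrable.mul_bdd (c := C) hu hφ.aestronglyMeasurable ?_
  filter_upwards [ae_restrict_mem (measurableSet_Ioo.prod measurableSet_Ioo)] with z hz
  exact hC z (prod_mono Ioo_subset_Icc_self Ioo_subset_Icc_self hz)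

lemma integrableOn_mul_potential (hq : ∀ j, ContinuousOn (q j) (Ioo 0 (l j)))
    (hqb : ∀ j, ∃ M, ∀ x ∈ Ioo 0 (l j), |q j x| ≤ M) (j : Fin 4) {u : ℝ × ℝ → ℝ} {s : Set (ℝ × ℝ)}
    (hu : IntegrableOn u s) : IntegrableOn (fun z => u z * potential l q j z.1) s := by
  obtain ⟨M, -, hM⟩ := exists_bound_potential hqb
  exact Integrable.mul_bdd (c := M) hu
    ((measurable_potential hq j).comp measurable_fst).aestronglyMeasurable
    (ae_of_all _ fun z => hM j z.1)

lemma intervalIntegral_intervalIntegral_eq {L τ : ℝ} (hL : 0 ≤ L) (hτ : 0 ≤ τ) {G : ℝ × ℝ → ℝ}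
    (hG : IntegrableOn G (Ioo 0 L ×ˢ Ioo 0 τ)) :
    ∫ t in (0 : ℝ)..τ, ∫ x in (0 : ℝ)..L, G (x, t) = ∫ z in Ioo 0 L ×ˢ Ioo 0 τ, G z := by
  simp only [intervalIntegral.integral_of_le hL, intervalIntegral.integral_of_le hτ,
    integral_Ioc_eq_integral_Ioo]
  rw [IntegrableOn, Measure.volume_eq_prod, ← Measure.prod_restrict] at hG
  rw [Measure.volume_eq_prod, ← Measure.prod_restrict, integral_prod_symm _ hG]

/-- The potential term is split off, so that -q u can play the part of a source for the free wave
operator. -/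
lemma weak_integral_eq (hl : ∀ j, 0 < l j) (hq : ∀ j, ContinuousOn (q j) (Ioo 0 (l j)))
    (hqb : ∀ j, ∃ M, ∀ x ∈ Ioo 0 (l j), |q j x| ≤ M) {τ : ℝ} (hτ : 0 ≤ τ) (j : Fin 4)
    {u φ : ℝ → ℝ → ℝ} (hu : IntegrableOn (fun z : ℝ × ℝ => u z.1 z.2) (Ioo 0 (l j) ×ˢ Ioo 0 τ))
    (hφ : ContDiff ℝ 2 fun p : ℝ × ℝ => φ p.1 p.2) :
    ∫ t in (0 : ℝ)..τ, ∫ x in (0 : ℝ)..l j, u x t * (iteratedDeriv 2 (fun s => φ x s) t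
        - iteratedDeriv 2 (fun y => φ y t) x + q j x * φ x t)
      = (∫ z in Ioo 0 (l j) ×ˢ Ioo 0 τ, u z.1 z.2 * box (fun p => φ p.1 p.2) z)
        + ∫ z in Ioo 0 (l j) ×ˢ Ioo 0 τ, u z.1 z.2 * potential l q j z.1 * φ z.1 z.2 := by
  have i1 := integrableOn_mul_of_continuous hu (continuous_box hφ)
  have i2 := integrableOn_mul_of_continuous (integrableOn_mul_potential hq hqb j hu) hφ.continuous
  have hG : IntegrableOn (fun z : ℝ × ℝ => u z.1 z.2 * box (fun p => φ p.1 p.2) z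
      + u z.1 z.2 * potential l q j z.1 * φ z.1 z.2) (Ioo 0 (l j) ×ˢ Ioo 0 τ) := i1.add i2
  rw [← integral_add i1 i2, ← intervalIntegral_intervalIntegral_eq (hl j).le hτ hG]
  refine intervalIntegral.integral_congr fun t _ => ?_
  simp only [intervalIntegral.integral_of_le (hl j).le, integral_Ioc_eq_integral_Ioo]
  refine setIntegral_congr_fun measurableSet_Ioo fun x hx => ?_
  simp only [potential, indicator_of_mem hx, box]
  ring

/-! ### Generalized solutions built from travelling waves -/

/-- Measurable functions which are square integrable on left half-lines. -/
structure IsSignal (f : ℝ → ℝ) : Prop where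
  measurable : Measurable f
  memLp : ∀ b, MemLp f 2 (volume.restrict (Iio b))

namespace IsSignal
variable {f g : ℝ → ℝ}

lemma zero : IsSignal fun _ => 0 := ⟨measurable_const, fun _ => MemLp.zero⟩

lemma add (hf : IsSignal f) (hg : IsSignal g) : IsSignal fun t => f t + g t :=
  ⟨hf.1.add hg.1, fun b => (hf.2 b).add (hg.2 b)⟩

lemma const_mul (a : ℝ) (hf : IsSignal f) : IsSignal fun t => a * f t :=
  ⟨hf.1.const_mul a, fun b => (hf.2 b).const_mul a⟩

lemma translate (a : ℝ) (hf : IsSignal f) : IsSignal fun t => f (t - a) := by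
  refine ⟨hf.1.comp (by fun_prop), fun b => (hf.2 (b - a)).comp_measurePreserving (g := f) ?_⟩
  have h := (measurePreserving_sub_right volume a).restrict_preimage
    (s := Iio (b - a)) measurableSet_Iio
  have hs : (fun x => x - a) ⁻¹' Iio (b - a) = Iio b := by ext x; simp
  rwa [hs] at h

lemma sum {ι : Type*} (s : Finset ι) {F : ι → ℝ → ℝ} (hF : ∀ i ∈ s, IsSignal (F i)) :
    IsSignal fun t => ∑ i ∈ s, F i t :=
  ⟨Finset.measurable_fun_sum s fun i hi => (hF i hi).1,
    fun b => memLp_finsetSum s fun i hi => (hF i hi).2 b⟩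

lemma duhamel {h : Fin 4 → ℝ × ℝ → ℝ} (hh : IsSource l h) (j : Fin 4) (x : ℝ) :
    IsSignal fun t => duhamel (h j) x t := by
  have hc : Continuous fun t => RingGraph.duhamel (h j) x t :=
    (continuous_duhamel (hh.integrable j)).comp (by fun_prop : Continuous fun t : ℝ => (x, t))
  refine ⟨hc.measurable, fun b => ?_⟩
  obtain ⟨M, hM⟩ := isCompact_Icc.exists_bound_of_continuousOn (s := Icc 0 b) hc.continuousOn
  have h1 : MemLp ((Ioo 0 b).indicator fun t => RingGraph.duhamel (h j) x t) 2 volume := by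
    rw [memLp_indicator_iff_restrict measurableSet_Ioo]
    refine MemLp.of_bound hc.aestronglyMeasurable M ?_
    filter_upwards [ae_restrict_mem measurableSet_Ioo] with t ht using hM t (Ioo_subset_Icc_self ht)
  refine (h1.restrict (Iio b)).ae_eq ?_
  filter_upwards [ae_restrict_mem measurableSet_Iio] with t ht
  by_cases h0 : 0 < t
  · exact indicator_of_mem (s := Ioo 0 b) ⟨h0, ht⟩ _
  · rw [indicator_of_notMem fun h => h0 h.1, duhamel_eq_zero_of_nonpos hh j x (not_lt.1 h0)]

lemma incoming {P : Fin 4 × Bool → ℝ → ℝ} {h : Fin 4 → ℝ × ℝ → ℝ} (hP : ∀ d, IsSignal (P d))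
    (hh : IsSource l h) (d : Fin 4 × Bool) : IsSignal (incoming l P h d) :=
  ((hP d).translate (l d.1)).add (duhamel hh d.1 (endpoint l d))

lemma profile {c : Fin 4 → ℝ} {ι : Fin 4 × Bool → ℝ → ℝ} {h : Fin 4 → ℝ × ℝ → ℝ}
    (hι : ∀ d, IsSignal (ι d)) (hh : IsSource l h) (N : ℕ) (d : Fin 4 × Bool) :
    IsSignal (profile c l N ι h d) :=
  solve_induction (Q := IsSignal) zero (fun _ _ => add) (fun a _ => const_mul a)
    (fun a _ => translate a) (fun d => (hι d).add (sum _ fun d' _ =>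
      (duhamel hh d'.1 (endpoint l d')).const_mul _)) N d

lemma memLp_indicator (hf : IsSignal f) (b : ℝ) : MemLp ((Iio b).indicator f) 2 :=
  (memLp_indicator_iff_restrict measurableSet_Iio).2 (hf.2 b)

lemma integrable_indicator (hf : IsSignal f) (h0 : ∀ t ≤ 0, f t = 0) (b : ℝ) :
    Integrable ((Iio b).indicator f) := by
  have h1 : (Iio b).indicator f = (Ioo 0 b).indicator f := by
    ext t
    by_cases ht : 0 < t
    · by_cases hb : t < b <;> simp [indicator, ht, hb]
    · simp [indicator, ht, h0 t (not_lt.1 ht)]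
  rw [h1, MeasureTheory.integrable_indicator_iff measurableSet_Ioo]
  exact ((hf.2 b).mono_measure (Measure.restrict_mono Ioo_subset_Iio_self le_rfl)).integrable
    (by norm_num)

end IsSignal

/-- The profiles cut off at the time `b`. -/
noncomputable def cut (b : ℝ) (P : Fin 4 × Bool → ℝ → ℝ) (d : Fin 4 × Bool) : ℝ → ℝ :=
  (Iio b).indicator (P d)

lemma cut_of_lt {b t : ℝ} (ht : t < b) (P : Fin 4 × Bool → ℝ → ℝ) (d : Fin 4 × Bool) :
    cut b P d t = P d t := indicator_of_mem (s := Iio b) ht _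

lemma cut_of_nonpos {P : Fin 4 × Bool → ℝ → ℝ} (hP : ∀ d, ∀ t ≤ 0, P d t = 0) (b : ℝ)
    (d : Fin 4 × Bool) {t : ℝ} (ht : t ≤ 0) : cut b P d t = 0 := by
  simp [cut, indicator, hP d t ht]

lemma incoming_cut (hl : ∀ j, 0 < l j) {b t : ℝ} (ht : t < b) (P : Fin 4 × Bool → ℝ → ℝ)
    (h : Fin 4 → ℝ × ℝ → ℝ) (d : Fin 4 × Bool) :
    incoming l (cut b P) h d t = incoming l P h d t := by
  simp only [incoming, cut_of_lt (show t - l d.1 < b by linarith [hl d.1])]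

/-- At an interior point the wave involves the profiles only at strictly earlier times. Cutting them
off therefore makes them globally square integrable without changing the solution up to the cutoff
time. -/
lemma wave_cut {b x t : ℝ} {j : Fin 4} (hx : x ∈ Ioo 0 (l j)) (ht : t ≤ b)
    (P : Fin 4 × Bool → ℝ → ℝ) (h : Fin 4 → ℝ × ℝ → ℝ) :
    wave l (cut b P) h j x t = wave l P h j x t := by
  simp only [wave, cut_of_lt (show t - x < b by linarith [hx.1]),
    cut_of_lt (show t - (l j - x) < b by linarith [hx.2])]

lemma VertexConditions.cut (hl : ∀ j, 0 < l j) {b t : ℝ} (ht : t < b) {f : ℝ → ℝ}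
    {P : Fin 4 × Bool → ℝ → ℝ} {h : Fin 4 → ℝ × ℝ → ℝ} (hv : VertexConditions l f P h t) :
    VertexConditions l f (cut b P) h t := by
  obtain ⟨h1, h2, h3, h4, h5, h6, h7, h8⟩ := hv
  constructor <;> simpa only [incoming_cut hl ht, cut_of_lt ht]

section
variable {P : Fin 4 × Bool → ℝ → ℝ} {h : Fin 4 → ℝ × ℝ → ℝ} {τ : ℝ} {f : ℝ → ℝ}

lemma integrableOn_wave (hP : ∀ d, IsSignal (P d)) (hP0 : ∀ d, ∀ t ≤ 0, P d t = 0)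
    (hh : ∀ j, Integrable (h j)) (j : Fin 4) :
    IntegrableOn (fun z : ℝ × ℝ => wave l P h j z.1 z.2) (Ioo 0 (l j) ×ˢ Ioo 0 τ) := by
  have hi := fun d => (hP d).integrable_indicator (hP0 d) τ
  have i1 := integrableOn_wave_mul (hi (j, false)) (continuous_const (y := (1 : ℝ))) 0 (l j) τ 0
  have i2 : IntegrableOn (fun z : ℝ × ℝ => (Iio τ).indicator (P (j, true)) (z.2 - (l j - z.1)))
      (Ioo 0 (l j) ×ˢ Ioo 0 τ) := by
    simpa using integrableOn_leftward_wave_mul (hi (j, true)) (continuous_const (y := (1 : ℝ))) (l j) τ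
  have i3 : IntegrableOn (fun z : ℝ × ℝ => duhamel (h j) z.1 z.2) (Ioo 0 (l j) ×ˢ Ioo 0 τ) :=
    ((continuous_duhamel (hh j)).continuousOn.integrableOn_compact
      (isCompact_Icc.prod isCompact_Icc)).mono_set
      (prod_mono Ioo_subset_Icc_self Ioo_subset_Icc_self)
  have i1' : IntegrableOn (fun z : ℝ × ℝ => (Iio τ).indicator (P (j, false)) (z.2 - z.1))
      (Ioo 0 (l j) ×ˢ Ioo 0 τ) := by simpa using i1
  refine ((i1'.add i2).add i3).congr_fun (fun z hz => ?_) (measurableSet_Ioo.prod measurableSet_Ioo)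
  exact wave_cut hz.1 hz.2.2.le P h

/-- A superposition of travelling waves whose source is `-q u` is a generalized solution. -/
theorem isGeneralizedSolution_wave (hl : ∀ j, 0 < l j)
    (hq : ∀ j, ContinuousOn (q j) (Ioo 0 (l j)))
    (hqb : ∀ j, ∃ M, ∀ x ∈ Ioo 0 (l j), |q j x| ≤ M) (hP : ∀ d, IsSignal (P d))
    (hP0 : ∀ d, ∀ t ≤ 0, P d t = 0) (hh : IsSource l h) (hτ : 0 < τ)
    (hv : ∀ t ∈ Ioo 0 τ, VertexConditions l f P h t)
    (he : ∀ j, ∀ᵐ p : ℝ × ℝ, p ∈ Ioo 0 (l j) ×ˢ Ioo 0 τ →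
      h j p = -potential l q j p.1 * wave l P h j p.1 p.2) :
    IsGeneralizedSolution l q τ f (wave l (cut τ P) h) := by
  have hm : ∀ d, Measurable (cut τ P d) := fun d => (hP d).1.indicator measurableSet_Iio
  have hL : ∀ d, MemLp (cut τ P d) 2 := fun d => (hP d).memLp_indicator τ
  refine ⟨fun j => (measurable_wave hm hh.integrable j).aestronglyMeasurable, fun j t _ => memLp_wave hL hh j t,
    fun j t _ => (tendsto_eLpNorm_wave_time hm hL hh j t).mono_left nhdsWithin_le_nhds,
    fun φ hφ => ?_⟩
  have hi : ∀ j, IntegrableOn (fun z : ℝ × ℝ => wave l (cut τ P) h j z.1 z.2)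
      (Ioo 0 (l j) ×ˢ Ioo 0 τ) := fun j =>
    (integrableOn_wave hP hP0 hh.integrable j).congr_fun
      (fun z hz => (wave_cut hz.1 hz.2.2.le P h).symm) (measurableSet_Ioo.prod measurableSet_Ioo)
  simp only [weak_integral_eq hl hq hqb hτ.le _ (hi _) (hφ.smooth _)]
  rw [Finset.sum_add_distrib, sum_integral_wave_mul_box (P := cut τ P) hl
    (fun d => (hP d).integrable_indicator (hP0 d) τ) (fun d t => cut_of_nonpos hP0 τ d) hh hτ
    (fun t ht => (hv t ht).cut hl ht.2) hφ, intervalIntegral.integral_of_le hτ.le,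
    integral_Ioc_eq_integral_Ioo, add_right_comm, add_eq_right, ← Finset.sum_add_distrib]
  -- By `he` the source term and the potential term cancel on each edge.
  refine Finset.sum_eq_zero fun j _ => ?_
  rw [← eq_neg_iff_add_eq_zero, ← integral_neg]
  refine setIntegral_congr_ae (measurableSet_Ioo.prod measurableSet_Ioo) ?_
  filter_upwards [he j] with z hz hzm
  rw [hz hzm, wave_cut hzm.1 hzm.2.2.le]
  ring

lemma isTraceAtV₂_wave (hl : ∀ j, 0 < l j) (hP : ∀ d, IsSignal (P d)) (hh : IsSource l h)
    (hv : ∀ t ∈ Ioo 0 τ, VertexConditions l f P h t) :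
    IsTraceAtV₂ τ (wave l (cut τ P) h) fun t => P (0, false) t + incoming l P h (0, true) t := by
  have hm : ∀ d, Measurable (cut τ P d) := fun d => (hP d).1.indicator measurableSet_Iio
  have hL : ∀ d, MemLp (cut τ P d) 2 := fun d => (hP d).memLp_indicator τ
  refine ⟨(((hP _).add (IsSignal.incoming hP hh _)).2 τ).mono_measure
    (Measure.restrict_mono Ioo_subset_Iio_self le_rfl), fun j hj => ?_⟩
  refine ((tendsto_eLpNorm_wave_space hm hL hh j τ).mono_left
    (inf_le_left.trans nhdsWithin_le_nhds)).congr fun x => eLpNorm_congr_ae ?_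
  filter_upwards [ae_restrict_mem measurableSet_Ioo] with t ht
  rw [cut_of_lt ht.2, incoming_cut hl ht.2]
  have h1 := (hv t ht).v₂_left
  have h2 := (hv t ht).v₂_right
  simp only [mem_insert_iff, mem_singleton_iff] at hj
  rcases hj with rfl | rfl | rfl
  · rfl
  · rw [h1]
  · rw [h1, h2]

end

end

/-! ### Mild solutions -/

lemma isFrame_zero (l : Fin 4 → ℝ) : IsFrame l (fun _ => 0) (fun _ _ => 0) :=
  ⟨fun j x y => by simp, fun _ => rfl, fun _ => rfl⟩

/-- The time offsets of a signal leaving from `v₁`, saturated at `v₂`. -/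
def delay (l : Fin 4 → ℝ) (j : Fin 4) (x : ℝ) : ℝ := if j = 0 then l 0 - x else l 0

/-- The values of `delay` at the vertices. -/
def vertexDelay (l : Fin 4 → ℝ) : Fin 4 → ℝ := ![0, l 0, l 0, l 0]

/-- The offset is 0 at v₁ and l 0 from v₂ onwards, with slope of modulus 1 on e₁. A front leaving v₁
therefore has constant frame time until it reaches v₂, and on e₁ the estimates still hold with the
roles of x and t exchanged. -/
lemma isFrame_delay (l : Fin 4 → ℝ) : IsFrame l (vertexDelay l) (delay l) := by
  refine ⟨fun j x y => ?_, fun j => ?_, fun j => ?_⟩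
  · by_cases hj : j = 0
    · simp only [delay, hj, if_true]
      rw [show l 0 - x - (l 0 - y) = y - x by ring, abs_sub_comm]
    · simp [delay, hj]
  · fin_cases j <;> simp [delay, vertexDelay, tail]
  · fin_cases j <;> simp [delay, vertexDelay, tail]

lemma delay_le {l : Fin 4 → ℝ} {j : Fin 4} {x : ℝ} (hx : x ∈ Ioo 0 (l j)) : delay l j x ≤ l 0 := by
  unfold delay; split_ifs
  · linarith [hx.1]
  · exact le_rfl

lemma delay_pos {l : Fin 4 → ℝ} (hl : ∀ j, 0 < l j) {j : Fin 4} {x : ℝ} (hx : x ∈ Ioo 0 (l j)) :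
    0 < delay l j x := by
  unfold delay; split_ifs with h
  · subst h; linarith [hx.2]
  · exact hl 0

section
variable {l : Fin 4 → ℝ} {q : Fin 4 → ℝ → ℝ} {V : Fin 4 → ℝ} {δ : Fin 4 → ℝ → ℝ}

lemma measurable_profile {c : Fin 4 → ℝ} {ι : Fin 4 × Bool → ℝ → ℝ} (hι : ∀ d, Measurable (ι d))
    {h : Fin 4 → ℝ × ℝ → ℝ} (hh : ∀ j, Integrable (h j)) (N : ℕ) (d : Fin 4 × Bool) :
    Measurable (profile c l N ι h d) := by
  refine solve_induction (Q := Measurable) measurable_const (fun _ _ => Measurable.add)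
    (fun a _ hf => hf.const_mul a) (fun a _ hf => hf.comp (by fun_prop))
    (fun d => (hι d).add (Finset.measurable_fun_sum _ fun d' _ => Measurable.const_mul ?_ _)) N d
  exact ((continuous_duhamel (hh d'.1)).comp
    (by fun_prop : Continuous fun t : ℝ => (endpoint l d', t))).measurable

lemma enorm_profile_sub_le (hF : IsFrame l V δ) (hl : ∀ j, 0 < l j) {c : Fin 4 → ℝ}
    (hc : ∀ v, c v ∈ Icc (0 : ℝ) 1) (ι : Fin 4 × Bool → ℝ → ℝ) {h h' : Fin 4 → ℝ × ℝ → ℝ}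
    (hh : ∀ j, Integrable (h j)) (hh' : ∀ j, Integrable (h' j)) (N : ℕ) (d : Fin 4 × Bool) (t : ℝ) :
    ‖profile c l N ι h d t - profile c l N ι h' d t‖ₑ
      ≤ solveConst N * 8 * pastMass δ (fun j p => h j p - h' j p) (t - V (tail d)) := by
  rw [← profile_sub N ι ι hh hh' d t, mul_assoc]
  refine (enorm_profile_le hF hl hc (B := fun _ => 0) monotone_const (by simp) _ N d t).trans_eq ?_
  rw [zero_add]

lemma enorm_potential_mul_le {M : ℝ} (hM : ∀ j x, |potential l q j x| ≤ M) (j : Fin 4) (x w : ℝ) :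
    ‖-potential l q j x * w‖ₑ ≤ ENNReal.ofReal M * ‖w‖ₑ := by
  rw [enorm_mul, enorm_neg, ← ofReal_norm (potential l q j x)]
  gcongr
  exact hM j x

/-- Existence of the source `-q u` for a superposition `u` of travelling waves whose profiles
depend on the source with the correct speed of propagation. -/
theorem exists_mild_source (hF : IsFrame l V δ) (hl : ∀ j, 0 < l j)
    (hq : ∀ j, ContinuousOn (q j) (Ioo 0 (l j)))
    (hqb : ∀ j, ∃ M, ∀ x ∈ Ioo 0 (l j), |q j x| ≤ M) {T b : ℝ}
    (hb : ∀ j, slab l δ T j ⊆ Ioo 0 (l j) ×ˢ Ioo 0 b)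
    {R : (Fin 4 → ℝ × ℝ → ℝ) → Fin 4 × Bool → ℝ → ℝ} {C : ENNReal} (hC : C ≠ ⊤)
    (hR : ∀ h : Fin 4 → ℝ × ℝ → ℝ, (∀ j, Integrable (h j)) → ∀ d, Measurable (R h d))
    (hR0 : ∀ d, IsSignal (R (fun _ _ => 0) d)) (hR1 : ∀ d, ∀ t ≤ 0, R (fun _ _ => 0) d t = 0)
    (hlip : ∀ h h' : Fin 4 → ℝ × ℝ → ℝ, (∀ j, Integrable (h j)) → (∀ j, Integrable (h' j)) →
      ∀ d t, ‖R h d t - R h' d t‖ₑ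
        ≤ C * pastMass δ (fun j p => h j p - h' j p) (t - V (tail d))) :
    ∃ h : Fin 4 → ℝ × ℝ → ℝ, (∀ j, Integrable (h j)) ∧ (∀ j, ∀ p ∉ slab l δ T j, h j p = 0) ∧
      ∀ j, ∀ᵐ p : ℝ × ℝ, p ∈ slab l δ T j →
        h j p = -potential l q j p.1 * wave l (R h) h j p.1 p.2 := by
  obtain ⟨M, -, hM⟩ := exists_bound_potential hqb
  refine exists_fixedPoint_source hF hl
    (Ψ := fun h j p => -potential l q j p.1 * wave l (R h) h j p.1 p.2)
    -- Two profiles with constant C each and one Duhamel integral with constant 1, multiplied by the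
    -- bound of the potential.
    (C := ENNReal.ofReal M * (2 * C + 1)) (by finiteness) T (fun h hh j => ?_) (fun j => ?_)
    (fun h h' hh hh' j p hp => ?_)
  · exact ((((measurable_potential hq j).comp measurable_fst).neg).mul
      (measurable_wave (hR h hh) hh j)).aestronglyMeasurable
  · have h1 := integrableOn_mul_potential hq hqb j
      ((integrableOn_wave (l := l) (h := fun _ _ => 0) (τ := b) hR0 hR1 (fun _ => integrable_zero _ _ _) j).mono_set
        (hb j)).neg
    refine h1.congr (ae_of_all _ fun p => ?_)
    simp only [Pi.neg_apply]; ring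
  · rw [← mul_sub, ← wave_sub _ _ hh hh', mul_assoc]
    refine (enorm_potential_mul_le hM j _ _).trans ?_
    gcongr
    refine (enorm_wave_le hF
      (B := fun r => C * pastMass δ (fun j p => h j p - h' j p) r)
      (fun r s hrs => by dsimp only; gcongr; exact monotone_pastMass _ _ hrs)
      (hlip h h' hh hh') j (Ioo_subset_Icc_self hp.1) p.2).trans_eq ?_
    ring

lemma isSource_of_slab {T : ℝ} {h : Fin 4 → ℝ × ℝ → ℝ}
    (hδ : ∀ j, ∀ x ∈ Ioo 0 (l j), 0 ≤ δ j x) (hh : ∀ j, Integrable (h j))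
    (hs : ∀ j, ∀ p ∉ slab l δ T j, h j p = 0) : IsSource l h := by
  refine ⟨hh, fun j p hp => ?_⟩
  have hm : p ∈ slab l δ T j := not_not.1 (mt (hs j p) hp)
  exact ⟨hm.1, by linarith [hm.2.1, hδ j _ hm.1]⟩

/-! ### The problem with boundary data at the first vertex -/

/-- The data `f` at `v₁`. -/
noncomputable def boundaryData (f : ℝ → ℝ) (d : Fin 4 × Bool) (t : ℝ) : ℝ :=
  if d = (0, true) then f t else 0

lemma boundaryData_of_nonpos {f : ℝ → ℝ} (hf : ∀ t ≤ 0, f t = 0) (d : Fin 4 × Bool) {t : ℝ}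
    (ht : t ≤ 0) : boundaryData f d t = 0 := by
  simp [boundaryData, hf t ht]

lemma isSignal_boundaryData {f : ℝ → ℝ} (hf : IsSignal f) (d : Fin 4 × Bool) :
    IsSignal (boundaryData f d) := by
  unfold boundaryData; split_ifs
  exacts [hf, IsSignal.zero]

/-- The source `h` is `-q u` for the mild solution `u` with boundary data `f`, on the time interval
`(0, τ)`. -/
structure IsMildSource (l : Fin 4 → ℝ) (q : Fin 4 → ℝ → ℝ) (τ : ℝ) (N : ℕ) (f : ℝ → ℝ)
    (h : Fin 4 → ℝ × ℝ → ℝ) : Prop where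
  isSource : IsSource l h
  eq_zero : ∀ j, ∀ p ∉ Ioo 0 (l j) ×ˢ Ioo 0 τ, h j p = 0
  eq_mul : ∀ j, ∀ᵐ p : ℝ × ℝ, p ∈ Ioo 0 (l j) ×ˢ Ioo 0 τ → h j p
    = -potential l q j p.1 * wave l (profile kirchhoffCoeff l N (boundaryData f) h) h j p.1 p.2

/-- In the zero frame, which is ordinary time, the slab is the full rectangle, and the profiles
depend on the source with the constant 8 `solveConst N`. -/
theorem exists_isMildSource (hl : ∀ j, 0 < l j) (hq : ∀ j, ContinuousOn (q j) (Ioo 0 (l j)))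
    (hqb : ∀ j, ∃ M, ∀ x ∈ Ioo 0 (l j), |q j x| ≤ M) (τ : ℝ) (N : ℕ) {f : ℝ → ℝ}
    (hf : IsSignal f) (hf0 : ∀ t ≤ 0, f t = 0) : ∃ h, IsMildSource l q τ N f h := by
  have hslab : ∀ j, slab l (fun _ _ => 0) τ j = Ioo 0 (l j) ×ˢ Ioo 0 τ := fun j => by
    ext p; simp [slab, mem_prod]
  have h0 : IsSource l fun _ _ => 0 := ⟨fun _ => integrable_zero _ _ _, fun _ _ h => absurd rfl h⟩
  obtain ⟨h, h1, h2, h3⟩ := exists_mild_source (isFrame_zero l) hl hq hqb (T := τ) (b := τ)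
    (fun j => (hslab j).le) (R := fun h => profile kirchhoffCoeff l N (boundaryData f) h)
    (C := solveConst N * 8) (ENNReal.mul_ne_top (solveConst_ne_top N) (by norm_num))
    (fun h hh d => measurable_profile (fun d => (isSignal_boundaryData hf d).1) hh N d)
    (fun d => IsSignal.profile (isSignal_boundaryData hf) h0 N d)
    (fun d t ht => profile_eq_zero hl (fun d t ht => boundaryData_of_nonpos hf0 d ht) h0 N d ht)
    (fun h h' hh hh' d t =>
      enorm_profile_sub_le (isFrame_zero l) hl kirchhoffCoeff_mem _ hh hh' N d t)
  have hs := isSource_of_slab (fun _ _ _ => le_rfl) h1 h2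
  simp only [hslab] at h2 h3
  exact ⟨h, hs, h2, h3⟩

/-! ### Mild solutions and finite speed of propagation -/

section
variable {τ m : ℝ} {N : ℕ} {f : ℝ → ℝ} {h : Fin 4 → ℝ × ℝ → ℝ}

lemma IsMildSource.vertexConditions (hh : IsMildSource l q τ N f h) (hm : ∀ j, m ≤ l j)
    (hf0 : ∀ t ≤ 0, f t = 0) {t : ℝ} (ht : t ≤ N * m) :
    VertexConditions l f (profile kirchhoffCoeff l N (boundaryData f) h) h t :=
  vertexConditions_of_scatter fun d =>
    profile_eq hm (fun d _ ht => boundaryData_of_nonpos hf0 d ht) hh.isSource N d ht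

/-- The trace at `v₂` of the mild solution. -/
noncomputable def mildTrace (l : Fin 4 → ℝ) (N : ℕ) (f : ℝ → ℝ) (h : Fin 4 → ℝ × ℝ → ℝ) (t : ℝ) : ℝ :=
  profile kirchhoffCoeff l N (boundaryData f) h (0, false) t
    + incoming l (profile kirchhoffCoeff l N (boundaryData f) h) h (0, true) t

theorem IsMildSource.exists_isGeneralizedSolution (hh : IsMildSource l q τ N f h)
    (hl : ∀ j, 0 < l j) (hq : ∀ j, ContinuousOn (q j) (Ioo 0 (l j)))
    (hqb : ∀ j, ∃ M, ∀ x ∈ Ioo 0 (l j), |q j x| ≤ M) (hm : ∀ j, m ≤ l j) (hτ : 0 < τ)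
    (hN : τ ≤ N * m) (hf : IsSignal f) (hf0 : ∀ t ≤ 0, f t = 0) :
    ∃ u, IsGeneralizedSolution l q τ f u ∧ IsTraceAtV₂ τ u (mildTrace l N f h) := by
  have hP := fun d => IsSignal.profile (c := kirchhoffCoeff) (isSignal_boundaryData hf)
    hh.isSource N d
  have hv : ∀ t ∈ Ioo 0 τ, VertexConditions l f _ h t := fun t ht =>
    hh.vertexConditions hm hf0 (ht.2.le.trans hN)
  exact ⟨_, isGeneralizedSolution_wave hl hq hqb hP
    (fun d t ht => profile_eq_zero hl (fun d _ ht => boundaryData_of_nonpos hf0 d ht)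
      hh.isSource N d ht) hh.isSource hτ hv hh.eq_mul, isTraceAtV₂_wave hl hP hh.isSource hv⟩

/-- Finite speed of propagation: before the time `T + l 0`, the trace at `v₂` only depends on the
boundary data before the time `T`. -/
theorem mildTrace_eq {f' : ℝ → ℝ} {h' : Fin 4 → ℝ × ℝ → ℝ} {T : ℝ}
    (hh : IsMildSource l q (T + l 0) N f h) (hh' : IsMildSource l q (T + l 0) N f' h')
    (hl : ∀ j, 0 < l j) (hqb : ∀ j, ∃ M, ∀ x ∈ Ioo 0 (l j), |q j x| ≤ M)
    (hff : ∀ t < T, f t = f' t) {t : ℝ} (ht : t < T + l 0) :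
    mildTrace l N f h t = mildTrace l N f' h' t := by
  obtain ⟨M, -, hM⟩ := exists_bound_potential hqb
  have hF := isFrame_delay l
  have i := hh.isSource.integrable
  have i' := hh'.isSource.integrable
  -- A bound that forces vanishing before T and is void afterwards. The difference of the data
  -- satisfies it because frame time and ordinary time agree at v₁.
  set B : ℝ → ENNReal := fun r => if r < T then 0 else ⊤ with hB
  have hBm : Monotone B := fun r s hrs => by
    by_cases hs : s < T
    · simp [hB, hs, hrs.trans_lt hs]
    · simp [hB, hs]
  have hι : ∀ d t, ‖boundaryData f d t - boundaryData f' d t‖ₑ ≤ B (t - vertexDelay l (tail d)) := by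
    intro d t
    by_cases hd : d = (0, true)
    · subst hd
      by_cases ht : t < T
      · simp [boundaryData, hff t ht]
      · simp [hB, tail, vertexDelay, ht]
    · simp [boundaryData, hd]
  have hPB := enorm_profile_le hF hl kirchhoffCoeff_mem hBm hι (fun j p => h j p - h' j p) N
  simp only [profile_sub N _ _ i i'] at hPB
  set B' : ℝ → ENNReal := fun r => solveConst N * (B r + 8 * pastMass (delay l) (fun j p => h j p - h' j p) r) with hB'
  have hB'm : Monotone B' := fun r s hrs => by
    simp only [hB']; gcongr; exacts [hBm hrs, monotone_pastMass _ _ hrs]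
  -- Before the frame time T the term from `B` disappears and the difference of the sources is
  -- bounded by its own past mass, so Gronwall applies.
  have hz : ∀ j, ∀ᵐ p : ℝ × ℝ, p.2 - delay l j p.1 < T → h j p - h' j p = 0 := by
    refine ae_eq_zero_of_le_pastMass hF hl (h := fun j p => h j p - h' j p) (fun j => (i j).sub (i' j)) (b := l 0)
      (C := ENNReal.ofReal M * (2 * (solveConst N * 8) + 1)) (fun j p hp => ?_)
      (by have := solveConst_ne_top N; finiteness) fun j => ?_
    · have hmem : p ∈ Ioo 0 (l j) ×ˢ Ioo 0 (T + l 0) := by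
        by_contra hn
        exact hp (by simp [hh.eq_zero j p hn, hh'.eq_zero j p hn])
      exact ⟨hmem.1, by linarith [delay_le hmem.1, hmem.2.1]⟩
    · filter_upwards [hh.eq_mul j, hh'.eq_mul j] with p h1 h2 hx hT
      by_cases hmem : p ∈ Ioo 0 (l j) ×ˢ Ioo 0 (T + l 0)
      · have hw := enorm_wave_le (h := fun j p => h j p - h' j p) hF hB'm hPB j (Ioo_subset_Icc_self hx) p.2
        rw [wave_sub _ _ i i'] at hw
        simp only [h1 hmem, h2 hmem]
        rw [← mul_sub, mul_assoc]
        refine (enorm_potential_mul_le hM j _ _).trans ?_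
        gcongr
        refine hw.trans_eq ?_
        simp only [hB', hB, hT, if_true, zero_add]
        ring
      · simp [hh.eq_zero j p hmem, hh'.eq_zero j p hmem]
  have hpm : ∀ r < T, pastMass (delay l) (fun j p => h j p - h' j p) r = 0 := fun r hr => by
    refine Finset.sum_eq_zero fun j _ => ?_
    have hm : AEMeasurable (fun p => ‖h j p - h' j p‖ₑ) := ((i j).sub (i' j)).1.enorm
    rw [lintegral_eq_zero_iff' hm.restrict]
    refine ae_restrict_of_ae_restrict_of_subset (t := {p | p.2 - delay l j p.1 < T})
      (fun p hp => lt_of_le_of_lt hp hr) ?_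
    rw [ae_restrict_iff' (measurableSet_lt (hF.measurable_time j) measurable_const)]
    filter_upwards [hz j] with p hp hpT
    simp [hp hpT]
  -- The frame time at v₂, where the offset is l 0.
  have hr : t - l 0 < T := by linarith
  have hB'0 : B' (t - l 0) = 0 := by simp [hB', hB, hr, hpm _ hr]
  have e1 := hPB (0, false) t
  have e2 := enorm_incoming_le (h := fun j p => h j p - h' j p) hF hl hB'm hPB (0, true) t
  rw [incoming_sub _ _ i i'] at e2
  have hV : vertexDelay l (tail (0, false)) = l 0 := by simp [vertexDelay, tail]
  have hV' : vertexDelay l (tail (rev (0, true))) = l 0 := by simp [vertexDelay, tail, rev]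
  rw [hV] at e1
  rw [hV', hB'0, hpm _ hr, add_zero] at e2
  have e1' := sub_eq_zero.1 (enorm_eq_zero.1 (le_zero_iff.1 (e1.trans_eq hB'0)))
  have e2' := sub_eq_zero.1 (enorm_eq_zero.1 (le_zero_iff.1 e2))
  rw [mildTrace, mildTrace, e1', e2']

end

end

/-! ### Uniqueness -/

section
variable {l : Fin 4 → ℝ} {q : Fin 4 → ℝ → ℝ} {τ : ℝ} {f : ℝ → ℝ} {u u' : Fin 4 → ℝ → ℝ → ℝ}

/-- Local bounds from continuity in L², patched by compactness. They make u integrable on the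
rectangle, so that the iterated integrals of the weak form become integrals over the rectangle. -/
lemma IsGeneralizedSolution.exists_bound (hu : IsGeneralizedSolution l q τ f u) (j : Fin 4) :
    ∃ C : ENNReal, C ≠ ⊤ ∧ ∀ t ∈ Icc 0 τ,
      eLpNorm (fun x => u j x t) 2 (volume.restrict (Ioo 0 (l j))) ≤ C := by
  refine (isCompact_Icc (a := (0 : ℝ)) (b := τ)).induction_on (p := fun S => ∃ C : ENNReal, C ≠ ⊤ ∧
    ∀ t ∈ S, eLpNorm (fun x => u j x t) 2 (volume.restrict (Ioo 0 (l j))) ≤ C)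
    ⟨0, by simp, by simp⟩ (fun s t hst ⟨C, hC, h⟩ => ⟨C, hC, fun r hr => h r (hst hr)⟩)
    (fun s t ⟨C, hC, h⟩ ⟨C', hC', h'⟩ => ⟨max C C', by simp [hC, hC'], ?_⟩) (fun t₀ ht₀ => ?_)
  · rintro r (hr | hr)
    exacts [(h r hr).trans (le_max_left _ _), (h' r hr).trans (le_max_right _ _)]
  · have h1 := (hu.continuous j t₀ ht₀).eventually (ge_mem_nhds (show (0 : ENNReal) < 1 by simp))
    refine ⟨_, inter_mem h1 self_mem_nhdsWithin,
      1 + eLpNorm (fun x => u j x t₀) 2 (volume.restrict (Ioo 0 (l j))),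
      ENNReal.add_ne_top.2 ⟨by simp, (hu.memLp j t₀ ht₀).eLpNorm_ne_top⟩, fun t ht => ?_⟩
    have h2 := eLpNorm_add_le ((hu.memLp j t ht.2).1.sub (hu.memLp j t₀ ht₀).1)
      (hu.memLp j t₀ ht₀).1 (p := 2) (by norm_num)
    rw [sub_add_cancel] at h2
    refine h2.trans ?_
    gcongr
    exact ht.1

lemma IsGeneralizedSolution.integrableOn (hu : IsGeneralizedSolution l q τ f u) (j : Fin 4) :
    IntegrableOn (fun z : ℝ × ℝ => u j z.1 z.2) (Ioo 0 (l j) ×ˢ Ioo 0 τ) := by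
  obtain ⟨C, hC, hCu⟩ := hu.exists_bound j
  have hm := hu.measurable j
  refine ⟨hm, ?_⟩
  rw [Measure.volume_eq_prod, ← Measure.prod_restrict] at hm ⊢
  rw [HasFiniteIntegral, lintegral_prod_symm _ hm.enorm]
  set K := (volume.restrict (Ioo 0 (l j))) univ ^ (1 / (1 : ENNReal).toReal - 1 / (2 : ENNReal).toReal)
    with hK
  have hKt : K ≠ ⊤ := ENNReal.rpow_ne_top_of_nonneg (by norm_num) (by simp)
  calc ∫⁻ t in Ioo 0 τ, ∫⁻ x in Ioo 0 (l j), ‖u j x t‖ₑ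
      ≤ ∫⁻ t in Ioo 0 τ, C * K := by
        refine setLIntegral_mono measurable_const fun t ht => ?_
        have ht' := Ioo_subset_Icc_self ht
        rw [← eLpNorm_one_eq_lintegral_enorm]
        refine (eLpNorm_le_eLpNorm_mul_rpow_measure_univ (p := 1) (q := 2) (by norm_num)
          (hu.memLp j t ht').1).trans ?_
        gcongr
        exact hCu t ht'
    _ < ⊤ := by
        rw [setLIntegral_const]
        exact ENNReal.mul_lt_top (ENNReal.mul_lt_top hC.lt_top hKt.lt_top) (by simp)

/-- Let w be the difference of the two solutions and z the wave with zero data and source -q w.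
Subtracting the weak forms shows that w - z is orthogonal to `box φ` for all test functions, hence w
= z. So the source -q w is bounded by its own past mass and vanishes by Gronwall, and with it w. -/
lemma IsGeneralizedSolution.ae_eq_prod (hl : ∀ j, 0 < l j)
    (hq : ∀ j, ContinuousOn (q j) (Ioo 0 (l j)))
    (hqb : ∀ j, ∃ M, ∀ x ∈ Ioo 0 (l j), |q j x| ≤ M) (hτ : 0 < τ)
    (hu : IsGeneralizedSolution l q τ f u) (hu' : IsGeneralizedSolution l q τ f u') (j : Fin 4) :
    ∀ᵐ z : ℝ × ℝ, z ∈ Ioo 0 (l j) ×ˢ Ioo 0 τ → u' j z.1 z.2 = u j z.1 z.2 := by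
  have hrm : ∀ j, MeasurableSet (Ioo 0 (l j) ×ˢ Ioo (0 : ℝ) τ) := fun j =>
    measurableSet_Ioo.prod measurableSet_Ioo
  set w : Fin 4 → ℝ → ℝ → ℝ := fun j x t => u' j x t - u j x t with hw
  have hwi : ∀ j, IntegrableOn (fun z : ℝ × ℝ => w j z.1 z.2) (Ioo 0 (l j) ×ˢ Ioo 0 τ) := fun j =>
    (hu'.integrableOn j).sub (hu.integrableOn j)
  set h : Fin 4 → ℝ × ℝ → ℝ := fun j => (Ioo 0 (l j) ×ˢ Ioo 0 τ).indicator
    fun z => -potential l q j z.1 * w j z.1 z.2 with hh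
  have hmem : ∀ j z, h j z ≠ 0 → z ∈ Ioo 0 (l j) ×ˢ Ioo 0 τ := fun j z hz =>
    mem_of_indicator_ne_zero hz
  have hs : IsSource l h := by
    refine ⟨fun j => ?_, fun j z hz => ⟨(hmem j z hz).1, (hmem j z hz).2.1⟩⟩
    rw [hh, integrable_indicator_iff (hrm j)]
    refine ((integrableOn_mul_potential hq hqb j (hwi j)).neg).congr (ae_of_all _ fun z => ?_)
    simp only [Pi.neg_apply]; ring
  obtain ⟨m, hm, hml⟩ : ∃ m > 0, ∀ j, m ≤ l j := by
    obtain ⟨i, hi⟩ := Finite.exists_min l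
    exact ⟨l i, hl i, hi⟩
  obtain ⟨N, hN⟩ := exists_nat_ge (τ / m)
  rw [div_le_iff₀ hm] at hN
  set P := profile kirchhoffCoeff l N (fun _ _ => 0) h with hPdef
  have hP : ∀ d, IsSignal (P d) := IsSignal.profile (fun _ => IsSignal.zero) hs N
  have hP0 : ∀ d, ∀ t ≤ 0, P d t = 0 := fun d t => profile_eq_zero hl (fun _ _ _ => rfl) hs N d
  have hv : ∀ t ∈ Ioo 0 τ, VertexConditions l (fun _ => 0) (cut τ P) h t := fun t ht =>
    (vertexConditions_of_scatter fun d => by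
      simpa using profile_eq hml (fun _ _ _ => rfl) hs N d (ht.2.le.trans hN)).cut hl ht.2
  have hzi : ∀ j, IntegrableOn (fun z : ℝ × ℝ => wave l (cut τ P) h j z.1 z.2)
      (Ioo 0 (l j) ×ˢ Ioo 0 τ) := fun j =>
    (integrableOn_wave hP hP0 hs.integrable j).congr_fun
      (fun z hz => (wave_cut hz.1 hz.2.2.le P h).symm) (hrm j)
  have hwz : ∀ j, ∀ᵐ z : ℝ × ℝ, z ∈ Ioo 0 (l j) ×ˢ Ioo 0 τ →
      w j z.1 z.2 = wave l P h j z.1 z.2 := by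
    have := ae_eq_zero_of_integral_mul_box (τ := τ) hl (fun j => (hwi j).sub (hzi j)) fun φ hφ => ?_
    · intro j
      filter_upwards [this j] with z hz hzm
      rw [← wave_cut hzm.1 hzm.2.2.le P h]
      exact sub_eq_zero.1 (hz hzm)
    · have e := sum_integral_wave_mul_box (P := cut τ P) hl
        (fun d => (hP d).integrable_indicator (hP0 d) τ) (fun d t => cut_of_nonpos hP0 τ d) hs hτ hv hφ
      have e1 := hu.weak φ hφ
      have e2 := hu'.weak φ hφ
      simp only [weak_integral_eq hl hq hqb hτ.le _ (hu.integrableOn _) (hφ.smooth _)] at e1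
      simp only [weak_integral_eq hl hq hqb hτ.le _ (hu'.integrableOn _) (hφ.smooth _)] at e2
      have hb : ∀ j, Continuous (box fun p => φ j p.1 p.2) := fun j => continuous_box (hφ.smooth j)
      have e3 : ∀ j, ∫ z in Ioo 0 (l j) ×ˢ Ioo 0 τ,
          ((fun z : ℝ × ℝ => w j z.1 z.2) - fun z : ℝ × ℝ => wave l (cut τ P) h j z.1 z.2) z
            * box (fun p => φ j p.1 p.2) z
          = ((∫ z in Ioo 0 (l j) ×ˢ Ioo 0 τ, u' j z.1 z.2 * box (fun p => φ j p.1 p.2) z)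
            - ∫ z in Ioo 0 (l j) ×ˢ Ioo 0 τ, u j z.1 z.2 * box (fun p => φ j p.1 p.2) z)
            - ∫ z in Ioo 0 (l j) ×ˢ Ioo 0 τ,
              wave l (cut τ P) h j z.1 z.2 * box (fun p => φ j p.1 p.2) z := fun j => by
        have i1 := integrableOn_mul_of_continuous (hu'.integrableOn j) (hb j)
        have i2 := integrableOn_mul_of_continuous (hu.integrableOn j) (hb j)
        have i3 := integrableOn_mul_of_continuous (hzi j) (hb j)
        have s1 := integral_sub i1 i2
        have s2 := integral_sub (i1.sub i2) i3
        simp only [Pi.sub_apply] at s2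
        rw [← s1, ← s2]
        refine integral_congr_ae (ae_of_all _ fun z => ?_)
        simp only [hw, Pi.sub_apply]; ring
      have e4 : ∀ j, ∫ z in Ioo 0 (l j) ×ˢ Ioo 0 τ, h j z * φ j z.1 z.2
          = (∫ z in Ioo 0 (l j) ×ˢ Ioo 0 τ, u j z.1 z.2 * potential l q j z.1 * φ j z.1 z.2)
            - ∫ z in Ioo 0 (l j) ×ˢ Ioo 0 τ, u' j z.1 z.2 * potential l q j z.1 * φ j z.1 z.2 :=
        fun j => by
          have i1 := integrableOn_mul_of_continuous
            (integrableOn_mul_potential hq hqb j (hu.integrableOn j)) (hφ.smooth j).continuous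
          have i2 := integrableOn_mul_of_continuous
            (integrableOn_mul_potential hq hqb j (hu'.integrableOn j)) (hφ.smooth j).continuous
          rw [← integral_sub i1 i2]
          refine setIntegral_congr_fun (hrm j) fun z hz => ?_
          simp only [hh, indicator_of_mem hz, hw]; ring
      simp only [e3, e4, Finset.sum_sub_distrib] at e ⊢
      rw [e]
      simp only [Finset.sum_add_distrib] at e1 e2
      simp only [zero_mul, integral_zero]
      linarith
  obtain ⟨M, -, hM⟩ := exists_bound_potential hqb
  have hF := isFrame_zero l
  have hPB := enorm_profile_le hF hl kirchhoffCoeff_mem (B := fun _ => 0) monotone_const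
    (ι := fun _ _ => 0) (by simp) h N
  have hh0 : ∀ j, ∀ᵐ z : ℝ × ℝ, z.2 - 0 < τ → h j z = 0 := by
    refine ae_eq_zero_of_le_pastMass hF hl hs.integrable (b := 0)
      (C := ENNReal.ofReal M * (2 * (solveConst N * 8) + 1)) (fun j z hz => ?_)
      (by have := solveConst_ne_top N; finiteness) fun j => ?_
    · exact ⟨(hmem j z hz).1, by linarith [(hmem j z hz).2.1]⟩
    · filter_upwards [hwz j] with z hz hx hT
      by_cases hzm : z ∈ Ioo 0 (l j) ×ˢ Ioo 0 τ
      · simp only [hh, indicator_of_mem hzm]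
        rw [hz hzm, mul_assoc]
        refine (enorm_potential_mul_le hM j _ _).trans ?_
        gcongr
        refine (enorm_wave_le hF (B := fun r => solveConst N * (0 + 8 * pastMass _ h r))
          (fun r s hrs => by dsimp only; gcongr; exact monotone_pastMass _ _ hrs) hPB j
          (Ioo_subset_Icc_self hx) z.2).trans_eq ?_
        rw [zero_add]; ring
      · simp [hh, indicator_of_notMem hzm]
  have hpm : pastMass (fun _ _ => 0) h τ = 0 := by
    refine Finset.sum_eq_zero fun j _ => ?_
    have hm : AEMeasurable (fun p => ‖h j p‖ₑ) := (hs.integrable j).1.enorm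
    refine nonpos_iff_eq_zero.1 ((setLIntegral_le_lintegral _ _).trans_eq ?_)
    rw [lintegral_eq_zero_iff' hm]
    filter_upwards [hh0 j] with z hz
    by_cases hzm : z ∈ Ioo 0 (l j) ×ˢ Ioo 0 τ
    · simp [hz (by linarith [hzm.2.2])]
    · simp [hh, indicator_of_notMem hzm]
  filter_upwards [hwz j] with z hz hzm
  have h1 := enorm_wave_le (h := h) hF (B := fun r => solveConst N * (0 + 8 * pastMass _ h r))
    (fun r s hrs => by dsimp only; gcongr; exact monotone_pastMass _ _ hrs) hPB j
    (Ioo_subset_Icc_self hzm.1) z.2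
  have h2 : pastMass (fun _ _ => 0) h (z.2 - 0) = 0 :=
    nonpos_iff_eq_zero.1 ((monotone_pastMass _ h (by linarith [hzm.2.2])).trans_eq hpm)
  rw [h2] at h1
  simp only [add_zero, mul_zero, nonpos_iff_eq_zero, enorm_eq_zero] at h1
  exact sub_eq_zero.1 ((hz hzm).trans h1)

/-- Uniqueness of generalized solutions. -/
theorem IsGeneralizedSolution.ae_eq (hl : ∀ j, 0 < l j)
    (hq : ∀ j, ContinuousOn (q j) (Ioo 0 (l j)))
    (hqb : ∀ j, ∃ M, ∀ x ∈ Ioo 0 (l j), |q j x| ≤ M) (hτ : 0 < τ)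
    (hu : IsGeneralizedSolution l q τ f u) (hu' : IsGeneralizedSolution l q τ f u') (j : Fin 4)
    {t₀ : ℝ} (ht₀ : t₀ ∈ Icc 0 τ) :
    (fun x => u' j x t₀) =ᵐ[volume.restrict (Ioo 0 (l j))] fun x => u j x t₀ := by
  have h1 := IsGeneralizedSolution.ae_eq_prod hl hq hqb hτ hu hu' j
  rw [Measure.volume_eq_prod] at h1
  have h2 : ∀ᵐ t : ℝ, ∀ᵐ x : ℝ, (x, t) ∈ Ioo 0 (l j) ×ˢ Ioo 0 τ → u' j x t = u j x t :=
    Measure.ae_ae_of_ae_prod (Measure.measurePreserving_swap.quasiMeasurePreserving.ae h1)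
  set S := {t : ℝ | ∀ᵐ x : ℝ, (x, t) ∈ Ioo 0 (l j) ×ˢ Ioo 0 τ → u' j x t = u j x t}
  -- Equality is known for almost every time. Such times are dense, and continuity in L² carries it
  -- to every t₀, including 0 and τ.
  have hS : t₀ ∈ closure (Ioo 0 τ ∩ S) := by
    rw [← closure_Ioo hτ.ne] at ht₀
    exact closure_minimal ((Measure.dense_of_ae h2).open_subset_closure_inter isOpen_Ioo)
      isClosed_closure ht₀
  have hne := mem_closure_iff_nhdsWithin_neBot.1 hS
  have hle : 𝓝[Ioo 0 τ ∩ S] t₀ ≤ 𝓝[Icc 0 τ] t₀ :=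
    nhdsWithin_mono _ (inter_subset_left.trans Ioo_subset_Icc_self)
  have m := (hu.memLp j t₀ ht₀).1
  have m' := (hu'.memLp j t₀ ht₀).1
  have hlim := ((hu'.continuous j t₀ ht₀).mono_left hle).add ((hu.continuous j t₀ ht₀).mono_left hle)
  rw [add_zero] at hlim
  have hc : eLpNorm ((fun x => u' j x t₀) - fun x => u j x t₀) 2 (volume.restrict (Ioo 0 (l j))) ≤ 0 := by
    refine ge_of_tendsto hlim ?_
    filter_upwards [self_mem_nhdsWithin] with t ht
    have n := (hu.memLp j t (Ioo_subset_Icc_self ht.1)).1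
    have n' := (hu'.memLp j t (Ioo_subset_Icc_self ht.1)).1
    have hae : ((fun x => u' j x t₀) - fun x => u j x t₀) =ᵐ[volume.restrict (Ioo 0 (l j))]
        (fun x => u j x t - u j x t₀) - (fun x => u' j x t - u' j x t₀) := by
      have hx := ht.2
      filter_upwards [ae_restrict_of_ae hx, ae_restrict_mem measurableSet_Ioo] with x hx hxm
      simp only [Pi.sub_apply, hx ⟨hxm, ht.1⟩]; ring
    rw [eLpNorm_congr_ae hae, add_comm]
    exact eLpNorm_sub_le (n.sub m) (n'.sub m') (by norm_num)
  have h3 := (eLpNorm_eq_zero_iff (m'.sub m) (by norm_num)).1 (nonpos_iff_eq_zero.1 hc)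
  filter_upwards [h3] with x hx
  exact sub_eq_zero.1 hx

end

/-- The trace only depends on the generalized solution up to null sets. -/
theorem IsTraceAtV₂.ae_eq {l : Fin 4 → ℝ} (hl : 0 < l 0) {τ : ℝ} {u u' : Fin 4 → ℝ → ℝ → ℝ}
    {o o' : ℝ → ℝ}
    (hm : AEStronglyMeasurable (fun p : ℝ × ℝ => u 0 p.1 p.2)
      (volume.restrict (Ioo 0 (l 0) ×ˢ Ioo 0 τ)))
    (hae : ∀ᵐ z : ℝ × ℝ, z ∈ Ioo 0 (l 0) ×ˢ Ioo 0 τ → u' 0 z.1 z.2 = u 0 z.1 z.2)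
    (ho : IsTraceAtV₂ τ u o) (ho' : IsTraceAtV₂ τ u' o') :
    o' =ᵐ[volume.restrict (Ioo 0 τ)] o := by
  rw [Measure.volume_eq_prod, ← Measure.prod_restrict] at hm
  rw [Measure.volume_eq_prod] at hae
  have h1 : ∀ᵐ x : ℝ, x ∈ Ioo 0 (l 0) → AEStronglyMeasurable (fun t => u 0 x t)
      (volume.restrict (Ioo 0 τ)) := by
    rw [← ae_restrict_iff' measurableSet_Ioo]
    exact hm.prodMk_left
  have h2 := Measure.ae_ae_of_ae_prod hae
  -- Limits along this filter are informative because every conull set is dense and so meets every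
  -- right neighbourhood of 0.
  have hne : (𝓝[>] (0 : ℝ) ⊓ ae volume).NeBot := by
    rw [inf_neBot_iff]
    intro s hs s' hs'
    obtain ⟨ε, hε, hsub⟩ := mem_nhdsGT_iff_exists_Ioo_subset.1 hs
    have hd : Dense s' := Measure.dense_of_ae (p := fun x => x ∈ s') hs'
    obtain ⟨x, hx, hx'⟩ := hd.exists_mem_open isOpen_Ioo (nonempty_Ioo.2 hε)
    exact ⟨x, hsub hx', hx⟩
  have hlim := (ho.2 0 (by simp)).add (ho'.2 0 (by simp))
  rw [add_zero] at hlim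
  have hc : eLpNorm (o' - o) 2 (volume.restrict (Ioo 0 τ)) ≤ 0 := by
    refine ge_of_tendsto hlim ?_
    have e1 : ∀ᶠ x in 𝓝[>] (0 : ℝ) ⊓ ae volume, x ∈ Ioo 0 (l 0) :=
      mem_inf_of_left (Ioo_mem_nhdsGT hl)
    filter_upwards [e1, h1.filter_mono inf_le_right, h2.filter_mono inf_le_right] with x hx hx1 hx2
    have hx2' : ∀ᵐ t ∂volume.restrict (Ioo 0 τ), u' 0 x t = u 0 x t := by
      filter_upwards [ae_restrict_of_ae hx2, ae_restrict_mem measurableSet_Ioo] with t ht htm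
      exact ht ⟨hx, htm⟩
    have hae : (o' - o) =ᵐ[volume.restrict (Ioo 0 τ)]
        (fun t => u 0 x t - o t) - fun t => u' 0 x t - o' t := by
      filter_upwards [hx2'] with t ht
      simp only [Pi.sub_apply, ht]; ring
    rw [eLpNorm_congr_ae hae]
    exact eLpNorm_sub_le ((hx1 hx).sub ho.1.1)
      (((hx1 hx).congr (hx2'.mono fun t ht => ht.symm)).sub ho'.1.1) (by norm_num)
  have h3 := (eLpNorm_eq_zero_iff (ho'.1.1.sub ho.1.1) (by norm_num)).1 (nonpos_iff_eq_zero.1 hc)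
  filter_upwards [h3] with x hx
  exact sub_eq_zero.1 hx

/-! ### Prescribing the trace -/

/-- The coefficients for Dirichlet conditions at `v₂` and the Kirchhoff condition at `v₃`. -/
noncomputable def ringCoeff : Fin 4 → ℝ := ![0, 0, 2 / 3, 0]

lemma ringCoeff_mem (v : Fin 4) : ringCoeff v ∈ Icc (0 : ℝ) 1 := by
  fin_cases v <;> simp [ringCoeff]
  norm_num

/-- The Dirichlet data `o` at `v₂` for the edges `e₂` and `e₃`. -/
noncomputable def ringData (o : ℝ → ℝ) (d : Fin 4 × Bool) (t : ℝ) : ℝ :=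
  if d = (1, false) ∨ d = (2, false) then o t else 0

/-- The profiles on the ring and on `e₄` when the values at `v₂` are `o`. -/
noncomputable def ringProfile (l : Fin 4 → ℝ) (N : ℕ) (o : ℝ → ℝ) (h : Fin 4 → ℝ × ℝ → ℝ) :
    Fin 4 × Bool → ℝ → ℝ := profile ringCoeff l N (ringData o) h

/-- The profiles of the waves which have the trace `o` at `v₂`. On `e₁` they are found from the
Cauchy data at `v₂`. -/
noncomputable def control (l : Fin 4 → ℝ) (N : ℕ) (o : ℝ → ℝ) (h : Fin 4 → ℝ × ℝ → ℝ)
    (d : Fin 4 × Bool) (t : ℝ) : ℝ :=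
  if d = (0, true) then
    3 / 2 * o (t + l 0) - incoming l (ringProfile l N o h) h (1, true) (t + l 0)
      - incoming l (ringProfile l N o h) h (2, true) (t + l 0) - duhamel (h 0) 0 (t + l 0)
  else if d = (0, false) then
    -(1 / 2) * o t + incoming l (ringProfile l N o h) h (1, true) t
      + incoming l (ringProfile l N o h) h (2, true) t
  else ringProfile l N o h d t

section
variable {l : Fin 4 → ℝ} {q : Fin 4 → ℝ → ℝ} {N : ℕ} {o : ℝ → ℝ} {h : Fin 4 → ℝ × ℝ → ℝ}

lemma incoming_control {d : Fin 4 × Bool} (hd : d.1 ≠ 0) (t : ℝ) :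
    incoming l (control l N o h) h d t = incoming l (ringProfile l N o h) h d t := by
  have h1 : d ≠ (0, true) := fun e => hd (by rw [e])
  have h2 : d ≠ (0, false) := fun e => hd (by rw [e])
  simp only [incoming, control, h1, h2, if_false]

/-- The coefficients 3/2 and -1/2 in `control` arise as follows. Write P for departing and I for
arriving waves at v₂. The value o gives P = o - I on all three edges, and inserting this for e₂ and
e₃ in the Kirchhoff sum yields P₁ = -o/2 + I₂ + I₃. Hence I₁ = 3o/2 - I₂ - I₃, whose free part left
v₁ a time l 0 earlier. -/
lemma control_add_incoming (t : ℝ) :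
    control l N o h (0, false) t + incoming l (control l N o h) h (0, true) t = o t := by
  simp only [incoming, control, endpoint, if_true, sub_add_cancel, Prod.mk.injEq, true_and,
    Bool.false_eq_true, if_false]
  ring

/-- The value at v₁ is not prescribed: whatever the waves produce there is declared to be the data.
The conditions at v₃ and v₄ and the value o on the ring edges come from scattering with `ringCoeff`,
those involving e₁ at v₂ from the choice of `control`. -/
lemma vertexConditions_control {m : ℝ} (hm : ∀ j, m ≤ l j) (hh : IsSource l h)
    (ho : ∀ t ≤ 0, o t = 0) {t : ℝ} (ht : t ≤ N * m) :
    VertexConditions l (fun t => control l N o h (0, true) t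
      + incoming l (control l N o h) h (0, false) t) (control l N o h) h t := by
  have e : ∀ d, ringProfile l N o h d t = ringData o d t
      + ∑ d', scatter ringCoeff d d' * incoming l (ringProfile l N o h) h d' t := fun d =>
    profile_eq hm (fun d t ht => by simp [ringData, ho t ht]) hh N d ht
  have hc := control_add_incoming (l := l) (N := N) (o := o) (h := h) t
  simp only [Fintype.sum_prod_type, Fin.sum_univ_four, Fintype.sum_bool, scatter, tail, rev,
    ringCoeff, ringData] at e
  have e1f := e (1, false)
  have e1t := e (1, true)
  have e2f := e (2, false)
  have e2t := e (2, true)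
  have e3f := e (3, false)
  have e3t := e (3, true)
  clear e
  have c0 : control l N o h (0, false) t = -(1 / 2) * o t
      + incoming l (ringProfile l N o h) h (1, true) t
      + incoming l (ringProfile l N o h) h (2, true) t := by simp [control]
  have c : ∀ d : Fin 4 × Bool, d.1 ≠ 0 → control l N o h d t = ringProfile l N o h d t :=
    fun d hd => by
      have h1 : d ≠ (0, true) := fun e => hd (by rw [e])
      have h2 : d ≠ (0, false) := fun e => hd (by rw [e])
      simp only [control, h1, h2, if_false]
  rw [c0] at hc
  simp at e1f e1t e2f e2t e3f e3t
  constructor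
  · rfl
  all_goals
    simp only [c0, c, incoming_control, ne_eq, one_ne_zero, Fin.reduceEq, not_false_eq_true]
    linarith

end

section
variable {l : Fin 4 → ℝ} {q : Fin 4 → ℝ → ℝ} {N : ℕ} {o : ℝ → ℝ} {h : Fin 4 → ℝ × ℝ → ℝ}

lemma isSignal_ringData (ho : IsSignal o) (d : Fin 4 × Bool) : IsSignal (ringData o d) := by
  unfold ringData; split_ifs
  exacts [ho, IsSignal.zero]

lemma measurable_control (ho : IsSignal o) (hh : ∀ j, Integrable (h j)) (d : Fin 4 × Bool) :
    Measurable (control l N o h d) := by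
  have hQ := measurable_profile (c := ringCoeff) (l := l) (fun d => (isSignal_ringData ho d).1) hh N
  have hD : ∀ j x, Measurable fun t => duhamel (h j) x t := fun j x =>
    ((continuous_duhamel (hh j)).comp (by fun_prop : Continuous fun t : ℝ => (x, t))).measurable
  have hI : ∀ d, Measurable (incoming l (ringProfile l N o h) h d) := fun d =>
    ((hQ d).comp (by fun_prop)).add (hD _ _)
  have hs : Measurable fun t : ℝ => t + l 0 := by fun_prop
  unfold control; split_ifs
  · exact ((((ho.1.comp hs).const_mul _).sub ((hI _).comp hs)).sub ((hI _).comp hs)).sub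
      ((hD _ _).comp hs)
  · exact ((ho.1.const_mul _).add (hI _)).add (hI _)
  · exact hQ d

lemma isSignal_control (ho : IsSignal o) (hh : IsSource l h) (d : Fin 4 × Bool) :
    IsSignal (control l N o h d) := by
  have hQ : ∀ d, IsSignal (ringProfile l N o h d) :=
    IsSignal.profile (isSignal_ringData ho) hh N
  have hI := IsSignal.incoming hQ hh
  have hs : ∀ {g : ℝ → ℝ}, IsSignal g → IsSignal fun t => g (t + l 0) := fun hg => by
    simpa using hg.translate (-l 0)
  have hsub : ∀ {f g : ℝ → ℝ}, IsSignal f → IsSignal g → IsSignal fun t => f t - g t :=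
    fun hf hg => by simpa [sub_eq_add_neg] using hf.add (hg.const_mul (-1))
  unfold control; split_ifs
  · exact hsub (hsub (hsub ((hs ho).const_mul _) (hs (hI _))) (hs (hI _)))
      (hs (IsSignal.duhamel hh 0 0))
  · exact ((ho.const_mul _).add (hI _)).add (hI _)
  · exact hQ d

lemma control_sub (o' : ℝ → ℝ) {h' : Fin 4 → ℝ × ℝ → ℝ} (hh : ∀ j, Integrable (h j))
    (hh' : ∀ j, Integrable (h' j)) (d : Fin 4 × Bool) (t : ℝ) :
    control l N (fun t => o t - o' t) (fun j p => h j p - h' j p) d t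
      = control l N o h d t - control l N o' h' d t := by
  have hQ : ringProfile l N (fun t => o t - o' t) (fun j p => h j p - h' j p)
      = fun d t => ringProfile l N o h d t - ringProfile l N o' h' d t := by
    ext d t
    refine (congrFun (congrFun (congrArg (fun ι => profile ringCoeff l N ι _) ?_) d) t).trans
      (profile_sub N (ringData o) (ringData o') hh hh' d t)
    ext d t
    simp only [ringData]; split_ifs <;> simp
  simp only [control, hQ, incoming_sub _ _ hh hh', duhamel_sub (hh _) (hh' _)]
  split_ifs <;> ring

/-- The profile leaving v₁ looks ahead to time t + l 0 at v₂, but both events have the same frame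
time, so `control` is causal in the frame `delay`. The constant adds 2 for the multiple 3/2 of o,
`solveConst N` + 1 for each of the two arriving waves, and 1 for the Duhamel integral on e₁. -/
lemma enorm_control_le (hl : ∀ j, 0 < l j) {B : ℝ → ENNReal} (hB : Monotone B)
    (ho : ∀ t, ‖o t‖ₑ ≤ B (t - l 0)) (h : Fin 4 → ℝ × ℝ → ℝ) (d : Fin 4 × Bool) (t : ℝ) :
    ‖control l N o h d t‖ₑ ≤ (2 * solveConst N + 5)
      * (B (t - vertexDelay l (tail d)) + 8 * pastMass (delay l) h (t - vertexDelay l (tail d))) := by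
  have hF := isFrame_delay l
  set E : ℝ → ENNReal := fun r => B r + 8 * pastMass (delay l) h r with hE
  have hEm : Monotone E := fun r s hrs => by
    simp only [hE]; gcongr; exacts [hB hrs, monotone_pastMass _ _ hrs]
  have hι : ∀ d t, ‖ringData o d t‖ₑ ≤ B (t - vertexDelay l (tail d)) := fun d t => by
    by_cases hd : d = (1, false) ∨ d = (2, false)
    · rw [ringData, if_pos hd]
      rcases hd with rfl | rfl <;> simpa [tail, vertexDelay] using ho t
    · simp [ringData, hd]
  have hQ : ∀ d t, ‖ringProfile l N o h d t‖ₑ ≤ solveConst N * E (t - vertexDelay l (tail d)) :=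
    enorm_profile_le hF hl ringCoeff_mem hB hι h N
  have hpE : ∀ r, pastMass (delay l) h r ≤ E r := fun r =>
    (le_mul_of_one_le_left' (by norm_num)).trans le_add_self
  have hoE : ∀ t, ‖o t‖ₑ ≤ E (t - l 0) := fun t => (ho t).trans le_self_add
  have hI : ∀ j : Fin 4, j ≠ 0 → j ≠ 3 → ∀ t,
      ‖incoming l (ringProfile l N o h) h (j, true) t‖ₑ ≤ (solveConst N + 1) * E (t - l 0) := by
    intro j hj hj' t
    have h1 := enorm_incoming_le (h := h) hF hl (B := fun r => solveConst N * E r)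
      (fun r s hrs => by dsimp only; gcongr; exact hEm hrs) hQ (j, true) t
    have hV : vertexDelay l (tail (rev (j, true))) = l 0 := by
      fin_cases j <;> simp [vertexDelay, tail, rev] at hj hj' ⊢
    rw [hV] at h1
    rw [add_mul, one_mul]
    exact h1.trans (by gcongr; exact hpE _)
  have habs : ∀ (a x : ℝ) (K : ENNReal), ‖x‖ₑ ≤ K → |a| ≤ 2 → ‖a * x‖ₑ ≤ 2 * K := fun a x K hx ha => by
    rw [enorm_mul]
    gcongr
    rw [← ofReal_norm, ← ENNReal.ofReal_ofNat]
    exact ENNReal.ofReal_le_ofReal ha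
  unfold control; split_ifs with h1 h2
  · subst h1
    have hV : vertexDelay l (tail (0, true)) = 0 := by simp [vertexDelay, tail]
    have hD := enorm_duhamel_le_pastMass hF h 0 0 (t + l 0)
    have e0 : delay l 0 0 = l 0 := by simp [delay]
    have a1 := habs (3 / 2) _ _ (hoE (t + l 0)) (by rw [abs_of_pos] <;> norm_num)
    have a2 := hI 1 (by decide) (by decide) (t + l 0)
    have a3 := hI 2 (by decide) (by decide) (t + l 0)
    rw [e0] at hD
    rw [add_sub_cancel_right] at hD a1 a2 a3
    rw [hV, sub_zero]
    refine enorm_sub_le.trans ((add_le_add (enorm_sub_le.trans (add_le_add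
      (enorm_sub_le.trans (add_le_add a1 a2)) a3)) (hD.trans (hpE t))).trans_eq ?_)
    change _ = _ * E t
    ring
  · subst h2
    have hV : vertexDelay l (tail (0, false)) = l 0 := by simp [vertexDelay, tail]
    have a1 := habs (-(1 / 2)) _ _ (hoE t) (by rw [abs_neg, abs_of_pos] <;> norm_num)
    have a2 := hI 1 (by decide) (by decide) t
    have a3 := hI 2 (by decide) (by decide) t
    rw [hV]
    refine (enorm_add_le _ _).trans ((add_le_add ((enorm_add_le _ _).trans (add_le_add a1 a2))
      a3).trans ?_)
    change _ ≤ _ * E (t - l 0)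
    calc _ = (2 * solveConst N + 4) * E (t - l 0) := by ring
      _ ≤ _ := by gcongr; norm_num
  · refine (hQ d t).trans ?_
    change _ * E _ ≤ _ * E _
    gcongr
    calc solveConst N ≤ 2 * solveConst N := le_mul_of_one_le_left' (by norm_num)
      _ ≤ _ := le_self_add

lemma pastMass_eq_zero {δ : Fin 4 → ℝ → ℝ} {r : ℝ}
    (hm : ∀ k, MeasurableSet {p : ℝ × ℝ | p.2 - δ k p.1 ≤ r})
    (h0 : ∀ k p, p.2 - δ k p.1 ≤ r → h k p = 0) : pastMass δ h r = 0 := by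
  refine Finset.sum_eq_zero fun k _ => ?_
  rw [setLIntegral_congr_fun (hm k) (g := fun _ => 0) fun p hp => by simp [h0 k p hp],
    lintegral_zero]

/-- Every signal starting at the time `l 0` is the trace at `v₂` of a generalized solution. -/
theorem exists_isTraceAtV₂ (hl : ∀ j, 0 < l j) (hq : ∀ j, ContinuousOn (q j) (Ioo 0 (l j)))
    (hqb : ∀ j, ∃ M, ∀ x ∈ Ioo 0 (l j), |q j x| ≤ M) {τ : ℝ} (hτ : 0 < τ) (ho : IsSignal o)
    (ho0 : ∀ t ≤ l 0, o t = 0) :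
    ∃ f u, MemLp f 2 (volume.restrict (Ioo 0 τ)) ∧ IsGeneralizedSolution l q τ f u ∧
      IsTraceAtV₂ τ u o := by
  have hF := isFrame_delay l
  obtain ⟨m, hm, hml⟩ : ∃ m > 0, ∀ j, m ≤ l j := by
    obtain ⟨i, hi⟩ := Finite.exists_min l
    exact ⟨l i, hl i, hi⟩
  obtain ⟨N, hN⟩ := exists_nat_ge (τ / m)
  rw [div_le_iff₀ hm] at hN
  have hS := solveConst_ne_top N
  -- Expresses as a bound that o vanishes up to l 0, that is, up to the frame time 0 at v₂.
  set B : ℝ → ENNReal := fun r => if r ≤ 0 then 0 else ⊤ with hB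
  have hBm : Monotone B := fun r s hrs => by
    by_cases hs : s ≤ 0
    · simp [hB, hs, hrs.trans hs]
    · simp [hB, hs]
  have hoB : ∀ t, ‖o t‖ₑ ≤ B (t - l 0) := fun t => by
    by_cases ht : t ≤ l 0
    · simp [ho0 t ht]
    · simp [hB, ht]
  have hmt : ∀ r k, MeasurableSet {p : ℝ × ℝ | p.2 - delay l k p.1 ≤ r} := fun r k =>
    measurableSet_le (hF.measurable_time k) measurable_const
  -- This secures the initial conditions: the profile at v₁ anticipates o by l 0, which the
  -- vanishing of o up to l 0 compensates.
  have hvanish : ∀ h : Fin 4 → ℝ × ℝ → ℝ, (∀ r ≤ 0, pastMass (delay l) h r = 0) →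
      ∀ d, ∀ t ≤ 0, control l N o h d t = 0 := fun h hh d t ht => by
    have hV : 0 ≤ vertexDelay l (tail d) := by
      generalize tail d = v
      fin_cases v <;> simp [vertexDelay, (hl 0).le]
    have hr : t - vertexDelay l (tail d) ≤ 0 := by linarith
    have := enorm_control_le (N := N) hl hBm hoB h d t
    rw [hh _ hr] at this
    simpa only [hB, hr, if_true, mul_zero, add_zero, nonpos_iff_eq_zero, enorm_eq_zero] using this
  have h0 : IsSource l fun _ _ => 0 := ⟨fun _ => integrable_zero _ _ _, fun _ _ h => absurd rfl h⟩
  -- Offsets are at most l 0, so frame times below τ are ordinary times below τ + l 0.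
  obtain ⟨h, h1, h2, h3⟩ := exists_mild_source hF hl hq hqb (T := τ) (b := τ + l 0)
    (fun j p hp => ⟨hp.1, by linarith [hp.2.1, delay_pos hl hp.1],
      by linarith [hp.2.2, delay_le hp.1]⟩) (R := fun h => control l N o h)
    (C := (2 * solveConst N + 5) * 8) (by finiteness) (fun h hh d => measurable_control ho hh d)
    (fun d => isSignal_control ho h0 d)
    (hvanish _ fun r _ => pastMass_eq_zero (hmt r) fun _ _ _ => rfl) fun h h' hh hh' d t => by
      rw [← control_sub o hh hh', mul_assoc]
      refine (enorm_control_le hl (B := fun _ => 0) monotone_const (by simp) _ d t).trans_eq ?_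
      rw [zero_add]
  have hs : IsSource l h := isSource_of_slab (fun j x hx => (delay_pos hl hx).le) h1 h2
  have hpm : ∀ r ≤ 0, pastMass (delay l) h r = 0 := fun r hr =>
    pastMass_eq_zero (hmt r) fun k p hp => h2 k p fun hmem => by linarith [hmem.2.1]
  have hP := fun d => isSignal_control (N := N) ho hs d
  have hv : ∀ t ∈ Ioo 0 τ, VertexConditions l _ (control l N o h) h t := fun t ht =>
    vertexConditions_control hml hs (fun t ht => ho0 t (ht.trans (hl 0).le)) (ht.2.le.trans hN)
  refine ⟨_, _, (((hP (0, true)).add (IsSignal.incoming hP hs (0, false))).2 τ).mono_measure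
    (Measure.restrict_mono Ioo_subset_Iio_self le_rfl),
    isGeneralizedSolution_wave hl hq hqb hP (hvanish h hpm) hs hτ hv fun j => ?_, ?_⟩
  · filter_upwards [h3 j] with p hp hpm'
    by_cases hmem : p ∈ slab l (delay l) τ j
    · exact hp hmem
    -- Offsets are positive inside the edges, so a point of the rectangle outside the slab has frame
    -- time at most 0. There the wave vanishes, and so does the source.
    · have hr : p.2 - delay l j p.1 ≤ 0 := by
        by_contra hr
        exact hmem ⟨hpm'.1, not_le.1 hr, by linarith [delay_pos hl hpm'.1, hpm'.2.2]⟩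
      have hw := enorm_wave_le hF (h := h)
        (B := fun r => (2 * solveConst N + 5) * (B r + 8 * pastMass (delay l) h r))
        (fun r s hrs => by dsimp only; gcongr; exacts [hBm hrs, monotone_pastMass _ _ hrs])
        (enorm_control_le (N := N) hl hBm hoB h) j (Ioo_subset_Icc_self hpm'.1) p.2
      rw [hpm _ hr] at hw
      simp only [hB, hr, if_true, mul_zero, add_zero, nonpos_iff_eq_zero, enorm_eq_zero] at hw
      rw [h2 j p hmem, hw, mul_zero]
  · have := isTraceAtV₂_wave hl hP hs hv
    simpa only [control_add_incoming] using this

end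

/-! ### The trace operator -/

lemma IsGeneralizedSolution.congr {l : Fin 4 → ℝ} {q : Fin 4 → ℝ → ℝ} {τ : ℝ} (hτ : 0 ≤ τ)
    {f f' : ℝ → ℝ} {u : Fin 4 → ℝ → ℝ → ℝ} (hu : IsGeneralizedSolution l q τ f u)
    (hf : f =ᵐ[volume.restrict (Ioo 0 τ)] f') : IsGeneralizedSolution l q τ f' u := by
  refine ⟨hu.1, hu.2, hu.3, fun φ hφ => (hu.weak φ hφ).trans ?_⟩
  simp only [intervalIntegral.integral_of_le hτ, integral_Ioc_eq_integral_Ioo]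
  refine integral_congr_ae ?_
  filter_upwards [hf] with t ht
  rw [ht]

lemma exists_isSignal {a b : ℝ} {F : ℝ → ℝ} (hF : MemLp F 2 (volume.restrict (Ioo a b))) :
    ∃ f, IsSignal f ∧ (∀ t ∉ Ioo a b, f t = 0) ∧ f =ᵐ[volume.restrict (Ioo a b)] F := by
  obtain ⟨g, hg, hFg⟩ := hF.1
  refine ⟨(Ioo a b).indicator g, ⟨hg.measurable.indicator measurableSet_Ioo, fun c => ?_⟩,
    fun t ht => indicator_of_notMem ht _, ?_⟩
  · exact ((memLp_indicator_iff_restrict measurableSet_Ioo).2 (hF.ae_eq hFg)).restrict _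
  · filter_upwards [hFg, ae_restrict_mem measurableSet_Ioo] with t ht hm
    rw [indicator_of_mem hm, ht]

end RingGraph

/-! ### Well-posedness and surjectivity of the trace map -/

theorem mainTheorem3
    (l : Fin 4 → ℝ) (hl : ∀ j, 0 < l j)
    (q : Fin 4 → ℝ → ℝ) (hq_cont : ∀ j, ContinuousOn (q j) (Ioo 0 (l j)))
    (hq_bdd : ∀ j, ∃ M, ∀ x ∈ Ioo 0 (l j), |q j x| ≤ M)
    (T : ℝ) (hT : 0 < T) :
    ∃ A : Lp ℝ 2 (volume.restrict (Ioo 0 T)) →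
        Lp ℝ 2 (volume.restrict (Ioo (l RingGraph.e₁) (T + l RingGraph.e₁))),
      (∀ (f : Lp ℝ 2 (volume.restrict (Ioo 0 T))) (F : ℝ → ℝ),
        MemLp F 2 (volume.restrict (Ioo 0 (T + l RingGraph.e₁))) →
        F =ᵐ[volume.restrict (Ioo 0 T)] f →
        ∃ (u : Fin 4 → ℝ → ℝ → ℝ) (o : ℝ → ℝ),
          RingGraph.IsGeneralizedSolution l q (T + l RingGraph.e₁) F u ∧
          (∀ u', RingGraph.IsGeneralizedSolution l q (T + l RingGraph.e₁) F u' →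
            ∀ j, ∀ t ∈ Icc 0 (T + l RingGraph.e₁),
              (fun x => u' j x t) =ᵐ[volume.restrict (Ioo 0 (l j))] fun x => u j x t) ∧
          RingGraph.IsTraceAtV₂ (T + l RingGraph.e₁) u o ∧
          o =ᵐ[volume.restrict (Ioo (l RingGraph.e₁) (T + l RingGraph.e₁))] A f) ∧
      Function.Surjective A := by
  have hl0 : 0 < l 0 := hl 0
  have hτ : 0 < T + l 0 := by linarith
  obtain ⟨m, hm, hml⟩ : ∃ m > 0, ∀ j, m ≤ l j := by
    obtain ⟨i, hi⟩ := Finite.exists_min l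
    exact ⟨l i, hl i, hi⟩
  obtain ⟨N, hN⟩ := exists_nat_ge ((T + l 0) / m)
  rw [div_le_iff₀ hm] at hN
  -- The operator is defined through one particular extension, a representative of f continued by
  -- zero.
  have key : ∀ f : Lp ℝ 2 (volume.restrict (Ioo 0 T)), ∃ (g : ℝ → ℝ) (h : Fin 4 → ℝ × ℝ → ℝ),
      RingGraph.IsSignal g ∧ (∀ t ∉ Ioo 0 T, g t = 0) ∧ g =ᵐ[volume.restrict (Ioo 0 T)] f ∧
      RingGraph.IsMildSource l q (T + l 0) N g h := fun f => by
    obtain ⟨g, hg, hg0, hgf⟩ := RingGraph.exists_isSignal (Lp.memLp f)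
    obtain ⟨h, hh⟩ := RingGraph.exists_isMildSource hl hq_cont hq_bdd (T + l 0) N hg
      fun t ht => hg0 t fun hm => absurd hm.1 (not_lt.2 ht)
    exact ⟨g, h, hg, hg0, hgf, hh⟩
  choose g h hg hg0 hgf hh using key
  have hA : ∀ f, MemLp (RingGraph.mildTrace l N (g f) (h f)) 2
      (volume.restrict (Ioo (l 0) (T + l 0))) := fun f => by
    obtain ⟨u, -, hu⟩ := (hh f).exists_isGeneralizedSolution hl hq_cont hq_bdd hml hτ hN (hg f)
      fun t ht => hg0 f t fun hm => absurd hm.1 (not_lt.2 ht)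
    exact hu.1.mono_measure (Measure.restrict_mono (Ioo_subset_Ioo_left hl0.le) le_rfl)
  have main : ∀ (f : Lp ℝ 2 (volume.restrict (Ioo 0 T))) (F : ℝ → ℝ),
        MemLp F 2 (volume.restrict (Ioo 0 (T + l RingGraph.e₁))) →
        F =ᵐ[volume.restrict (Ioo 0 T)] f →
        ∃ (u : Fin 4 → ℝ → ℝ → ℝ) (o : ℝ → ℝ),
          RingGraph.IsGeneralizedSolution l q (T + l RingGraph.e₁) F u ∧
          (∀ u', RingGraph.IsGeneralizedSolution l q (T + l RingGraph.e₁) F u' →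
            ∀ j, ∀ t ∈ Icc 0 (T + l RingGraph.e₁),
              (fun x => u' j x t) =ᵐ[volume.restrict (Ioo 0 (l j))] fun x => u j x t) ∧
          RingGraph.IsTraceAtV₂ (T + l RingGraph.e₁) u o ∧
          o =ᵐ[volume.restrict (Ioo (l RingGraph.e₁) (T + l RingGraph.e₁))]
            MemLp.toLp _ (hA f) := by
    intro f F hF hFf
    obtain ⟨F₁, hF₁, hF₁0, hF₁F⟩ := RingGraph.exists_isSignal hF
    -- `mildTrace_eq` compares data that agree at every time before T, not just almost everywhere.
    -- So F is replaced by a representative which coincides with the chosen `g f` there.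
    set F₂ : ℝ → ℝ := fun t => if t < T then g f t else F₁ t with hF₂
    have hF₂e : F₂ = fun t => (Iio T).indicator (g f) t + (Iio T)ᶜ.indicator F₁ t := by
      ext t
      by_cases ht : t < T <;> simp [hF₂, ht, indicator]
    have hF₂s : RingGraph.IsSignal F₂ := by
      rw [hF₂e]
      refine RingGraph.IsSignal.add ⟨(hg f).1.indicator measurableSet_Iio, fun b =>
        ((hg f).2 b).indicator measurableSet_Iio⟩ ⟨hF₁.1.indicator measurableSet_Iio.compl, fun b =>
        (hF₁.2 b).indicator measurableSet_Iio.compl⟩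
    have hF₂0 : ∀ t ≤ 0, F₂ t = 0 := fun t ht => by
      simp only [hF₂, ht.trans_lt hT, if_true]
      exact hg0 f t fun hm => absurd hm.1 (not_lt.2 ht)
    have hF₂F : F₂ =ᵐ[volume.restrict (Ioo 0 (T + l 0))] F := by
      have h1 := (ae_restrict_iff' measurableSet_Ioo).1 ((hgf f).trans hFf.symm)
      filter_upwards [hF₁F, ae_restrict_of_ae h1, ae_restrict_mem measurableSet_Ioo] with t ht ht1 htm
      by_cases htT : t < T
      · simp only [hF₂, htT, if_true, ht1 ⟨htm.1, htT⟩]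
      · simp only [hF₂, htT, if_false, ht]
    obtain ⟨h₂, hh₂⟩ := RingGraph.exists_isMildSource hl hq_cont hq_bdd (T + l 0) N hF₂s hF₂0
    obtain ⟨u, hu, huo⟩ :=
      hh₂.exists_isGeneralizedSolution hl hq_cont hq_bdd hml hτ hN hF₂s hF₂0
    have hu' := hu.congr hτ.le hF₂F
    refine ⟨u, _, hu', fun u' hv j t ht => hu'.ae_eq hl hq_cont hq_bdd hτ hv j ht, huo, ?_⟩
    filter_upwards [MemLp.coeFn_toLp (hA f), ae_restrict_mem measurableSet_Ioo] with t ht htm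
    rw [ht]
    exact RingGraph.mildTrace_eq hh₂ (hh f) hl hq_bdd
      (fun s hs => by simp only [hF₂, hs, if_true]) htm.2
  refine ⟨fun f => MemLp.toLp _ (hA f), main, fun y => ?_⟩
  obtain ⟨o, ho, ho0, hoy⟩ := RingGraph.exists_isSignal (Lp.memLp y)
  obtain ⟨F, u, hF, hu, huo⟩ := RingGraph.exists_isTraceAtV₂ hl hq_cont hq_bdd hτ ho
    fun t ht => ho0 t fun hm => absurd hm.1 (not_lt.2 ht)
  have hFT : MemLp F 2 (volume.restrict (Ioo 0 T)) :=
    hF.mono_measure (Measure.restrict_mono (Ioo_subset_Ioo_right (by linarith)) le_rfl)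
  -- A second solution with the same data F, whose trace is the image of F restricted to (0, T). By
  -- uniqueness its trace agrees with the prescribed o.
  obtain ⟨u₁, o₁, hu₁, -, huo₁, ho₁⟩ := main (hFT.toLp F) F hF hFT.coeFn_toLp.symm
  refine ⟨hFT.toLp F, Lp.ext ?_⟩
  have hoo := RingGraph.IsTraceAtV₂.ae_eq hl0 (hu₁.measurable 0)
    (hu₁.ae_eq_prod hl hq_cont hq_bdd hτ hu 0) huo₁ huo
  have hoo' := ae_restrict_of_ae_restrict_of_subset
    (Ioo_subset_Ioo_left hl0.le : Ioo (l 0) (T + l 0) ⊆ Ioo 0 (T + l 0)) hoo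
  filter_upwards [ho₁, hoo', hoy] with t h1 h2 h3
  rw [← h1, ← h2, h3]
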